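/- Let $M$ be a smooth manifold (finite-dimensional, Hausdorff, $\sigma$-compact, without boundary) with a Poisson bivector field $\Pi$, and let $\#:T^*M\to TM$ be given by $\langle\beta,\#\alpha\rangle=\Pi(\alpha,\beta)$. Let $[\alpha,\beta]=\mathcal L_{\#\alpha}\beta-\mathcal L_{\#\beta}\alpha-d\,\Pi(\alpha,\beta)$ be the Lie bracket on $\Omega^1(M)$. Let $p:T^*M\to M$ be the projection, $Z\subset T^*M$ the zero section, $I_Z\subset C^\infty(T^*M)$ the ideal of functions vanishing on $Z$, $C^\infty(T^*M,Z)=C^\infty(T^*M)/\bigcap_k I_Z^k$ the algebra of formal functions, and $\mathrm{Vect}(T^*M,Z)$ the Lie algebra of formal vector fields, i.e. derivations of $C^\infty(T^*M,Z)$; a formal vector field is vertical if it annihilates $p^*C^\infty(M)$. In local coordinates $x^i$ on $M$ and dual fibre coordinates $\xi_i$ on $T^*M$, write $\hat v=v^i\xi_i$ for the operator of multiplication by the fibrewise linear function defined by a vector field $v$ on $M$, and $\hat\alpha=\alpha_i\,\partial/\partial\xi_i$ for the vertical vector field defined by $\alpha\in\Omega^1(M)$. A nonlinear formal contravariant connection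 on $(T^*M,Z)$ is an additive map $D^\bullet:\Omega^1(M)\to\mathrm{Vect}(T^*M,Z)$ with $D^{f\alpha}=p^*(f)D^\alpha$ and $[D^\alpha,p^*f]=p^*((\#\alpha)f)$ for all $\alpha\in\Omega^1(M)$, $f\in C^\infty(M)$. It is invertible if the bundle endomorphism $\psi_D$ of $T^*M$ defined by $D^\alpha_{-1}=\widehat{\psi_D(\alpha)}$ is invertible, where $D^\alpha_{-1}$ is the component of $D^\alpha$ of degree $-1$ in the fibre variables. Two such connections $(D^\bullet,{}^\dagger D^\bullet)$ are associated if $$[{}^\dagger D^\alpha,\widehat{\#\beta}]-[D^\beta,\widehat{\#\alpha}]-\widehat{\#[\alpha,\beta]}=0\qquad\text{for all }\alpha,\beta\in\Omega^1(M).$$ The curvature of $D^\bullet$ is $R^D(\alpha,\beta)=[D^\alpha,D^\beta]-D^{[\alpha,\beta]}$, a vertical formal vector field. Theorem. Let $(D^\bullet,{}^\dagger D^\bullet)$ be a pair of associated invertible nonlinear formal contravariant connections on $(T^*M,Z)$. Then the following are equivalent: (a) for every $f\in C^\infty(M)$ there is a unique $F\in C^\infty(T^*M,Z)$ with $D^\alpha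 F=0$ for all $\alpha\in\Omega^1(M)$ and $F|_Z=p^*(f)|_Z$; (b) for all $\alpha,\beta\in\Omega^1(M)$ the vertical formal vector field $R^D(\alpha,\beta)$ is in the kernel of the fibrewise presymplectic form $\Omega$ on $T^*M$ given locally by $\Omega=\frac12\pi^{ij}\,d\xi_i\wedge d\xi_j$ with $\pi^{ij}=\Pi(dx^i,dx^j)$, that is, $\iota(R^D(\alpha,\beta))\Omega=0$. -/

import Mathlib

open scoped Manifold ContDiff Bundle
open Bundle

noncomputable section

namespace FormalPoisson

/-! ## Smooth functions, vector fields and one-forms on a manifold -/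

section Basic

variable (n : ℕ) (M : Type*) [TopologicalSpace M] [ChartedSpace (EuclideanSpace ℝ (Fin n)) M]

/-- The cotangent space `T*_x M`. -/
abbrev CotangentFibre {M : Type*} [TopologicalSpace M] [ChartedSpace (EuclideanSpace ℝ (Fin n)) M]
    (x : M) : Type := TangentSpace (𝓡 n) x →L[ℝ] Bundle.Trivial M ℝ x

/-- The model fibre of the cotangent bundle. -/
abbrev CotangentModel : Type := EuclideanSpace ℝ (Fin n) →L[ℝ] ℝ

/-- The total space of the cotangent bundle `T*M`; its points are the pairs `⟨x, ξ⟩` with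
`ξ ∈ T*_x M`. -/
abbrev CotangentBundle : Type _ := TotalSpace (CotangentModel n) (CotangentFibre n (M := M))

/-- The model with corners of the manifold `T*M`. -/
abbrev cotangentModelWithCorners :
    ModelWithCorners ℝ (EuclideanSpace ℝ (Fin n) × CotangentModel n)
      (ModelProd (EuclideanSpace ℝ (Fin n)) (CotangentModel n)) :=
  (𝓡 n).prod 𝓘(ℝ, CotangentModel n)

/-- `C^∞(M)`. -/
abbrev SmoothFn : Type _ := C^∞⟮𝓡 n, M; ℝ⟯

variable [IsManifold (𝓡 n) ∞ M]

/-- `C^∞(T*M)`. -/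
abbrev SmoothFnCot : Type _ := C^∞⟮cotangentModelWithCorners n, CotangentBundle n M; ℝ⟯

/-- `Vect(M)`, the smooth vector fields on `M`. -/
abbrev VectorFieldOn : Type _ :=
  Cₛ^∞⟮𝓡 n; EuclideanSpace ℝ (Fin n), TangentSpace (𝓡 n) (M := M)⟯

/-- `Ω¹(M)`, the smooth one-forms on `M`. -/
abbrev OneForm : Type _ := Cₛ^∞⟮𝓡 n; CotangentModel n, CotangentFibre n (M := M)⟯

/-- Smooth bundle maps `T*M → TM` over the identity of `M`. -/
abbrev CotToTan : Type _ :=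
  Cₛ^∞⟮𝓡 n; CotangentModel n →L[ℝ] EuclideanSpace ℝ (Fin n),
    fun x : M => CotangentFibre n x →L[ℝ] TangentSpace (𝓡 n) x⟯

/-- Smooth bundle endomorphisms of `T*M` over the identity of `M`. -/
abbrev CotEnd : Type _ :=
  Cₛ^∞⟮𝓡 n; CotangentModel n →L[ℝ] CotangentModel n,
    fun x : M => CotangentFibre n x →L[ℝ] CotangentFibre n x⟯

end Basic

section Calculus

variable {n : ℕ} {M : Type*} [TopologicalSpace M] [ChartedSpace (EuclideanSpace ℝ (Fin n)) M]

/-- If a map into the trivial line bundle is smooth, so is its fibre component. -/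
theorem contMDiff_of_trivial {E' H' N : Type*} [NormedAddCommGroup E'] [NormedSpace ℝ E']
    [TopologicalSpace H'] {J : ModelWithCorners ℝ E' H'} [TopologicalSpace N] [ChartedSpace H' N]
    {b : N → M} {f : N → ℝ}
    (h : ContMDiff J ((𝓡 n).prod 𝓘(ℝ, ℝ)) ∞
      (fun p => (⟨b p, f p⟩ : TotalSpace ℝ (Bundle.Trivial M ℝ)))) :
    ContMDiff J 𝓘(ℝ, ℝ) ∞ f := by
  intro p
  have := ((contMDiffAt_totalSpace (F := ℝ) (E := Bundle.Trivial M ℝ)).1 (h p)).2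
  simpa using this

theorem contMDiffAt_of_trivial {E' H' N : Type*} [NormedAddCommGroup E'] [NormedSpace ℝ E']
    [TopologicalSpace H'] {J : ModelWithCorners ℝ E' H'} [TopologicalSpace N] [ChartedSpace H' N]
    {b : N → M} {f : N → ℝ} {k : ℕ∞ω} {p : N}
    (h : ContMDiffAt J ((𝓡 n).prod 𝓘(ℝ, ℝ)) k
      (fun p => (⟨b p, f p⟩ : TotalSpace ℝ (Bundle.Trivial M ℝ))) p) :
    ContMDiffAt J 𝓘(ℝ, ℝ) k f p := by
  have := ((contMDiffAt_totalSpace (F := ℝ) (E := Bundle.Trivial M ℝ)).1 h).2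
  simpa using this

variable [IsManifold (𝓡 n) ∞ M]

/-- The pairing `⟨α, X⟩` of a one-form and a vector field. -/
def pairing (α : OneForm n M) (X : VectorFieldOn n M) : SmoothFn n M :=
  ⟨fun x => α x (X x),
    contMDiff_of_trivial (n := n) (M := M) (b := id) (α.contMDiff.clm_bundle_apply X.contMDiff)⟩

/-- The product of a function and a one-form. -/
def fnSmul (f : SmoothFn n M) (α : OneForm n M) : OneForm n M :=
  ⟨fun x => f x • α x, ContMDiff.smul_section f.contMDiff α.contMDiff⟩

/-- The vector field `S(α)` for a bundle map `S : T*M → TM`. -/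
def CotToTan.app (S : CotToTan n M) (α : OneForm n M) : VectorFieldOn n M :=
  ⟨fun x => S x (α x), S.contMDiff.clm_bundle_apply α.contMDiff⟩

/-- The one-form `ψ(α)` for a bundle endomorphism `ψ` of `T*M`. -/
def CotEnd.app (ψ : CotEnd n M) (α : OneForm n M) : OneForm n M :=
  ⟨fun x => ψ x (α x), ψ.contMDiff.clm_bundle_apply α.contMDiff⟩

/-- The pull-back `p^* f` of a function on `M` to `T*M`. -/
def pullbackFn (f : SmoothFn n M) : SmoothFnCot n M :=
  ⟨fun p => f p.1, f.contMDiff.comp (contMDiff_proj _)⟩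

/-- The fibrewise linear function `(x, ξ) ↦ ⟨ξ, X_x⟩` on `T*M` defined by a vector field `X`;
in local coordinates it is `X^i(x) ξ_i`. -/
def linearFn (X : VectorFieldOn n M) : SmoothFnCot n M :=
  ⟨fun p => p.2 (X p.1), by
    refine contMDiff_of_trivial (n := n) (M := M) (b := fun p => p.1)
      (ContMDiff.clm_bundle_apply (v := fun p : CotangentBundle n M => X p.1)
        (ϕ := fun p : CotangentBundle n M => p.2) contMDiff_id ?_)
    exact X.contMDiff.comp (contMDiff_proj _)⟩

/-- The restriction of functions on `T*M` to the zero section `Z`, which is identified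
with `M`. -/
def restrictZero : SmoothFnCot n M →ₐ[ℝ] SmoothFn n M where
  toFun F := ⟨fun x => F ⟨x, 0⟩, F.contMDiff.comp (contMDiff_zeroSection ℝ _)⟩
  map_one' := rfl
  map_mul' _ _ := rfl
  map_zero' := rfl
  map_add' _ _ := rfl
  commutes' _ := rfl

/-- The differential of a function that is smooth near `x` is smooth near `x`. -/
theorem contMDiffAt_mvfderiv_section {f : M → ℝ} {x : M}
    (hf : ContMDiffAt (𝓡 n) 𝓘(ℝ, ℝ) ∞ f x) :
    ContMDiffAt (𝓡 n) ((𝓡 n).prod 𝓘(ℝ, CotangentModel n)) ∞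
      (fun y => (⟨y, mvfderiv (𝓡 n) f y⟩ : CotangentBundle n M)) x := by
  rw [contMDiffAt_hom_bundle]
  refine ⟨contMDiffAt_id, ?_⟩
  have h := ContMDiffAt.mfderiv_const (m := ∞) hf (by simp)
  refine h.congr_of_eventuallyEq (Filter.Eventually.of_forall fun y => ?_)
  ext v
  simp only [inTangentCoordinates, ContinuousLinearMap.inCoordinates,
    ContinuousLinearMap.comp_apply]
  rw [TangentBundle.continuousLinearMapAt_model_space]
  simp
  rfl

/-- The differential of a function. -/
def differential (f : SmoothFn n M) : OneForm n M :=
  ⟨fun x => mvfderiv (𝓡 n) f x, fun x => contMDiffAt_mvfderiv_section (f.contMDiff x)⟩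

/-- A one-form is smooth if its values on the coordinate frames are. -/
theorem contMDiffAt_oneForm_of_frame {γ : ∀ x : M, CotangentFibre n x} {x : M}
    (h : ∀ v : EuclideanSpace ℝ (Fin n), ContMDiffAt (𝓡 n) 𝓘(ℝ, ℝ) ∞
      (fun y => γ y ((trivializationAt (EuclideanSpace ℝ (Fin n))
        (TangentSpace (𝓡 n)) x).symmL ℝ y v)) x) :
    ContMDiffAt (𝓡 n) ((𝓡 n).prod 𝓘(ℝ, CotangentModel n)) ∞
      (fun y => (⟨y, γ y⟩ : CotangentBundle n M)) x := by
  rw [contMDiffAt_hom_bundle]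
  refine ⟨contMDiffAt_id, ?_⟩
  let b := EuclideanSpace.basisFun (Fin n) ℝ
  have key : ContMDiffAt (𝓡 n) 𝓘(ℝ, CotangentModel n) ∞
      (fun y => ∑ i : Fin n, (γ y ((trivializationAt (EuclideanSpace ℝ (Fin n))
        (TangentSpace (𝓡 n)) x).symmL ℝ y (b i)) : ℝ) •
          (EuclideanSpace.proj i : CotangentModel n)) x :=
    ContMDiffAt.sum fun i _ => (h (b i)).smul contMDiffAt_const
  refine key.congr_of_eventuallyEq (Filter.Eventually.of_forall fun y => ?_)
  ext v
  simp only [ContinuousLinearMap.inCoordinates, ContinuousLinearMap.comp_apply]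
  conv_lhs => rw [← b.sum_repr v]
  simp [b, mul_comm]

/-! ## The Lie derivative and the bracket of one-forms -/

theorem isManifold_minSmoothness : IsManifold (𝓡 n) (minSmoothness ℝ 2) M := by
  simpa using (inferInstance : IsManifold (𝓡 n) 2 M)

/-- The expression `X⟨β, Y⟩ - ⟨β, [X, Y]⟩` at a point. -/
def lieDerivAux (X : VectorFieldOn n M) (β : OneForm n M) (x : M)
    (Y : ∀ y : M, TangentSpace (𝓡 n) y) : ℝ :=
  mvfderiv (𝓡 n) (fun y => (β y (Y y) : ℝ)) x (X x) -
    β x (VectorField.mlieBracket (𝓡 n) X Y x)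

theorem mdiffAt_pairing (β : OneForm n M) {Y : ∀ y : M, TangentSpace (𝓡 n) y} {x : M}
    (hY : MDifferentiableAt (𝓡 n) ((𝓡 n).prod 𝓘(ℝ, EuclideanSpace ℝ (Fin n)))
      (fun y => (⟨y, Y y⟩ : TangentBundle (𝓡 n) M)) x) :
    MDifferentiableAt (𝓡 n) 𝓘(ℝ, ℝ) (fun y => (β y (Y y) : ℝ)) x := by
  have h := MDifferentiableAt.clm_bundle_apply (β.mdifferentiableAt (x := x)) hY
  simpa using ((mdifferentiableAt_totalSpace (F := ℝ) (E := Bundle.Trivial M ℝ) (𝓡 n) _).1 h).2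

theorem lieDerivAux_tensorial (X : VectorFieldOn n M) (β : OneForm n M) (x : M) :
    TensorialAt (𝓡 n) (EuclideanSpace ℝ (Fin n)) (lieDerivAux X β x) x where
  smul {f Y} hf hY := by
    have := isManifold_minSmoothness (n := n) (M := M)
    have h1 : (fun y => (β y ((f • Y) y) : ℝ)) = f * fun y => (β y (Y y) : ℝ) := by
      funext y; simp
    have hd := mdiffAt_pairing β hY
    simp only [lieDerivAux]
    rw [h1, mvfderiv_mul hf hd, VectorField.mlieBracket_smul_right hf hY]
    simp
    ring
  add {Y Y'} hY hY' := by
    have := isManifold_minSmoothness (n := n) (M := M)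
    have h1 : (fun y => (β y ((Y + Y') y) : ℝ)) =
        (fun y => (β y (Y y) : ℝ)) + fun y => (β y (Y' y) : ℝ) := by
      funext y; simp
    simp only [lieDerivAux]
    rw [h1, mvfderiv_add (mdiffAt_pairing β hY) (mdiffAt_pairing β hY'),
      VectorField.mlieBracket_add_right hY hY']
    simp
    ring

/-- The Lie bracket of a smooth vector field with one that is smooth near `x`. -/
theorem contMDiffAt_mlieBracket (X : VectorFieldOn n M) {Y : ∀ y : M, TangentSpace (𝓡 n) y} {x : M}
    (hY : ContMDiffAt (𝓡 n) ((𝓡 n).prod 𝓘(ℝ, EuclideanSpace ℝ (Fin n))) ∞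
      (fun y => (⟨y, Y y⟩ : TangentBundle (𝓡 n) M)) x) :
    ContMDiffAt (𝓡 n) ((𝓡 n).prod 𝓘(ℝ, EuclideanSpace ℝ (Fin n))) ∞
      (fun z => (⟨z, VectorField.mlieBracket (𝓡 n) X Y z⟩ : TangentBundle (𝓡 n) M)) x := by
  have := isManifold_minSmoothness (n := n) (M := M)
  have : IsManifold (𝓡 n) (((⊤ : ℕ∞) : ℕ∞ω) + 1) M := by
    simpa using (inferInstance : IsManifold (𝓡 n) ∞ M)
  exact ContMDiffAt.mlieBracket_vectorField (m := ⊤) (n := ⊤) (X.contMDiff x) hY (by simp)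

/-- The coordinate frames are smooth. -/
theorem contMDiffAt_frame (x : M) (v : EuclideanSpace ℝ (Fin n)) {y : M}
    (hy : y ∈ (trivializationAt (EuclideanSpace ℝ (Fin n)) (TangentSpace (𝓡 n)) x).baseSet) :
    ContMDiffAt (𝓡 n) ((𝓡 n).prod 𝓘(ℝ, EuclideanSpace ℝ (Fin n))) ∞
      (fun z => (⟨z, (trivializationAt (EuclideanSpace ℝ (Fin n))
        (TangentSpace (𝓡 n)) x).symmL ℝ z v⟩ : TangentBundle (𝓡 n) M)) y := by
  set e := trivializationAt (EuclideanSpace ℝ (Fin n)) (TangentSpace (𝓡 n) (M := M)) x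
  refine ((e.contMDiffOn_section_baseSet_iff (IB := 𝓡 n) (n := ∞)
    (s := fun z => e.symmL ℝ z v)).2 ?_).contMDiffAt (e.open_baseSet.mem_nhds hy)
  refine (contMDiffOn_const (c := v)).congr fun z hz => ?_
  simp [hz]

theorem contMDiffAt_lieDerivAux (X : VectorFieldOn n M) (β : OneForm n M)
    {Y : ∀ y : M, TangentSpace (𝓡 n) y} {x : M}
    (hY : ContMDiffAt (𝓡 n) ((𝓡 n).prod 𝓘(ℝ, EuclideanSpace ℝ (Fin n))) ∞
      (fun y => (⟨y, Y y⟩ : TangentBundle (𝓡 n) M)) x) :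
    ContMDiffAt (𝓡 n) 𝓘(ℝ, ℝ) ∞ (fun z => lieDerivAux X β z Y) x := by
  have hpair : ContMDiffAt (𝓡 n) 𝓘(ℝ, ℝ) ∞ (fun y => (β y (Y y) : ℝ)) x :=
    contMDiffAt_of_trivial (n := n) (M := M) (b := id)
      ((β.contMDiff x).clm_bundle_apply hY)
  have h1 : ContMDiffAt (𝓡 n) 𝓘(ℝ, ℝ) ∞
      (fun z => mvfderiv (𝓡 n) (fun y => (β y (Y y) : ℝ)) z (X z)) x :=
    contMDiffAt_of_trivial (n := n) (M := M) (b := id)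
      ((contMDiffAt_mvfderiv_section hpair).clm_bundle_apply (X.contMDiff x))
  have h2 : ContMDiffAt (𝓡 n) 𝓘(ℝ, ℝ) ∞
      (fun z => (β z (VectorField.mlieBracket (𝓡 n) X Y z) : ℝ)) x :=
    contMDiffAt_of_trivial (n := n) (M := M) (b := id)
      ((β.contMDiff x).clm_bundle_apply (contMDiffAt_mlieBracket X hY))
  exact h1.sub h2

/-- The Lie derivative `L_X β` as a pointwise object. -/
def lieDerivFun (X : VectorFieldOn n M) (β : OneForm n M) (x : M) : CotangentFibre n x :=
  TensorialAt.mkHom (lieDerivAux X β x) x (lieDerivAux_tensorial X β x)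

theorem lieDerivFun_apply (X : VectorFieldOn n M) (β : OneForm n M) {x : M}
    {Y : ∀ y : M, TangentSpace (𝓡 n) y}
    (hY : MDifferentiableAt (𝓡 n) ((𝓡 n).prod 𝓘(ℝ, EuclideanSpace ℝ (Fin n)))
      (fun y => (⟨y, Y y⟩ : TangentBundle (𝓡 n) M)) x) :
    (lieDerivFun X β x (Y x) : ℝ) = lieDerivAux X β x Y :=
  TensorialAt.mkHom_apply (lieDerivAux_tensorial X β x) hY

theorem contMDiff_lieDerivFun (X : VectorFieldOn n M) (β : OneForm n M) :
    ContMDiff (𝓡 n) ((𝓡 n).prod 𝓘(ℝ, CotangentModel n)) ∞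
      (fun y => (⟨y, lieDerivFun X β y⟩ : CotangentBundle n M)) := by
  intro x
  apply contMDiffAt_oneForm_of_frame
  intro v
  have hx : x ∈ (trivializationAt (EuclideanSpace ℝ (Fin n)) (TangentSpace (𝓡 n)) x).baseSet :=
    FiberBundle.mem_baseSet_trivializationAt' x
  have h1 := contMDiffAt_lieDerivAux X β (contMDiffAt_frame x v hx)
  have h2 : ∀ᶠ y in nhds x, (lieDerivFun X β y ((trivializationAt (EuclideanSpace ℝ (Fin n))
        (TangentSpace (𝓡 n)) x).symmL ℝ y v) : ℝ) =
      lieDerivAux X β y (fun z => (trivializationAt (EuclideanSpace ℝ (Fin n))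
        (TangentSpace (𝓡 n)) x).symmL ℝ z v) := by
    filter_upwards [(trivializationAt (EuclideanSpace ℝ (Fin n))
      (TangentSpace (𝓡 n)) x).open_baseSet.mem_nhds hx] with y hy
    have h3 := (contMDiffAt_frame x v hy).mdifferentiableAt (by simp)
    exact lieDerivFun_apply X β (Y := fun z => (trivializationAt (EuclideanSpace ℝ (Fin n))
        (TangentSpace (𝓡 n)) x).symmL ℝ z v) h3
  exact h1.congr_of_eventuallyEq h2

/-- The Lie derivative `L_X β`, the one-form with `⟨L_X β, Y⟩ = X⟨β, Y⟩ - ⟨β, [X, Y]⟩` for every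
vector field `Y`. -/
def lieDerivative (X : VectorFieldOn n M) (β : OneForm n M) : OneForm n M :=
  ⟨lieDerivFun X β, contMDiff_lieDerivFun X β⟩

end Calculus

/-! ## Poisson structures -/

section Poisson

variable {n : ℕ} {M : Type*} [TopologicalSpace M] [ChartedSpace (EuclideanSpace ℝ (Fin n)) M]
  [IsManifold (𝓡 n) ∞ M]

/-- The function `Π(α, β) = ⟨β, #α⟩` for a bundle map `# : T*M → TM`. -/
def bivectorPairing (sharp : CotToTan n M) (α β : OneForm n M) : SmoothFn n M :=
  pairing β (sharp.app α)

/-- The bracket `{f, g} = Π(df, dg)`. -/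
def bracketOf (sharp : CotToTan n M) (f g : SmoothFn n M) : SmoothFn n M :=
  bivectorPairing sharp (differential f) (differential g)

variable (n M) in
/-- A Poisson structure on `M`. The smooth bivector field `Π` is given by the bundle map
`# : T*M → TM`, `⟨b, #a⟩ = Π(a, b)`; the skew-symmetry of `Π` and the Jacobi identity of the
bracket `{f, g} = Π(df, dg)` are required. -/
structure PoissonStructure where
  /-- the bundle map `#` -/
  sharp : CotToTan n M
  skew : ∀ (x : M) (a b : CotangentFibre n x), (b (sharp x a) : ℝ) = -(a (sharp x b) : ℝ)
  jacobi : ∀ f g h : SmoothFn n M,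
    bracketOf sharp f (bracketOf sharp g h) + bracketOf sharp g (bracketOf sharp h f) +
      bracketOf sharp h (bracketOf sharp f g) = 0

namespace PoissonStructure

variable (P : PoissonStructure n M)

/-- `Π(α, β)`. -/
def bivector (α β : OneForm n M) : SmoothFn n M := bivectorPairing P.sharp α β

/-- The vector field `#α`. -/
def sharpField (α : OneForm n M) : VectorFieldOn n M := P.sharp.app α

/-- The Lie bracket of one-forms `[α, β] = L_{#α} β - L_{#β} α - dΠ(α, β)`. -/
def formBracket (α β : OneForm n M) : OneForm n M :=
  lieDerivative (P.sharpField α) β - lieDerivative (P.sharpField β) α -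
    differential (P.bivector α β)

end PoissonStructure

end Poisson

/-! ## The formal neighbourhood `(T*M, Z)` of the zero section -/

section Formal

variable {n : ℕ} {M : Type*} [TopologicalSpace M] [ChartedSpace (EuclideanSpace ℝ (Fin n)) M]
  [IsManifold (𝓡 n) ∞ M]

variable (n M) in
/-- The ideal `I_Z` of the functions on `T*M` that vanish on the zero section. -/
def zeroIdeal : Ideal (SmoothFnCot n M) := RingHom.ker (restrictZero (n := n) (M := M))

variable (n M) in
/-- The intersection of all powers of `I_Z`. -/
def flatIdeal : Ideal (SmoothFnCot n M) := ⨅ k : ℕ, zeroIdeal n M ^ k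

variable (n M) in
/-- The algebra `C^∞(T*M, Z) = C^∞(T*M) / ⋂ₖ I_Z^k` of formal functions. -/
abbrev FormalFn : Type _ := SmoothFnCot n M ⧸ flatIdeal n M

variable (n M) in
/-- `Vect(T*M, Z)`, the Lie algebra of formal vector fields: the derivations of the algebra of
formal functions. -/
abbrev FormalVectorField : Type _ := Derivation ℝ (FormalFn n M) (FormalFn n M)

/-- The formal function represented by a smooth function on `T*M`. -/
def toFormal (F : SmoothFnCot n M) : FormalFn n M := Ideal.Quotient.mk (flatIdeal n M) F

/-- The formal function `p^* f`. -/
def pullback (f : SmoothFn n M) : FormalFn n M := toFormal (pullbackFn f)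

/-- The formal function whose multiplication operator is `X̂`; locally it is `X^i(x) ξ_i`. -/
def hatField (X : VectorFieldOn n M) : FormalFn n M := toFormal (linearFn X)

theorem flatIdeal_le : flatIdeal n M ≤ zeroIdeal n M :=
  (iInf_le _ 1).trans (by rw [pow_one])

/-- The restriction `F ↦ F|_Z` of formal functions, where `Z` is identified with `M`. -/
def restrict : FormalFn n M →ₐ[ℝ] SmoothFn n M :=
  Ideal.Quotient.liftₐ (flatIdeal n M) restrictZero fun _ hF => flatIdeal_le hF

/-! ### The vertical derivations `α̂ = α_i ∂/∂ξ_i` -/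

/-- The smooth map `((x, ξ), t) ↦ (x, ξ + t α_x)`. -/
theorem contMDiff_translate (α : OneForm n M) :
    ContMDiff ((cotangentModelWithCorners n).prod 𝓘(ℝ, ℝ)) (cotangentModelWithCorners n) ∞
      (fun q : CotangentBundle n M × ℝ => (⟨q.1.1, q.1.2 + q.2 • α q.1.1⟩ : CotangentBundle n M)) := by
  intro q₀
  rw [contMDiffAt_totalSpace]
  let e := trivializationAt (CotangentModel n) (CotangentFibre n (M := M)) q₀.1.1
  have hbase : ContMDiff ((cotangentModelWithCorners n).prod 𝓘(ℝ, ℝ)) (𝓡 n) ∞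
      (fun q : CotangentBundle n M × ℝ => q.1.1) := (contMDiff_proj _).comp contMDiff_fst
  refine ⟨hbase q₀, ?_⟩
  have h1 : ContMDiffAt ((cotangentModelWithCorners n).prod 𝓘(ℝ, ℝ)) 𝓘(ℝ, CotangentModel n) ∞
      (fun q : CotangentBundle n M × ℝ => (e q.1).2) q₀ :=
    ((contMDiffAt_totalSpace (IB := 𝓡 n)).1 (contMDiff_fst q₀)).2
  have h2 : ContMDiffAt ((cotangentModelWithCorners n).prod 𝓘(ℝ, ℝ)) 𝓘(ℝ, CotangentModel n) ∞
      (fun q : CotangentBundle n M × ℝ => (e (⟨q.1.1, α q.1.1⟩ : CotangentBundle n M)).2) q₀ :=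
    ((contMDiffAt_totalSpace (IB := 𝓡 n)).1 ((α.contMDiff.comp hbase) q₀)).2
  have h3 : ContMDiffAt ((cotangentModelWithCorners n).prod 𝓘(ℝ, ℝ)) 𝓘(ℝ, ℝ) ∞
      (fun q : CotangentBundle n M × ℝ => q.2) q₀ := contMDiff_snd q₀
  refine (h1.add (h3.smul h2)).congr_of_eventuallyEq ?_
  have hmem : ∀ᶠ q : CotangentBundle n M × ℝ in nhds q₀, q.1.1 ∈ e.baseSet :=
    hbase.continuous.continuousAt.eventually
      (e.open_baseSet.mem_nhds (FiberBundle.mem_baseSet_trivializationAt' q₀.1.1))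
  filter_upwards [hmem] with q hq
  have hlin := e.linear ℝ hq
  have ha := hlin.map_add q.1.2 (q.2 • α q.1.1)
  have hs := hlin.map_smul q.2 (α q.1.1)
  exact ha.trans (congrArg _ hs)

theorem contMDiff_line (F : SmoothFnCot n M) (α : OneForm n M) :
    ContMDiff ((cotangentModelWithCorners n).prod 𝓘(ℝ, ℝ)) 𝓘(ℝ, ℝ) ∞
      (fun q : CotangentBundle n M × ℝ =>
        F (⟨q.1.1, q.1.2 + q.2 • α q.1.1⟩ : CotangentBundle n M)) :=
  F.contMDiff.comp (contMDiff_translate α)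

theorem differentiable_line (F : SmoothFnCot n M) (α : OneForm n M) (p : CotangentBundle n M) :
    Differentiable ℝ (fun t : ℝ => F (⟨p.1, p.2 + t • α p.1⟩ : CotangentBundle n M)) := by
  have h : ContMDiff 𝓘(ℝ, ℝ) ((cotangentModelWithCorners n).prod 𝓘(ℝ, ℝ)) ∞
      (fun t : ℝ => (p, t)) := contMDiff_const.prodMk contMDiff_id
  exact ((contMDiff_line F α).comp h).contDiff.differentiable (by simp)

/-- The derivative of `F` along the fibres of `T*M` in the direction of `α`. -/
def fibreDeriv (α : OneForm n M) (F : SmoothFnCot n M) : SmoothFnCot n M where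
  val p := deriv (fun t : ℝ => F (⟨p.1, p.2 + t • α p.1⟩ : CotangentBundle n M)) 0
  property := by
    intro p
    have h := ContMDiffAt.mfderiv_apply (x₀ := p) (m := ∞)
      (J := cotangentModelWithCorners n) (J' := cotangentModelWithCorners n)
      (I := 𝓘(ℝ, ℝ)) (I' := 𝓘(ℝ, ℝ))
      (fun (p : CotangentBundle n M) (t : ℝ) =>
        F (⟨p.1, p.2 + t • α p.1⟩ : CotangentBundle n M)) (fun _ => 0) id (fun _ => 1)
      ((contMDiff_line F α) (p, 0)) contMDiffAt_const contMDiffAt_id contMDiffAt_const (by simp)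
    refine h.congr_of_eventuallyEq (Filter.Eventually.of_forall fun q => ?_)
    simp only [inTangentCoordinates, ContinuousLinearMap.inCoordinates,
      ContinuousLinearMap.comp_apply]
    rw [TangentBundle.continuousLinearMapAt_model_space, TangentBundle.symmL_model_space]
    rw [mfderiv_eq_fderiv]
    rfl

/-- The derivation `α_i ∂/∂ξ_i` of `C^∞(T*M)`. -/
def fibreDerivation (α : OneForm n M) : Derivation ℝ (SmoothFnCot n M) (SmoothFnCot n M) :=
  Derivation.mk'
    { toFun := fibreDeriv α
      map_add' := fun F G => by
        ext p
        exact deriv_add (differentiable_line F α p 0) (differentiable_line G α p 0)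
      map_smul' := fun c F => by
        ext p
        exact deriv_const_smul c (differentiable_line F α p 0) }
    fun F G => by
      ext p
      have := deriv_mul (differentiable_line F α p 0) (differentiable_line G α p 0)
      simp only [zero_smul, add_zero] at this
      refine this.trans ?_
      rw [add_comm, mul_comm (deriv _ _)]
      rfl

/-- A derivation maps `I^(k+1)` to `I^k`. -/
theorem derivation_pow {R : Type*} [CommRing R] [Algebra ℝ R] (d : Derivation ℝ R R) (I : Ideal R)
    (k : ℕ) : ∀ F ∈ I ^ (k + 1), d F ∈ I ^ k := by
  induction k with
  | zero => simp
  | succ k ih =>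
    intro F hF
    rw [pow_succ] at hF
    refine Submodule.mul_induction_on hF (fun a ha b hb => ?_) fun a b ha hb => ?_
    · rw [d.leibniz]
      refine Ideal.add_mem _ (Ideal.mul_mem_right _ _ ha) ?_
      rw [pow_succ, smul_eq_mul, mul_comm b]
      exact Ideal.mul_mem_mul (ih a ha) hb
    · rw [map_add]
      exact Ideal.add_mem _ ha hb

theorem derivation_flat (d : Derivation ℝ (SmoothFnCot n M) (SmoothFnCot n M))
    {F : SmoothFnCot n M} (hF : F ∈ flatIdeal n M) : d F ∈ flatIdeal n M := by
  rw [flatIdeal, Submodule.mem_iInf] at hF ⊢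
  exact fun k => derivation_pow d _ k F (hF (k + 1))

theorem derivation_descends (d : Derivation ℝ (SmoothFnCot n M) (SmoothFnCot n M)) :
    ∀ F : SmoothFnCot n M, Ideal.Quotient.mkₐ ℝ (flatIdeal n M) F = 0 →
      Ideal.Quotient.mkₐ ℝ (flatIdeal n M) (d F) = 0 := fun _ hF =>
  Ideal.Quotient.eq_zero_iff_mem.2 (derivation_flat d (Ideal.Quotient.eq_zero_iff_mem.1 hF))

/-- The formal vector field `F mod ⋂ₖ I_Z^k ↦ d F mod ⋂ₖ I_Z^k` defined by a derivation `d` of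
`C^∞(T*M)`. -/
def formalOfDerivation (d : Derivation ℝ (SmoothFnCot n M) (SmoothFnCot n M)) :
    FormalVectorField n M :=
  Derivation.liftOfSurjective (f := Ideal.Quotient.mkₐ ℝ (flatIdeal n M))
    (Ideal.Quotient.mkₐ_surjective ℝ _) (derivation_descends d)

theorem formalOfDerivation_apply (d : Derivation ℝ (SmoothFnCot n M) (SmoothFnCot n M))
    (F : SmoothFnCot n M) : formalOfDerivation d (toFormal F) = toFormal (d F) :=
  Derivation.liftOfSurjective_apply (f := Ideal.Quotient.mkₐ ℝ (flatIdeal n M))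
    (Ideal.Quotient.mkₐ_surjective ℝ _) (derivation_descends d) F

/-- The vertical formal vector field `α̂`, locally `α_i ∂/∂ξ_i`. -/
def hatForm (α : OneForm n M) : FormalVectorField n M := formalOfDerivation (fibreDerivation α)

end Formal

/-! ## Nonlinear contravariant connections on `(T*M, Z)` -/

section Connections

variable {n : ℕ} {M : Type*} [TopologicalSpace M] [ChartedSpace (EuclideanSpace ℝ (Fin n)) M]
  [IsManifold (𝓡 n) ∞ M]

/-- The operator of multiplication by a formal function. -/
def mulOp (F : FormalFn n M) : Module.End ℝ (FormalFn n M) := LinearMap.mulLeft ℝ F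

/-- A formal vector field as an operator on formal functions. -/
def vectOp (U : FormalVectorField n M) : Module.End ℝ (FormalFn n M) :=
  (U : FormalFn n M →ₗ[ℝ] FormalFn n M)

/-- The commutator `[S, T] = S T - T S` of operators on formal functions. -/
def opComm (S T : Module.End ℝ (FormalFn n M)) : Module.End ℝ (FormalFn n M) :=
  S ∘ₗ T - T ∘ₗ S

/-- The derivative `X f` of a function `f` along a vector field `X`. -/
def fieldDeriv (X : VectorFieldOn n M) (f : SmoothFn n M) : SmoothFn n M :=
  pairing (differential f) X

/-- A nonlinear contravariant connection on the formal neighbourhood `(T*M, Z)`: an additive map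
`α ↦ D^α` from one-forms to formal vector fields with `D^{fα} = p^*(f) D^α` and
`[D^α, p^* f] = p^*((#α) f)`. -/
structure FormalConnection (P : PoissonStructure n M) where
  /-- the map `α ↦ D^α` -/
  op : OneForm n M → FormalVectorField n M
  op_add : ∀ α β : OneForm n M, op (α + β) = op α + op β
  op_fnSmul : ∀ (f : SmoothFn n M) (α : OneForm n M), op (fnSmul f α) = pullback f • op α
  op_pullback : ∀ (α : OneForm n M) (f : SmoothFn n M),
    opComm (vectOp (op α)) (mulOp (pullback f)) = mulOp (pullback (fieldDeriv (P.sharpField α) f))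

/-- A formal vector field that has no homogeneous components of negative degree (in the fibre
variables): it preserves the filtration of the formal functions by the powers of the ideal of the
zero section. -/
def NonnegDegree (U : FormalVectorField n M) : Prop :=
  ∀ (k : ℕ) (F : FormalFn n M),
    F ∈ RingHom.ker (restrict (n := n) (M := M)) ^ k →
      U F ∈ RingHom.ker (restrict (n := n) (M := M)) ^ k

namespace FormalConnection

variable {P : PoissonStructure n M}

/-- The component of degree `-1` of `D^α` is the vertical field defined by the one-form `ψ(α)`,
for every one-form `α`. -/
def HasLeadingTerm (D : FormalConnection P) (ψ : CotEnd n M) : Prop :=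
  ∀ α : OneForm n M, NonnegDegree (D.op α - hatForm (ψ.app α))

/-- `D` is invertible: the endomorphism `ψ_D` of `T*M` that gives the component of degree `-1`
of `D` is invertible. -/
def IsInvertible (D : FormalConnection P) : Prop :=
  ∃ ψ : CotEnd n M, D.HasLeadingTerm ψ ∧ ∀ x : M, Function.Bijective (ψ x)

/-- The connections `D` and `D'` are associated:
`[D'^α, (#β)^] - [D^β, (#α)^] - (#[α, β])^ = 0` for all one-forms `α, β`. -/
def Associated (D D' : FormalConnection P) : Prop :=
  ∀ α β : OneForm n M,
    opComm (vectOp (D'.op α)) (mulOp (hatField (P.sharpField β))) -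
        opComm (vectOp (D.op β)) (mulOp (hatField (P.sharpField α))) -
      mulOp (hatField (P.sharpField (P.formBracket α β))) = 0

/-- The curvature `R^D(α, β) = [D^α, D^β] - D^{[α, β]}`. -/
def curvature (D : FormalConnection P) (α β : OneForm n M) : FormalVectorField n M :=
  ⁅D.op α, D.op β⁆ - D.op (P.formBracket α β)

end FormalConnection

/-! ### The fibrewise presymplectic form `Ω = ½ π^{ij} dξ_i ∧ dξ_j` -/

/-- A formal vector field is vertical if it annihilates the functions `p^* f`. -/
def IsVertical (U : FormalVectorField n M) : Prop :=
  ∀ f : SmoothFn n M, U (pullback f) = 0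

/-- The vector fields `e_1, …, e_n` and the one-forms `ε^1, …, ε^n` are dual to each other at the
points of `W`. -/
def DualOn (W : Set M) (e : Fin n → VectorFieldOn n M) (ε : Fin n → OneForm n M) : Prop :=
  ∀ x ∈ W, ∀ i j : Fin n, (ε i x (e j x) : ℝ) = if i = j then 1 else 0

/-- The value `½ π^{ij} (dξ_i ∧ dξ_j)(U, V)` on vertical fields `U, V`, written in a local frame
`e` with dual frame `ε`: the fibre coordinates `ξ_i` are the fibrewise linear functions defined by
the `e_i`, and `π^{ij} = Π(ε^i, ε^j)`. Over a set on which `e` and `ε` are dual to each other this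
does not depend on the frame. -/
def localPresymplectic (P : PoissonStructure n M) (e : Fin n → VectorFieldOn n M)
    (ε : Fin n → OneForm n M) (U V : FormalVectorField n M) : FormalFn n M :=
  (1 / 2 : ℝ) • ∑ i, ∑ j, pullback (P.bivector (ε i) (ε j)) *
    (U (hatField (e i)) * V (hatField (e j)) - U (hatField (e j)) * V (hatField (e i)))

/-- `ι(U) Ω = 0`: the formal function `Ω(U, V)` vanishes for every vertical field `V`. The form
`Ω` is given locally, so its vanishing is tested over the open sets `W` with a frame, after
multiplication by functions with support in `W`. -/
def InKernel (P : PoissonStructure n M) (U : FormalVectorField n M) : Prop :=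
  ∀ W : Set M, IsOpen W → ∀ (e : Fin n → VectorFieldOn n M) (ε : Fin n → OneForm n M),
    DualOn W e ε → ∀ f : SmoothFn n M, tsupport f ⊆ W →
      ∀ V : FormalVectorField n M, IsVertical V →
        pullback f * localPresymplectic P e ε U V = 0

end Connections
end FormalPoisson
end

noncomputable section

open scoped Topology
open Filter

namespace FormalPoisson

/-! ### Derivations of a ring separated by the powers of an ideal -/

section Algebra

variable {A ι : Type*} [CommRing A] [Algebra ℝ A] [Fintype ι]

/-! In coordinates put D_i = D^{dx_i}, p_ij = Π(dx_i, dx_j), V_ij = D_i ξ_j, and let V' be the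
matrix of the associated connection. By the Jacobi identity # respects brackets
(`fieldDeriv_formBracket`). Hence the derivatives of p drop out of the association condition, and
what remains is V' pᵀ = p Vᵀ, that is V p = -p V'ᵀ (`associated_matrix`). Near Z the matrices V, V'
are invertible, since on Z they represent the invertible endomorphisms ψ. The curvature R is
vertical, again because # respects brackets; it is determined by the row r_i = R ξ_i, and ι(R)Ω = 0
means r p = 0 (`inKernel_iff`). In both directions one compares R with Σ c_i D_i, where c = r V⁻¹ is
chosen so that the two agree on the ξ_i.

From (a) to (b) (`FormalFrame.kernel_of_solutions`): R and Σ c_i D_i both annihilate every solution.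
Solutions with arbitrary initial values together with the ξ_i determine a derivation, so R = Σ c_i
D_i. Evaluation at x_j gives c p = 0, and then r p = c V p = -c p V'ᵀ = 0.

From (b) to (a) (`FormalFrame.mem_span_of_kernel`): c p = r V⁻¹ p = -r p (V'ᵀ)⁻¹ = 0, so Σ c_i D_i
is vertical and equals R. The D_i are therefore in involution, and the combinations T = V⁻¹ D, which
are dual to the ξ_i, commute (`lie_eq_zero_of_dual`). This is a formal Frobenius situation: T_i F =
0 is solved degree by degree, the correction at each step being -Σ ξ_i T_i g divided by the degree.
Since Σ ξ_i T_i acts as multiplication by k on terms of order k, up to higher order, the step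
succeeds (`derivation_correction_mem`), and a solution vanishing on Z has infinite order
(`mem_span_pow_of_forall_eq_zero`).

The passage between formal series and smooth functions rests on three facts. A formal function
vanishes once its infinite jets at all points of Z vanish, because flat functions can be divided by
every power of a fibrewise quadratic form (`mem_flatIdeal_of_forall`); so identities are checked in
the stalks, which are separated rings. Hadamard's lemma expands functions in the ξ_i with
coefficients valid over a whole open set. Borel's lemma sums the homogeneous terms found by the
recursion. Local solutions are then glued by a partition of unity, uniqueness making them agree on
overlaps. -/

theorem derivation_sum_smul_apply (c : ι → A) (D : ι → Derivation ℝ A A) (a : A) :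
    (∑ i, c i • D i) a = ∑ i, c i * D i a := by
  have h := map_sum (Derivation.coeFnAddMonoidHom : Derivation ℝ A A →+ A → A)
    (fun i => c i • D i) Finset.univ
  refine (congrFun h a).trans ?_
  rw [Finset.sum_apply]
  rfl

/-- Elements `ξ_i` of an ideal `m` with `⋂ m^k = 0` such that every element is the sum of an
element of `B` and of a combination of the `ξ_i`. -/
structure FormalFrame (m : Ideal A) (B : Set A) (ξ : ι → A) : Prop where
  separated : ∀ a, (∀ k, a ∈ m ^ k) → a = 0
  mem : ∀ i, ξ i ∈ m
  expand : ∀ a, ∃ b ∈ B, ∃ c : ι → A, a = b + ∑ i, c i * ξ i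

namespace FormalFrame

variable {m : Ideal A} {B : Set A} {ξ : ι → A}

theorem derivation_combination (U : Derivation ℝ A A) (hξ : ∀ i, U (ξ i) = 0) (c : ι → A) :
    U (∑ i, c i * ξ i) = ∑ i, ξ i * U (c i) := by
  simp [map_sum, hξ]

theorem combination_mem (h : FormalFrame m B ξ) {k : ℕ} (U : Derivation ℝ A A)
    (hU : ∀ a, U a ∈ m ^ k) (c : ι → A) : ∑ i, ξ i * U (c i) ∈ m ^ (k + 1) := by
  rw [pow_succ']
  exact Ideal.sum_mem _ fun i _ => Ideal.mul_mem_mul (h.mem i) (hU _)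

/-- Writing a as an element of B plus Σ c_i ξ_i gives U a = Σ ξ_i U(c_i). So if all values of U lie
in m^k, they lie in m^(k+1), and separation concludes. -/
theorem derivation_eq_zero (h : FormalFrame m B ξ) (U : Derivation ℝ A A)
    (hB : ∀ b ∈ B, U b = 0) (hξ : ∀ i, U (ξ i) = 0) : U = 0 := by
  have key : ∀ k : ℕ, ∀ a, U a ∈ m ^ k := by
    intro k
    induction k with
    | zero => simp
    | succ k ih =>
      intro a
      obtain ⟨b, hb, c, rfl⟩ := h.expand a
      rw [map_add, hB b hb, zero_add, derivation_combination U hξ]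
      exact h.combination_mem U ih c
  ext a
  exact h.separated _ fun k => key k a

/-- A derivation that annihilates the `ξ_i` and the elements of a set of representatives of `B`
modulo the `ξ_i` vanishes. -/
theorem derivation_eq_zero_of_solutions (h : FormalFrame m B ξ) (U : Derivation ℝ A A)
    (hB : ∀ b ∈ B, ∃ c : ι → A, U (b + ∑ i, c i * ξ i) = 0) (hξ : ∀ i, U (ξ i) = 0) : U = 0 := by
  have key : ∀ k : ℕ, ∀ a, U a ∈ m ^ k := by
    intro k
    induction k with
    | zero => simp
    | succ k ih =>
      intro a
      obtain ⟨b, hb, c, rfl⟩ := h.expand a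
      obtain ⟨c', hc'⟩ := hB b hb
      rw [map_add, derivation_combination U hξ] at hc' ⊢
      -- The annihilated element over b expresses U b as -Σ ξ_i U(c'_i), which gains one order just
      -- as the second sum does.
      rw [eq_neg_of_add_eq_zero_left hc']
      exact Ideal.add_mem _ (neg_mem (h.combination_mem U ih c')) (h.combination_mem U ih c)
  ext a
  exact h.separated _ fun k => key k a

end FormalFrame

/-! ### The Euler operator of a dual system and formal integration -/

section Euler

variable [DecidableEq ι] {ξ : ι → A} {T : ι → Derivation ℝ A A}

theorem frame_mem_span {A ι : Type*} [CommRing A] (ξ : ι → A) (i : ι) : ξ i ∈ Ideal.span (Set.range ξ) :=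
  Ideal.subset_span ⟨i, rfl⟩

/-- The Euler derivation acts on the `k`-th power of the ideal of the `ξ_i` as multiplication by
`k`, up to higher order. -/
theorem euler_sub_mem (hT : ∀ i j, T i (ξ j) = if i = j then 1 else 0) (k : ℕ) :
    ∀ a ∈ Ideal.span (Set.range ξ) ^ k,
      ∑ i, ξ i * T i a - k * a ∈ Ideal.span (Set.range ξ) ^ (k + 1) := by
  set I := Ideal.span (Set.range ξ)
  have h0 : ∀ a, ∑ i, ξ i * T i a ∈ I := fun a =>
    Ideal.sum_mem _ fun i _ => Ideal.mul_mem_right _ _ (frame_mem_span ξ i)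
  -- The Euler operator is itself a derivation, so degrees add under products and the case of degree
  -- one carries the induction.
  have hmul : ∀ a b, ∑ i, ξ i * T i (a * b) =
      a * (∑ i, ξ i * T i b) + b * ∑ i, ξ i * T i a := by
    intro a b
    rw [Finset.mul_sum, Finset.mul_sum, ← Finset.sum_add_distrib]
    refine Finset.sum_congr rfl fun i _ => ?_
    rw [Derivation.leibniz, smul_eq_mul, smul_eq_mul]
    ring
  have hadd : ∀ a b, ∑ i, ξ i * T i (a + b) = (∑ i, ξ i * T i a) + ∑ i, ξ i * T i b := by
    intro a b
    simp [mul_add, Finset.sum_add_distrib]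
  have h1 : ∀ a ∈ I, ∑ i, ξ i * T i a - a ∈ I ^ 2 := by
    intro a ha
    induction ha using Submodule.span_induction with
    | mem x hx =>
      obtain ⟨j, rfl⟩ := hx
      simp [hT]
    | zero => simp
    | add a b _ _ ha hb =>
      rw [hadd]
      convert Ideal.add_mem _ ha hb using 1
      ring
    | smul c a ha' ha =>
      rw [smul_eq_mul, hmul]
      have : c * (∑ i, ξ i * T i a) + a * (∑ i, ξ i * T i c) - c * a =
          c * (∑ i, ξ i * T i a - a) + a * (∑ i, ξ i * T i c) := by ring
      rw [this, pow_two]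
      rw [pow_two] at ha
      exact Ideal.add_mem _ (Ideal.mul_mem_left _ _ ha) (Ideal.mul_mem_mul ha' (h0 c))
  induction k with
  | zero => simpa using fun a => h0 a
  | succ k ih =>
    intro a ha
    rw [pow_succ] at ha
    refine Submodule.mul_induction_on ha (fun x hx y hy => ?_) fun x y hx hy => ?_
    · rw [hmul]
      have : x * (∑ i, ξ i * T i y) + y * (∑ i, ξ i * T i x) - ((k + 1 : ℕ) : A) * (x * y) =
          x * (∑ i, ξ i * T i y - y) + (∑ i, ξ i * T i x - k * x) * y := by
        push_cast; ring
      rw [this]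
      refine Ideal.add_mem _ ?_ ?_
      · rw [show k + 1 + 1 = k + 2 from rfl, pow_add]
        exact Ideal.mul_mem_mul hx (h1 y hy)
      · rw [pow_succ _ (k + 1)]
        exact Ideal.mul_mem_mul (ih x hx) hy
    · rw [hadd]
      convert Ideal.add_mem _ hx hy using 1
      ring

theorem mem_of_natCast_mul_mem {I : Ideal A} {k : ℕ} (hk : k ≠ 0) {a : A} (h : (k : A) * a ∈ I) :
    a ∈ I := by
  have h2 : a = algebraMap ℝ A (k : ℝ)⁻¹ * ((k : A) * a) := by
    rw [← mul_assoc, ← map_natCast (algebraMap ℝ A) k, ← map_mul,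
      inv_mul_cancel₀ (by exact_mod_cast hk), map_one, one_mul]
  rw [h2]
  exact Ideal.mul_mem_left _ _ h

/-- The Euler operator annihilates a, yet on I^(k+1) it is multiplication by k + 1 modulo I^(k+2).
As k + 1 is invertible in a real algebra, a climbs one order at a time. -/
theorem mem_span_pow_of_forall_eq_zero (hT : ∀ i j, T i (ξ j) = if i = j then 1 else 0) {a : A}
    (ha : a ∈ Ideal.span (Set.range ξ)) (h : ∀ i, T i a = 0) (k : ℕ) :
    a ∈ Ideal.span (Set.range ξ) ^ (k + 1) := by
  induction k with
  | zero => simpa using ha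
  | succ k ih =>
    have := euler_sub_mem hT (k + 1) a ih
    simp only [h, mul_zero, Finset.sum_const_zero, zero_sub, neg_mem_iff] at this
    exact mem_of_natCast_mul_mem (Nat.succ_ne_zero k) this

/-- Uniqueness of formal solutions: a has infinite order in the ξ_i, and these lie in the separated
ideal m. -/
theorem FormalFrame.eq_zero_of_forall_eq_zero {m : Ideal A} {B : Set A}
    (hF : FormalFrame m B ξ) (hT : ∀ i j, T i (ξ j) = if i = j then 1 else 0) {a : A}
    (ha : a ∈ Ideal.span (Set.range ξ)) (h : ∀ i, T i a = 0) : a = 0 := by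
  have hle : Ideal.span (Set.range ξ) ≤ m := by
    rw [Ideal.span_le]
    rintro _ ⟨i, rfl⟩
    exact hF.mem i
  refine hF.separated a fun k => Ideal.pow_le_pow_right (Nat.le_succ k) ?_
  exact Ideal.pow_right_mono hle _ (mem_span_pow_of_forall_eq_zero hT ha h k)

/-- One step in the construction of a formal solution of `T_i F = 0` for commuting `T_i`. -/
theorem derivation_correction_mem (hT : ∀ i j, T i (ξ j) = if i = j then 1 else 0)
    (hcomm : ∀ i j, ⁅T i, T j⁆ = 0) {k : ℕ} {g : A}
    (hg : ∀ i, T i g ∈ Ideal.span (Set.range ξ) ^ k) (j : ι) :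
    T j (g - ((k : ℝ) + 1)⁻¹ • ∑ i, ξ i * T i g) ∈ Ideal.span (Set.range ξ) ^ (k + 1) := by
  have hc : ∀ i, T j (T i g) = T i (T j g) := by
    intro i
    have := congrArg (fun U : Derivation ℝ A A => U g) (hcomm j i)
    simpa [Derivation.commutator_apply, sub_eq_zero] using this
  -- T_j hits the factor ξ_j once and otherwise commutes past T_i. The result is (1 + Euler) applied
  -- to T_j g, hence (k + 1) T_j g up to order k + 1; this is where the factor (k + 1)⁻¹ comes from.
  have h1 : T j (∑ i, ξ i * T i g) = T j g + ∑ i, ξ i * T i (T j g) := by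
    simp [map_sum, hT, hc, Finset.sum_add_distrib, add_comm]
  have h2 := euler_sub_mem hT k _ (hg j)
  have h3 : T j (g - ((k : ℝ) + 1)⁻¹ • ∑ i, ξ i * T i g) =
      -(algebraMap ℝ A ((k : ℝ) + 1)⁻¹ * (∑ i, ξ i * T i (T j g) - k * T j g)) := by
    have h4 : algebraMap ℝ A ((k : ℝ) + 1)⁻¹ * ((k : A) + 1) = 1 := by
      rw [← map_natCast (algebraMap ℝ A) k, ← map_one (algebraMap ℝ A), ← map_add, ← map_mul,
        inv_mul_cancel₀ (by positivity)]
    rw [map_sub, Derivation.map_smul, h1, Algebra.smul_def]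
    linear_combination (-(T j) g) * h4
  rw [h3]
  exact neg_mem (Ideal.mul_mem_left _ _ h2)

end Euler

/-! ### Involutive systems and commuting dual derivations -/

section Involutive

variable {ξ : ι → A} {D : ι → Derivation ℝ A A}

/-- The extra term of [X, fY] = f[X, Y] + X(f) Y stays in the A-span, so involutivity passes from
the generators to their combinations. -/
theorem lie_mem_span_of_generators
    (h : ∀ i j, ⁅D i, D j⁆ ∈ Submodule.span A (Set.range D)) {X Y : Derivation ℝ A A}
    (hX : X ∈ Submodule.span A (Set.range D)) (hY : Y ∈ Submodule.span A (Set.range D)) :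
    ⁅X, Y⁆ ∈ Submodule.span A (Set.range D) := by
  have hsm : ∀ (f : A) (X Y : Derivation ℝ A A), ⁅X, f • Y⁆ = f • ⁅X, Y⁆ + X f • Y := by
    intro f X Y
    ext a
    simp [Derivation.commutator_apply]
  have hone : ∀ i, ∀ Y ∈ Submodule.span A (Set.range D),
      ⁅D i, Y⁆ ∈ Submodule.span A (Set.range D) := by
    intro i Y hY
    induction hY using Submodule.span_induction with
    | mem Y hY => obtain ⟨j, rfl⟩ := hY; exact h i j
    | zero => simp
    | add Y Z _ _ hY hZ => rw [lie_add]; exact add_mem hY hZ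
    | smul f Y hY' hY =>
      rw [hsm]
      exact add_mem (Submodule.smul_mem _ _ hY) (Submodule.smul_mem _ _ hY')
  induction hX using Submodule.span_induction with
  | mem X hX => obtain ⟨i, rfl⟩ := hX; exact hone i Y hY
  | zero => simp
  | add X Z _ _ hX hZ => rw [add_lie]; exact add_mem hX hZ
  | smul f X hX' hX =>
    rw [← lie_skew, hsm, ← lie_skew Y X]
    exact neg_mem (add_mem (Submodule.smul_mem _ _ (neg_mem hX)) (Submodule.smul_mem _ _ hX'))

/-- The derivations dual to the `ξ_i` in an involutive system of derivations commute. -/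
theorem lie_eq_zero_of_dual [DecidableEq ι] {W : Matrix ι ι A}
    (hW : W * Matrix.of (fun i j => D i (ξ j)) = 1)
    (h : ∀ i j, ⁅D i, D j⁆ ∈ Submodule.span A (Set.range D)) (i j : ι) :
    ⁅∑ k, W i k • D k, ∑ k, W j k • D k⁆ = 0 := by
  set T : ι → Derivation ℝ A A := fun i => ∑ k, W i k • D k with hTdef
  have hTξ : ∀ i j, T i (ξ j) = if i = j then 1 else 0 := by
    intro i j
    have := congrFun (congrFun hW i) j
    rw [Matrix.mul_apply, Matrix.one_apply] at this
    rw [← this]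
    exact derivation_sum_smul_apply _ _ _
  have hmem : ∀ i, T i ∈ Submodule.span A (Set.range D) := fun i =>
    Submodule.sum_mem _ fun k _ => Submodule.smul_mem _ _ (Submodule.subset_span ⟨k, rfl⟩)
  -- The values T_i ξ_l are constants, so the bracket annihilates all ξ_l. A combination of the D_k
  -- with this property has zero coefficients, because the matrix D_i ξ_j is invertible.
  have hz : ∀ l, ⁅T i, T j⁆ (ξ l) = 0 := by
    intro l
    rw [Derivation.commutator_apply, hTξ, hTξ]
    split_ifs <;> simp
  obtain ⟨d, hd⟩ := (Submodule.mem_span_range_iff_exists_fun A).1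
    (lie_mem_span_of_generators h (hmem i) (hmem j))
  have hdV : Matrix.vecMul d (Matrix.of (fun i j => D i (ξ j))) = 0 := by
    ext l
    have := hz l
    rw [← hd, derivation_sum_smul_apply] at this
    simpa [Matrix.vecMul, dotProduct] using this
  have hVW : Matrix.of (fun i j => D i (ξ j)) * W = 1 := mul_eq_one_comm.1 hW
  have hd0 : d = 0 := by
    rw [← Matrix.vecMul_one d, ← hVW, ← Matrix.vecMul_vecMul, hdV, Matrix.zero_vecMul]
  change ⁅T i, T j⁆ = 0
  rw [← hd, hd0]
  simp

end Involutive

/-! ### The linear algebra linking curvature, kernel and solutions -/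

section Curvature

open Matrix

variable [DecidableEq ι] {m : Ideal A} {B : Set A} {ξ : ι → A} {D D' : ι → Derivation ℝ A A}
  {p : Matrix ι ι A}

/-- If `V' pᵀ = p Vᵀ` with `p` skew-symmetric, then `V p = -p V'ᵀ`. -/
theorem mul_skew_of_associated {A ι : Type*} [CommRing A] [Fintype ι] {p V V' : Matrix ι ι A} (hp : pᵀ = -p) (h : V' * pᵀ = p * Vᵀ) :
    V * p = -(p * V'ᵀ) := by
  have := congrArg transpose h
  rw [transpose_mul, transpose_mul, transpose_transpose, transpose_transpose, hp] at this
  rw [this]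
  simp

/-- A vertical derivation in the kernel of the fibrewise form is a combination of the `D_i`. -/
theorem FormalFrame.mem_span_of_kernel (hF : FormalFrame m B ξ) (hp : pᵀ = -p)
    (hassoc : Matrix.of (fun i j => D' i (ξ j)) * pᵀ = p * (Matrix.of (fun i j => D i (ξ j)))ᵀ)
    (hV : IsUnit (Matrix.of (fun i j => D i (ξ j)))) (hV' : IsUnit (Matrix.of (fun i j => D' i (ξ j))))
    (hDB : ∀ b ∈ B, ∃ y : ι → A, ∀ i, D i b = ∑ j, p i j * y j) {R : Derivation ℝ A A}
    (hRB : ∀ b ∈ B, R b = 0) (hR : (fun i => R (ξ i)) ᵥ* p = 0) :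
    R ∈ Submodule.span A (Set.range D) := by
  set V := Matrix.of (fun i j => D i (ξ j)) with hVdef
  set V' := Matrix.of (fun i j => D' i (ξ j))
  obtain ⟨W, hVW⟩ := hV.exists_right_inv
  have hWV : W * V = 1 := mul_eq_one_comm.1 hVW
  obtain ⟨Y, hY⟩ := (Matrix.isUnit_transpose V').2 hV' |>.exists_right_inv
  have h1 := mul_skew_of_associated hp hassoc
  -- W is V⁻¹ and Y inverts V'ᵀ: association lets V⁻¹ move past p, turning into the inverse of V'ᵀ
  -- with a sign.
  have h2 : W * p = -(p * Y) := by
    have h3 : W * (V * p) * Y = p * Y := by rw [← Matrix.mul_assoc W, hWV, Matrix.one_mul]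
    rw [h1] at h3
    rw [← h3]
    simp only [Matrix.mul_neg, Matrix.neg_mul, neg_neg]
    rw [← Matrix.mul_assoc W, Matrix.mul_assoc (W * p), hY, Matrix.mul_one]
  set r : ι → A := fun i => R (ξ i) with hr
  -- The only possible coefficients: they make Σ c_i D_i agree with R on the ξ_i.
  set c := r ᵥ* W with hc
  have hcp : c ᵥ* p = 0 := by
    rw [hc, vecMul_vecMul, h2, vecMul_neg, ← vecMul_vecMul, hR]
    simp
  have hcV : c ᵥ* V = r := by rw [hc, vecMul_vecMul, hWV, vecMul_one]
  have hz : R - ∑ i, c i • D i = 0 := by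
    refine hF.derivation_eq_zero _ (fun b hb => ?_) fun j => ?_
    -- On B the D_i factor through p, so c p = 0 makes the combination vertical, as R is.
    · obtain ⟨y, hy⟩ := hDB b hb
      have : ∑ i, c i * D i b = (c ᵥ* p) ⬝ᵥ y := by
        rw [← dotProduct_mulVec]
        simp [dotProduct, mulVec, hy]
      rw [Derivation.sub_apply, derivation_sum_smul_apply, hRB b hb, this, hcp]
      simp
    · have := congrFun hcV j
      simp only [vecMul, dotProduct, hVdef, Matrix.of_apply, hr] at this
      rw [Derivation.sub_apply, derivation_sum_smul_apply, this, sub_self]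
  rw [sub_eq_zero.1 hz]
  exact Submodule.sum_mem _ fun k _ => Submodule.smul_mem _ _ (Submodule.subset_span ⟨k, rfl⟩)

/-- A vertical derivation that annihilates enough solutions of `D_i F = 0` is in the kernel of the
fibrewise form. -/
theorem FormalFrame.kernel_of_solutions (hF : FormalFrame m B ξ) (hp : pᵀ = -p)
    (hassoc : Matrix.of (fun i j => D' i (ξ j)) * pᵀ = p * (Matrix.of (fun i j => D i (ξ j)))ᵀ)
    (hV : IsUnit (Matrix.of (fun i j => D i (ξ j))))
    {x : ι → A} (hxB : ∀ i, x i ∈ B) (hx : ∀ i j, D i (x j) = p i j) {R : Derivation ℝ A A}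
    (hRB : ∀ b ∈ B, R b = 0)
    (hsol : ∀ b ∈ B, ∃ c : ι → A, (∀ i, D i (b + ∑ i, c i * ξ i) = 0) ∧
      R (b + ∑ i, c i * ξ i) = 0) :
    (fun i => R (ξ i)) ᵥ* p = 0 := by
  set V := Matrix.of (fun i j => D i (ξ j)) with hVdef
  set V' := Matrix.of (fun i j => D' i (ξ j))
  obtain ⟨W, hVW⟩ := hV.exists_right_inv
  have hWV : W * V = 1 := mul_eq_one_comm.1 hVW
  have h1 := mul_skew_of_associated hp hassoc
  set r : ι → A := fun i => R (ξ i) with hr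
  set c := r ᵥ* W with hc
  have hcV : c ᵥ* V = r := by rw [hc, vecMul_vecMul, hWV, vecMul_one]
  -- Both derivations agree on the ξ_i and annihilate a solution over each b in B, which is enough
  -- to identify them.
  have hz : R - ∑ i, c i • D i = 0 := by
    refine hF.derivation_eq_zero_of_solutions _ (fun b hb => ?_) fun j => ?_
    · obtain ⟨y, hy, hRy⟩ := hsol b hb
      exact ⟨y, by rw [Derivation.sub_apply, derivation_sum_smul_apply]; simp only [hy, hRy]; simp⟩
    · have := congrFun hcV j
      simp only [vecMul, dotProduct, hVdef, Matrix.of_apply, hr] at this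
      rw [Derivation.sub_apply, derivation_sum_smul_apply, this, sub_self]
  -- Evaluate at the coordinates: R annihilates x_j, while D_i x_j = p_ij.
  have hcp : c ᵥ* p = 0 := by
    ext j
    have := congrArg (fun U : Derivation ℝ A A => U (x j)) hz
    simp only [Derivation.sub_apply, derivation_sum_smul_apply, hRB _ (hxB j), hx] at this
    simpa [vecMul, dotProduct] using this
  rw [← hcV, vecMul_vecMul, h1, vecMul_neg, ← vecMul_vecMul, hcp]
  simp

end Curvature

end Algebra

section Analysis

/-! ### Hadamard's lemma with parameters -/

/-- Differentiation under the integral sign; finite dimension makes the ball compact, which supplies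
the constant dominating function. -/
theorem hasFDerivAt_parametric {X : Type*} [NormedAddCommGroup X] [NormedSpace ℝ X]
    [FiniteDimensional ℝ X] {g : X × ℝ → ℝ} (hg : ContDiff ℝ ∞ g) (x₀ : X) :
    HasFDerivAt (fun x => ∫ t in (0 : ℝ)..1, g (x, t))
      (∫ t in (0 : ℝ)..1, (fderiv ℝ g (x₀, t)).comp (ContinuousLinearMap.inl ℝ X ℝ)) x₀ := by
  have hgc : Continuous g := hg.continuous
  have hg' : Continuous fun p : X × ℝ =>
      (fderiv ℝ g p).comp (ContinuousLinearMap.inl ℝ X ℝ) :=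
    (hg.continuous_fderiv (by simp)).clm_comp continuous_const
  have hc : IsCompact (Metric.closedBall x₀ 1 ×ˢ Set.Icc (0 : ℝ) 1) :=
    (isCompact_closedBall x₀ 1).prod isCompact_Icc
  obtain ⟨C, hC⟩ := hc.exists_bound_of_continuousOn hg'.continuousOn
  refine intervalIntegral.hasFDerivAt_integral_of_dominated_of_fderiv_le
    (F' := fun x t => (fderiv ℝ g (x, t)).comp (ContinuousLinearMap.inl ℝ X ℝ))
    (bound := fun _ => C) (Metric.closedBall_mem_nhds x₀ one_pos) ?_ ?_ ?_ ?_ ?_ ?_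
  · exact Eventually.of_forall fun x =>
      (hgc.comp (Continuous.prodMk_right x)).aestronglyMeasurable
  · exact (hgc.comp (Continuous.prodMk_right x₀)).intervalIntegrable _ _
  · exact (hg'.comp (Continuous.prodMk_right x₀)).aestronglyMeasurable
  · refine Eventually.of_forall fun t ht x hx => hC (x, t) ⟨hx, ?_⟩
    rw [Set.uIoc_of_le zero_le_one] at ht
    exact ⟨ht.1.le, ht.2⟩
  · exact intervalIntegrable_const
  · refine Eventually.of_forall fun t _ x _ => ?_
    have h1 : HasFDerivAt g (fderiv ℝ g (x, t)) (x, t) :=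
      (hg.differentiable (by simp) _).hasFDerivAt
    exact h1.comp x (hasFDerivAt_prodMk_left x t)

/-- Directional derivatives of such an integral are integrals of the same form, so the induction on
the order of smoothness runs over all g. -/
theorem contDiff_parametric {X : Type*} [NormedAddCommGroup X] [NormedSpace ℝ X]
    [FiniteDimensional ℝ X] {g : X × ℝ → ℝ} (hg : ContDiff ℝ ∞ g) :
    ContDiff ℝ ∞ (fun x => ∫ t in (0 : ℝ)..1, g (x, t)) := by
  rw [contDiff_infty]
  intro m
  induction m generalizing g with
  | zero =>
    rw [Nat.cast_zero, contDiff_zero]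
    exact continuous_iff_continuousAt.2 fun x => (hasFDerivAt_parametric hg x).continuousAt
  | succ m ih =>
    rw [Nat.cast_succ, contDiff_succ_iff_fderiv_apply]
    refine ⟨fun x => (hasFDerivAt_parametric hg x).differentiableAt, by simp, fun v => ?_⟩
    have h1 : ContDiff ℝ ∞ fun p : X × ℝ => fderiv ℝ g p (v, 0) :=
      (hg.fderiv_right (m := ∞) (by simp)).clm_apply contDiff_const
    convert ih h1 using 2 with x
    rw [(hasFDerivAt_parametric hg x).fderiv, ContinuousLinearMap.intervalIntegral_apply]
    · simp
    · refine Continuous.intervalIntegrable ?_ _ _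
      exact ((hg.continuous_fderiv (by simp)).comp
        (Continuous.prodMk_right x)).clm_comp continuous_const

variable {E ι : Type*} [NormedAddCommGroup E] [NormedSpace ℝ E] [FiniteDimensional ℝ E] [Fintype ι]

theorem hasDerivAt_ray {f : E × (ι → ℝ) → ℝ} (hf : ContDiff ℝ ∞ f) (y : E) (η : ι → ℝ) (t : ℝ) :
    HasDerivAt (fun t : ℝ => f (y, t • η)) (fderiv ℝ f (y, t • η) (0, η)) t := by
  have h1 : HasFDerivAt f (fderiv ℝ f (y, t • η)) (y, t • η) :=
    (hf.differentiable (by simp) _).hasFDerivAt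
  have h2 : HasDerivAt (fun t : ℝ => (y, t • η)) (0, η) t := by
    refine (hasDerivAt_const t y).prodMk ?_
    simpa using (hasDerivAt_id t).smul_const η
  exact h1.comp_hasDerivAt t h2

theorem fderiv_fibre_eq_sum [DecidableEq ι] (L : E × (ι → ℝ) →L[ℝ] ℝ) (η : ι → ℝ) :
    L (0, η) = ∑ i, L (0, Pi.single i 1) * η i := by
  have h : ((0 : E), η) = ∑ i, η i • ((0 : E), (Pi.single i 1 : ι → ℝ)) := by
    ext j
    · simp [Prod.fst_sum]
    · simp [Prod.snd_sum, Finset.sum_apply, Pi.single_apply]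
  conv_lhs => rw [h]
  rw [map_sum]
  exact Finset.sum_congr rfl fun i _ => by rw [map_smul, smul_eq_mul, mul_comm]

/-- Hadamard's lemma. -/
theorem exists_contDiff_hadamard {f : E × (ι → ℝ) → ℝ} (hf : ContDiff ℝ ∞ f) :
    ∃ F : ι → E × (ι → ℝ) → ℝ, (∀ i, ContDiff ℝ ∞ (F i)) ∧
      ∀ y η, f (y, η) = f (y, 0) + ∑ i, F i (y, η) * η i := by
  classical
  have hs : ∀ i, ContDiff ℝ ∞ fun p : (E × (ι → ℝ)) × ℝ =>
      fderiv ℝ f (p.1.1, p.2 • p.1.2) (0, Pi.single i 1) := fun i =>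
    ((hf.fderiv_right (m := ∞) (by simp)).comp
      ((contDiff_fst.comp contDiff_fst).prodMk
        (contDiff_snd.smul (contDiff_snd.comp contDiff_fst)))).clm_apply contDiff_const
  -- The coefficient is the average of ∂f/∂η_i along the ray from (y, 0) to (y, η).
  refine ⟨fun i p => ∫ t in (0 : ℝ)..1, fderiv ℝ f (p.1, t • p.2) (0, Pi.single i 1),
    fun i => contDiff_parametric (hs i), fun y η => ?_⟩
  have hint : ∀ i, IntervalIntegrable
      (fun t : ℝ => fderiv ℝ f (y, t • η) (0, Pi.single i 1)) MeasureTheory.volume 0 1 := fun i =>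
    ((hs i).continuous.comp (Continuous.prodMk_right (y, η))).intervalIntegrable _ _
  have h1 := intervalIntegral.integral_eq_sub_of_hasDerivAt (a := 0) (b := 1)
    (f := fun t : ℝ => f (y, t • η))
    (f' := fun t => ∑ i, fderiv ℝ f (y, t • η) (0, Pi.single i 1) * η i)
    (fun t _ => by rw [← fderiv_fibre_eq_sum]; exact hasDerivAt_ray hf y η t)
    (Continuous.intervalIntegrable (continuous_finsetSum _ fun i _ =>
      ((hs i).continuous.comp (Continuous.prodMk_right (y, η))).mul continuous_const) _ _)
  rw [intervalIntegral.integral_finsetSum fun i _ => (hint i).mul_const _] at h1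
  simp only [intervalIntegral.integral_mul_const, one_smul, zero_smul] at h1
  rw [h1]
  ring

/-! ### Division of flat functions -/

/-- A smooth function on `E × ℝ^ι` all of whose derivatives vanish on `E × 0`. -/
structure IsFlat (f : E × (ι → ℝ) → ℝ) : Prop where
  smooth : ContDiff ℝ ∞ f
  zero : ∀ (k : ℕ) (y : E), iteratedFDeriv ℝ k f (y, 0) = 0

/-- The derivatives of order `< k` of `f` at `z` vanish. -/
def VanishesTo {X : Type*} [NormedAddCommGroup X] [NormedSpace ℝ X] (k : ℕ) (f : X → ℝ)
    (z : X) : Prop := ∀ i < k, iteratedFDeriv ℝ i f z = 0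

/-- In the Leibniz formula for an order below j + k, each term differentiates f fewer than j times
or g fewer than k times. -/
theorem VanishesTo.mul {X : Type*} [NormedAddCommGroup X] [NormedSpace ℝ X] {j k : ℕ}
    {f g : X → ℝ} {z : X} (hf : ContDiff ℝ ∞ f) (hg : ContDiff ℝ ∞ g) (hfz : VanishesTo j f z)
    (hgz : VanishesTo k g z) : VanishesTo (j + k) (fun x => f x * g x) z := by
  intro i hi
  rw [← norm_le_zero_iff]
  refine (norm_iteratedFDeriv_mul_le (n := i) (hf.of_le (by exact_mod_cast le_top)) (hg.of_le (by exact_mod_cast le_top)) z le_rfl).trans ?_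
  refine (Finset.sum_eq_zero fun l hl => ?_).le
  rw [Finset.mem_range] at hl
  rcases lt_or_ge l j with h | h
  · rw [hfz l h]; simp
  · rw [hgz (i - l) (by omega)]; simp

theorem IsFlat.mul_left {f g : E × (ι → ℝ) → ℝ} (hf : IsFlat f) (hg : ContDiff ℝ ∞ g) :
    IsFlat (fun z => g z * f z) where
  smooth := hg.mul hf.smooth
  zero k y := by
    have := VanishesTo.mul (j := 0) (k := k + 1) (z := (y, (0 : ι → ℝ))) hg hf.smooth
      (fun i hi => absurd hi (Nat.not_lt_zero i)) (fun i _ => hf.zero i y)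
    exact this k (by omega)

theorem IsFlat.sub {f g : E × (ι → ℝ) → ℝ} (hf : IsFlat f) (hg : IsFlat g) :
    IsFlat (fun z => f z - g z) where
  smooth := hf.smooth.sub hg.smooth
  zero k y := by
    have := iteratedFDeriv_sub_apply (i := k) (x := (y, (0 : ι → ℝ)))
      (hf.smooth.contDiffAt.of_le (by exact_mod_cast le_top))
      (hg.smooth.contDiffAt.of_le (by exact_mod_cast le_top))
    rw [hf.zero, hg.zero, sub_zero] at this
    exact this

theorem IsFlat.fderiv_apply {f : E × (ι → ℝ) → ℝ} (hf : IsFlat f) (v : E × (ι → ℝ)) :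
    IsFlat (fun z => fderiv ℝ f z v) where
  smooth := (hf.smooth.fderiv_right (m := ∞) (by simp)).clm_apply contDiff_const
  zero k y := by
    rw [← norm_le_zero_iff]
    have h1 := norm_iteratedFDeriv_clm_apply_const (n := k) (c := v)
      (x := (y, (0 : ι → ℝ))) (N := ∞)
      ((hf.smooth.fderiv_right (m := ∞) (by simp)).contDiffAt) (by exact_mod_cast le_top)
    rw [norm_iteratedFDeriv_fderiv, hf.zero] at h1
    simpa using h1

theorem IsFlat.apply_zero {f : E × (ι → ℝ) → ℝ} (hf : IsFlat f) (y : E) : f (y, 0) = 0 := by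
  have := hf.zero 0 y
  rw [← norm_eq_zero, norm_iteratedFDeriv_zero] at this
  simpa using this

/-- Fibre derivatives of a flat function are flat; a bound of order N on them gives order N + 1 for
f by the mean value inequality along rays. -/
theorem IsFlat.exists_bound {f : E × (ι → ℝ) → ℝ} (hf : IsFlat f) (N : ℕ) (y₀ : E) :
    ∃ C : ℝ, 0 ≤ C ∧ ∀ y ∈ Metric.closedBall y₀ 1, ∀ η ∈ Metric.closedBall (0 : ι → ℝ) 1,
      |f (y, η)| ≤ C * ‖η‖ ^ N := by
  classical
  induction N generalizing f with
  | zero =>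
    have hc : IsCompact (Metric.closedBall y₀ 1 ×ˢ Metric.closedBall (0 : ι → ℝ) 1) :=
      (isCompact_closedBall _ _).prod (isCompact_closedBall _ _)
    obtain ⟨C, hC⟩ := hc.exists_bound_of_continuousOn hf.smooth.continuous.continuousOn
    refine ⟨|C|, abs_nonneg _, fun y hy η hη => ?_⟩
    have := hC (y, η) ⟨hy, hη⟩
    rw [Real.norm_eq_abs] at this
    simpa using this.trans (le_abs_self C)
  | succ N ih =>
    choose C hC0 hC using fun i : ι => ih (hf.fderiv_apply (0, Pi.single i 1))
    refine ⟨∑ i, C i, Finset.sum_nonneg fun i _ => hC0 i, fun y hy η hη => ?_⟩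
    have hη1 : ‖η‖ ≤ 1 := by simpa using hη
    have h1 := norm_image_sub_le_of_norm_deriv_le_segment_01' (C := (∑ i, C i) * ‖η‖ ^ (N + 1))
      (f := fun t : ℝ => f (y, t • η))
      (fun t _ => (hasDerivAt_ray hf.smooth y η t).hasDerivWithinAt) (fun t ht => ?_)
    · simpa [hf.apply_zero] using h1
    · have ht1 : ‖t • η‖ ≤ ‖η‖ := by
        rw [norm_smul, Real.norm_of_nonneg ht.1]
        exact mul_le_of_le_one_left (norm_nonneg _) ht.2.le
      rw [fderiv_fibre_eq_sum, Finset.sum_mul]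
      refine (norm_sum_le _ _).trans (Finset.sum_le_sum fun i _ => ?_)
      rw [norm_mul, Real.norm_eq_abs]
      have h2 := hC i y hy (t • η) (by simpa using ht1.trans hη1)
      calc |_| * ‖η i‖ ≤ (C i * ‖t • η‖ ^ N) * ‖η‖ := by
            have := hC0 i
            gcongr
            exact norm_le_pi_norm η i
        _ ≤ (C i * ‖η‖ ^ N) * ‖η‖ := by
            have := hC0 i
            gcongr
        _ = _ := by ring

/-- A smooth function that is a positive definite quadratic form on the fibres. -/
structure IsFibreNorm (q : E × (ι → ℝ) → ℝ) : Prop where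
  smooth : ContDiff ℝ ∞ q
  homogeneous : ∀ y (t : ℝ) η, q (y, t • η) = t ^ 2 * q (y, η)
  pos : ∀ y η, η ≠ 0 → 0 < q (y, η)

theorem IsFibreNorm.exists_lower_bound {q : E × (ι → ℝ) → ℝ} (hq : IsFibreNorm q) (y₀ : E) :
    ∃ c : ℝ, 0 < c ∧ ∀ y ∈ Metric.closedBall y₀ 1, ∀ η, c * ‖η‖ ^ 2 ≤ q (y, η) := by
  have h0 : ∀ y, q (y, 0) = 0 := fun y => by simpa using hq.homogeneous y 0 0
  have hc : IsCompact (Metric.closedBall y₀ 1 ×ˢ Metric.sphere (0 : ι → ℝ) 1) :=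
    (isCompact_closedBall _ _).prod (isCompact_sphere _ _)
  have key : ∃ c : ℝ, 0 < c ∧ ∀ y ∈ Metric.closedBall y₀ 1, ∀ η ∈ Metric.sphere (0 : ι → ℝ) 1,
      c ≤ q (y, η) := by
    -- The sphere is empty when there are no fibre coordinates; any positive constant then serves.
    rcases (Metric.closedBall y₀ 1 ×ˢ Metric.sphere (0 : ι → ℝ) 1).eq_empty_or_nonempty with h | h
    · refine ⟨1, one_pos, fun y hy η hη => ?_⟩
      have : (y, η) ∈ Metric.closedBall y₀ 1 ×ˢ Metric.sphere (0 : ι → ℝ) 1 := ⟨hy, hη⟩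
      simp [h] at this
    · obtain ⟨z, hz, hmin⟩ := hc.exists_isMinOn h hq.smooth.continuous.continuousOn
      refine ⟨q z, hq.pos z.1 z.2 ?_, fun y hy η hη => hmin (show (y, η) ∈ _ from ⟨hy, hη⟩)⟩
      have := hz.2
      rintro h0
      simp [h0] at this
  obtain ⟨c, hc0, hcb⟩ := key
  refine ⟨c, hc0, fun y hy η => ?_⟩
  rcases eq_or_ne η 0 with rfl | hη
  · simp [h0]
  · have hn : ‖η‖ ≠ 0 := norm_ne_zero_iff.2 hη
    have h1 := hcb y hy (‖η‖⁻¹ • η) (by simp [norm_smul, hn])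
    rw [hq.homogeneous, inv_pow] at h1
    have : 0 < ‖η‖ ^ 2 := by positivity
    rwa [← div_eq_inv_mul, le_div_iff₀ this] at h1

/-- The denominator is at least (c‖η‖²)^N. Decay of order 2N + 2 in the numerator leaves ‖η‖², so
the quotient has zero derivative on E × 0; its value there is 0 since the numerator vanishes. -/
theorem IsFlat.hasFDerivAt_div_zero {f q : E × (ι → ℝ) → ℝ} (hf : IsFlat f) (hq : IsFibreNorm q)
    (N : ℕ) (y₀ : E) : HasFDerivAt (fun z => f z / q z ^ N) (0 : E × (ι → ℝ) →L[ℝ] ℝ) (y₀, 0) := by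
  obtain ⟨c, hc0, hc⟩ := hq.exists_lower_bound y₀
  obtain ⟨C, hC0, hC⟩ := hf.exists_bound (2 * N + 2) y₀
  rw [hasFDerivAt_iff_isLittleO]
  have hO : (fun z : E × (ι → ℝ) => f z / q z ^ N) =O[𝓝 (y₀, 0)] fun z => ‖z - (y₀, 0)‖ ^ 2 := by
    refine Asymptotics.IsBigO.of_bound (C / c ^ N) ?_
    filter_upwards [prod_mem_nhds (Metric.closedBall_mem_nhds y₀ one_pos)
      (Metric.closedBall_mem_nhds (0 : ι → ℝ) one_pos)] with z hz
    obtain ⟨y, η⟩ := z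
    have h1 := hC y hz.1 η hz.2
    have h2 := hc y hz.1 η
    rcases eq_or_ne η 0 with rfl | hη
    · rw [hf.apply_zero]; simp; positivity
    · have hn : 0 < ‖η‖ := norm_pos_iff.2 hη
      have h3 : (c * ‖η‖ ^ 2) ^ N ≤ q (y, η) ^ N := by gcongr
      have h4 : ‖η‖ ≤ ‖((y, η) : E × (ι → ℝ)) - (y₀, 0)‖ := by
        have := norm_snd_le (((y, η) : E × (ι → ℝ)) - (y₀, 0))
        simpa using this
      rw [norm_div, norm_pow, Real.norm_eq_abs, Real.norm_of_nonneg (hq.pos y η hη).le,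
        norm_pow, norm_norm]
      calc |f (y, η)| / q (y, η) ^ N ≤ (C * ‖η‖ ^ (2 * N + 2)) / (c * ‖η‖ ^ 2) ^ N := by gcongr
        _ = C / c ^ N * ‖η‖ ^ 2 := by
            rw [mul_pow, ← pow_mul, pow_add]
            field_simp
        _ ≤ _ := by gcongr
  have ho : (fun z : E × (ι → ℝ) => ‖z - (y₀, 0)‖ ^ 2) =o[𝓝 (y₀, 0)] fun z => z - (y₀, 0) := by
    have h1 : (fun z : E × (ι → ℝ) => ‖z - (y₀, 0)‖) =o[𝓝 (y₀, 0)] fun _ => (1 : ℝ) := by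
      rw [Asymptotics.isLittleO_one_iff]
      have : Continuous fun z : E × (ι → ℝ) => ‖z - (y₀, 0)‖ := by fun_prop
      simpa using this.tendsto (y₀, 0)
    have h2 := h1.mul_isBigO (Asymptotics.isBigO_refl
      (fun z : E × (ι → ℝ) => ‖z - (y₀, 0)‖) (𝓝 (y₀, 0)))
    simp only [one_mul, ← pow_two] at h2
    exact h2.of_norm_right
  have h0 : f (y₀, 0) / q (y₀, 0) ^ N = 0 := by rw [hf.apply_zero, zero_div]
  simpa [h0] using hO.trans_isLittleO ho

/-- The quotient rule, valid also on E × 0, where f and its derivatives vanish and both sides are 0.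
-/
theorem IsFlat.hasFDerivAt_div {f q : E × (ι → ℝ) → ℝ} (hf : IsFlat f) (hq : IsFibreNorm q)
    (N : ℕ) (z : E × (ι → ℝ)) : ∃ L : E × (ι → ℝ) →L[ℝ] ℝ,
      HasFDerivAt (fun z => f z / q z ^ N) L z ∧ ∀ v, L v =
        (q z * fderiv ℝ f z v - (N * fderiv ℝ q z v) * f z) / q z ^ (N + 1) := by
  obtain ⟨y, η⟩ := z
  rcases eq_or_ne η 0 with rfl | hη
  · refine ⟨0, hf.hasFDerivAt_div_zero hq N y, fun v => ?_⟩
    rw [hf.apply_zero, (hf.fderiv_apply v).apply_zero]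
    simp
  · have hqz : q (y, η) ≠ 0 := (hq.pos y η hη).ne'
    have h1 : HasFDerivAt f (fderiv ℝ f (y, η)) (y, η) :=
      (hf.smooth.differentiable (by simp) _).hasFDerivAt
    have h2 : HasFDerivAt q (fderiv ℝ q (y, η)) (y, η) :=
      (hq.smooth.differentiable (by simp) _).hasFDerivAt
    have h3 : HasDerivAt (fun s : ℝ => (s ^ N)⁻¹)
        (-((N : ℝ) * q (y, η) ^ (N - 1)) / (q (y, η) ^ N) ^ 2) (q (y, η)) :=
      (hasDerivAt_pow N _).fun_inv (pow_ne_zero _ hqz)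
    have h4 := h1.mul (h3.comp_hasFDerivAt (y, η) h2)
    refine ⟨_, by simpa only [div_eq_mul_inv] using! h4, fun v => ?_⟩
    cases N with
    | zero => simp; field_simp
    | succ N =>
      simp
      field_simp
      ring

/-- The derivative is again a flat function over a power of q, so the induction closes when f and N
are allowed to vary. -/
theorem IsFlat.contDiff_div {f q : E × (ι → ℝ) → ℝ} (hf : IsFlat f) (hq : IsFibreNorm q)
    (N : ℕ) : ContDiff ℝ ∞ (fun z => f z / q z ^ N) := by
  rw [contDiff_infty]
  intro m
  induction m generalizing f N with
  | zero =>
    rw [Nat.cast_zero, contDiff_zero, continuous_iff_continuousAt]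
    intro z
    obtain ⟨L, hL, -⟩ := hf.hasFDerivAt_div hq N z
    exact hL.continuousAt
  | succ m ih =>
    rw [Nat.cast_succ, contDiff_succ_iff_fderiv_apply]
    refine ⟨fun z => ?_, by simp, fun v => ?_⟩
    · obtain ⟨L, hL, -⟩ := hf.hasFDerivAt_div hq N z
      exact hL.differentiableAt
    · have hdq : ContDiff ℝ ∞ fun z => (N : ℝ) * fderiv ℝ q z v :=
        contDiff_const.mul ((hq.smooth.fderiv_right (m := ∞) (by simp)).clm_apply contDiff_const)
      have hflat : IsFlat fun z => q z * fderiv ℝ f z v - ((N : ℝ) * fderiv ℝ q z v) * f z :=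
        ((hf.fderiv_apply v).mul_left hq.smooth).sub (hf.mul_left hdq)
      convert ih hflat (N + 1) using 2 with z
      obtain ⟨L, hL, hLv⟩ := hf.hasFDerivAt_div hq N z
      rw [hL.fderiv, hLv]

end Analysis

/-! ### A smooth substitute for the reciprocal -/

section Cutoff

/-- A smooth function that agrees with `s ↦ s⁻¹` near `1`, together with a cutoff function that
vanishes near `1`. -/
theorem exists_smooth_inverse : ∃ κ τ : ℝ → ℝ, ContDiff ℝ ∞ κ ∧ ContDiff ℝ ∞ τ ∧
    (∀ s, 3 / 4 ≤ s → τ s = 0) ∧ ∀ s (k : ℕ), s * κ s - 1 = (s * κ s - 1) * τ s ^ k := by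
  have hθ : ContDiff ℝ ∞ fun s : ℝ => Real.smoothTransition (4 * s - 1) :=
    Real.smoothTransition.contDiff.comp ((contDiff_const.mul contDiff_id).sub contDiff_const)
  -- κ is 1/s for s ≥ 1/2 and 0 for s ≤ 1/4; τ is 1 for s ≤ 1/2 and 0 for s ≥ 3/4. At every s either
  -- s κ(s) = 1 or τ(s) = 1, whence the identity for all k.
  refine ⟨fun s => Real.smoothTransition (4 * s - 1) * s⁻¹,
    fun s => 1 - Real.smoothTransition (4 * s - 2), ?_, ?_, ?_, ?_⟩
  · rw [contDiff_iff_contDiffAt]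
    intro s
    by_cases hs : s = 0
    · subst hs
      refine (contDiffAt_const (c := (0 : ℝ))).congr_of_eventuallyEq ?_
      filter_upwards [gt_mem_nhds (show (0 : ℝ) < 1 / 4 by norm_num)] with s hs
      rw [Real.smoothTransition.zero_of_nonpos (by linarith), zero_mul]
    · exact hθ.contDiffAt.mul (contDiffAt_inv ℝ hs)
  · exact contDiff_const.sub (Real.smoothTransition.contDiff.comp
      ((contDiff_const.mul contDiff_id).sub contDiff_const))
  · intro s hs
    simp [Real.smoothTransition.one_of_one_le (show (1 : ℝ) ≤ 4 * s - 2 by linarith)]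
  · intro s k
    rcases le_or_gt (1 / 2) s with hs | hs
    · have h1 : s * (Real.smoothTransition (4 * s - 1) * s⁻¹) = 1 := by
        rw [Real.smoothTransition.one_of_one_le (by linarith), one_mul,
          mul_inv_cancel₀ (by linarith)]
      simp [h1]
    · simp [Real.smoothTransition.zero_of_nonpos (show 4 * s - 2 ≤ 0 by linarith)]

end Cutoff

/-! ### Borel's lemma with parameters -/

section Borel

variable {E ι : Type*} [NormedAddCommGroup E] [NormedSpace ℝ E] [FiniteDimensional ℝ E] [Fintype ι]

/-- Rescaling of the fibre coordinates. -/
noncomputable def fibreScale (E ι : Type*) [NormedAddCommGroup E] [NormedSpace ℝ E] [Fintype ι] (T : ℝ) :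
    E × (ι → ℝ) →L[ℝ] E × (ι → ℝ) :=
  (ContinuousLinearMap.id ℝ E).prodMap (T • ContinuousLinearMap.id ℝ (ι → ℝ))

theorem norm_fibreScale_le {T : ℝ} (hT : 1 ≤ T) : ‖fibreScale E ι T‖ ≤ T := by
  refine ContinuousLinearMap.opNorm_le_bound _ (by linarith) fun z => ?_
  have h0 : ‖z.1‖ ≤ T * ‖z‖ :=
    (norm_fst_le z).trans (le_mul_of_one_le_left (norm_nonneg _) hT)
  have h1 : ‖T • z.2‖ ≤ T * ‖z‖ := by
    rw [norm_smul, Real.norm_of_nonneg (by linarith)]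
    gcongr
    exact norm_snd_le z
  simpa [fibreScale, Prod.norm_def] using! And.intro h0 h1

theorem norm_iteratedFDeriv_fibreScale_le {g : E × (ι → ℝ) → ℝ} (hg : ContDiff ℝ ∞ g) {C T : ℝ}
    (hT : 1 ≤ T) {i : ℕ} (hC : ∀ z, ‖iteratedFDeriv ℝ i g z‖ ≤ C) (z : E × (ι → ℝ)) :
    ‖iteratedFDeriv ℝ i (g ∘ fibreScale E ι T) z‖ ≤ T ^ i * C := by
  rw [ContinuousLinearMap.iteratedFDeriv_comp_right _ hg _ (by exact_mod_cast le_top)]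
  refine (ContinuousMultilinearMap.norm_compContinuousLinearMap_le _ _).trans ?_
  rw [Finset.prod_const, Finset.card_univ, Fintype.card_fin, mul_comm]
  have h2 : ‖fibreScale E ι T‖ ^ i ≤ T ^ i :=
    pow_le_pow_left₀ (norm_nonneg _) (norm_fibreScale_le hT) i
  exact mul_le_mul h2 (hC _) (norm_nonneg _) (by positivity)

theorem exists_homogeneous_bound {P : E × (ι → ℝ) → ℝ} (hP : Continuous P) {k : ℕ}
    (hom : ∀ y (t : ℝ) η, P (y, t • η) = t ^ k * P (y, η)) {K : Set E} (hK : IsCompact K)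
    (supp : ∀ y η, y ∉ K → P (y, η) = 0) :
    ∃ C, 0 ≤ C ∧ ∀ y η, |P (y, η)| ≤ C * ‖η‖ ^ k := by
  obtain ⟨C, hC⟩ := (hK.prod (isCompact_closedBall (0 : ι → ℝ) 1)).exists_bound_of_continuousOn
    hP.continuousOn
  refine ⟨|C|, abs_nonneg _, fun y η => ?_⟩
  by_cases hy : y ∈ K
  · have h1 : η = ‖η‖ • (‖η‖⁻¹ • η) := by
      rcases eq_or_ne η 0 with rfl | h
      · simp
      · rw [smul_smul, mul_inv_cancel₀ (norm_ne_zero_iff.2 h), one_smul]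
    have h2 : ‖‖η‖⁻¹ • η‖ ≤ 1 := by
      rw [norm_smul, norm_inv, norm_norm]
      exact inv_mul_le_one
    conv_lhs => rw [h1]
    rw [hom, abs_mul, abs_pow, abs_norm, mul_comm]
    have := hC (y, ‖η‖⁻¹ • η) ⟨hy, by simpa using h2⟩
    exact mul_le_mul_of_nonneg_right (this.trans (le_abs_self C)) (by positivity)
  · rw [supp y η hy, abs_zero]
    positivity

/-- Borel's lemma: there is a smooth function with prescribed homogeneous components along
`E × 0`. -/
theorem exists_contDiff_borel {P : ℕ → E × (ι → ℝ) → ℝ} (hP : ∀ k, ContDiff ℝ ∞ (P k))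
    (hom : ∀ k y (t : ℝ) η, P k (y, t • η) = t ^ k * P k (y, η)) {K : Set E} (hK : IsCompact K)
    (supp : ∀ k y η, y ∉ K → P k (y, η) = 0) :
    ∃ F : E × (ι → ℝ) → ℝ, ContDiff ℝ ∞ F ∧ ∀ k y η,
      (fun t : ℝ => F (y, t • η) - ∑ j ∈ Finset.range k, P j (y, t • η)) =O[𝓝 0]
        fun t => t ^ k := by
  let χ : ContDiffBump (0 : ι → ℝ) := ⟨1, 2, one_pos, one_lt_two⟩
  have hχ : ContDiff ℝ ∞ χ := χ.contDiff
  have hχ1 : ∀ η : ι → ℝ, ‖η‖ ≤ 1 → χ η = 1 := fun η h =>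
    χ.one_of_mem_closedBall (by simpa using h)
  have hχ0 : ∀ η : ι → ℝ, 2 ≤ ‖η‖ → χ η = 0 := fun η h =>
    χ.zero_of_le_dist (by simpa using h)
  have hχle : ∀ η : ι → ℝ, |χ η| ≤ 1 := fun η => by
    rw [abs_of_nonneg χ.nonneg]; exact χ.le_one
  set g : ℕ → E × (ι → ℝ) → ℝ := fun k z => χ z.2 * P k z with hgdef
  have hg : ∀ k, ContDiff ℝ ∞ (g k) := fun k => (hχ.comp contDiff_snd).mul (hP k)
  have hgc : ∀ k, HasCompactSupport (g k) := fun k =>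
    HasCompactSupport.of_support_subset_isCompact (hK.prod (isCompact_closedBall (0 : ι → ℝ) 2))
      fun z hz => by
        by_contra hn
        apply hz
        by_cases hz1 : z.1 ∈ K
        · have : ¬ ‖z.2‖ ≤ 2 := fun h => hn ⟨hz1, by simpa using h⟩
          simp [hgdef, hχ0 z.2 (by linarith)]
        · simp [hgdef, show P k z = 0 from supp k z.1 z.2 hz1]
  have hbd : ∀ k i, ∃ C, ∀ z, ‖iteratedFDeriv ℝ i (g k) z‖ ≤ C := by
    intro k i
    have : BddAbove (Set.range fun z => ‖iteratedFDeriv ℝ i (g k) z‖) := by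
      apply ((hg k).continuous_iteratedFDeriv
        (mod_cast le_top)).norm.bddAbove_range_of_hasCompactSupport
      exact HasCompactSupport.comp_left ((hgc k).iteratedFDeriv i) norm_zero
    exact ⟨this.choose, fun z => this.choose_spec ⟨z, rfl⟩⟩
  choose C hC using hbd
  choose C' hC'0 hC' using fun k => exists_homogeneous_bound (hP k).continuous (hom k) hK (supp k)
  -- T k is the rate at which the k-th cutoff shrinks. The three bounds keep its support in the unit
  -- ball, make the derivatives of order below k at most 2^-k, and make the term at most 2^-k times
  -- any lower power of ‖η‖.
  have hTex : ∀ k, ∃ T : ℝ, 2 ≤ T ∧ (∀ i ≤ k, 2 ^ k * C k i ≤ T) ∧ 2 * 2 ^ k * C' k ≤ T := by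
    intro k
    refine ⟨2 + (∑ i ∈ Finset.range (k + 1), 2 ^ k * |C k i|) + 2 * 2 ^ k * C' k, ?_, ?_, ?_⟩
    · have : 0 ≤ ∑ i ∈ Finset.range (k + 1), 2 ^ k * |C k i| :=
        Finset.sum_nonneg fun i _ => by positivity
      have := hC'0 k
      have : 0 ≤ 2 * 2 ^ k * C' k := by positivity
      linarith
    · intro i hi
      have h1 : 2 ^ k * |C k i| ≤ ∑ i ∈ Finset.range (k + 1), 2 ^ k * |C k i| :=
        Finset.single_le_sum (f := fun i => 2 ^ k * |C k i|) (fun i _ => by positivity)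
          (Finset.mem_range.2 (by omega))
      have h2 : 2 ^ k * C k i ≤ 2 ^ k * |C k i| := by gcongr; exact le_abs_self _
      have := hC'0 k
      have : 0 ≤ 2 * 2 ^ k * C' k := by positivity
      linarith
    · have : 0 ≤ ∑ i ∈ Finset.range (k + 1), 2 ^ k * |C k i| :=
        Finset.sum_nonneg fun i _ => by positivity
      linarith
  choose T hT2 hTC hTC' using hTex
  have hT0 : ∀ k, 0 < T k := fun k => by linarith [hT2 k]
  set u : ℕ → E × (ι → ℝ) → ℝ := fun k z => χ (T k • z.2) * P k z with hudef
  have hu : ∀ k, ContDiff ℝ ∞ (u k) := fun k =>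
    (hχ.comp (f := fun z : E × (ι → ℝ) => T k • z.2) (contDiff_snd.const_smul _)).mul (hP k)
  -- Homogeneity turns the shrinking of the cutoff into a gain T^-k, against which i derivatives
  -- cost only T^i; for i < k a factor 1/T is left.
  have hug : ∀ k, u k = (T k ^ k)⁻¹ • (g k ∘ fibreScale E ι (T k)) := by
    intro k
    funext z
    obtain ⟨y, η⟩ := z
    have h1 : fibreScale E ι (T k) (y, η) = (y, T k • η) := by simp [fibreScale]
    have := (pow_pos (hT0 k) k).ne'
    simp only [hudef, Pi.smul_apply, Function.comp_apply, h1, hgdef, hom, smul_eq_mul]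
    field_simp
  have hderiv : ∀ k i, i < k → ∀ z, ‖iteratedFDeriv ℝ i (u k) z‖ ≤ (1 / 2 : ℝ) ^ k := by
    intro k i hik z
    have hT1 : 1 ≤ T k := by linarith [hT2 k]
    have hC0 : 0 ≤ C k i := (norm_nonneg _).trans (hC k i z)
    rw [hug, iteratedFDeriv_const_smul_apply
      (((hg k).comp (fibreScale E ι (T k)).contDiff).contDiffAt.of_le (mod_cast le_top)),
      norm_smul, Real.norm_of_nonneg (by positivity)]
    have h1 := norm_iteratedFDeriv_fibreScale_le (hg k) hT1 (hC k i) z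
    have h2 : T k ^ (i + 1) ≤ T k ^ k := pow_le_pow_right₀ hT1 hik
    have h3 := hTC k i hik.le
    have hTp := hT0 k
    calc (T k ^ k)⁻¹ * _ ≤ (T k ^ k)⁻¹ * (T k ^ i * C k i) := by gcongr
      _ ≤ (T k ^ (i + 1))⁻¹ * (T k ^ i * C k i) := by gcongr
      _ = (T k)⁻¹ * C k i := by rw [pow_succ]; field_simp
      _ ≤ (1 / 2 : ℝ) ^ k := by
          rw [inv_mul_le_iff₀ hTp, one_div, inv_pow, ← div_eq_mul_inv, le_div_iff₀ (by positivity)]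
          linarith
  have hsum2 : Summable fun k : ℕ => (1 / 2 : ℝ) ^ k :=
    summable_geometric_of_lt_one (by norm_num) (by norm_num)
  have hval : ∀ j k, k < j → ∀ y η, |u j (y, η)| ≤ (1 / 2 : ℝ) ^ j * ‖η‖ ^ k := by
    intro j k hkj y η
    rcases le_or_gt 2 ‖T j • η‖ with h | h
    · rw [hudef]
      simp only [hχ0 _ h, zero_mul, abs_zero]
      positivity
    · have hTp := hT0 j
      rw [norm_smul, Real.norm_of_nonneg hTp.le] at h
      have h1 : ‖η‖ ≤ 1 := by nlinarith [hT2 j, norm_nonneg η]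
      have h2 : ‖η‖ ^ j ≤ ‖η‖ ^ (k + 1) := pow_le_pow_of_le_one (norm_nonneg _) h1 hkj
      have hC0 := hC'0 j
      have h3 : C' j * ‖η‖ ≤ (1 / 2 : ℝ) ^ j := by
        rw [one_div, inv_pow, ← one_div, le_div_iff₀ (by positivity)]
        have h4 := mul_le_mul_of_nonneg_right (hTC' j) (norm_nonneg η)
        nlinarith
      calc |u j (y, η)| = |χ (T j • η)| * |P j (y, η)| := abs_mul _ _
        _ ≤ 1 * (C' j * ‖η‖ ^ j) := by gcongr; exacts [hχle _, hC' j y η]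
        _ ≤ 1 * (C' j * ‖η‖ ^ (k + 1)) := by gcongr
        _ = (C' j * ‖η‖) * ‖η‖ ^ k := by ring
        _ ≤ _ := by gcongr
  refine ⟨fun z => ∑' k, u k z, ?_, fun k y η => ?_⟩
  · refine contDiff_tsum_of_eventually hu (v := fun _ k => (1 / 2 : ℝ) ^ k) (fun _ _ => hsum2)
      fun i _ => ?_
    rw [Nat.cofinite_eq_atTop]
    filter_upwards [eventually_gt_atTop i] with k hk z using hderiv k i hk z
  · have hsu : ∀ z, Summable fun j => u j z := fun z =>
      .of_norm_bounded_eventually hsum2 (by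
        rw [Nat.cofinite_eq_atTop]
        filter_upwards [eventually_gt_atTop 0] with j hj
        have := hderiv j 0 hj z
        rwa [norm_iteratedFDeriv_zero] at this)
    have hhead : ∀ᶠ t : ℝ in 𝓝 0, ∀ j ∈ Finset.range k, u j (y, t • η) = P j (y, t • η) := by
      rw [eventually_all_finset]
      intro j _
      have hc : Tendsto (fun t : ℝ => ‖T j • t • η‖) (𝓝 0) (𝓝 0) := by
        have : Continuous fun t : ℝ => ‖T j • t • η‖ := by fun_prop
        simpa using this.tendsto 0
      filter_upwards [hc.eventually (gt_mem_nhds one_pos)] with t ht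
      simp only [hudef, hχ1 _ ht.le, one_mul]
    -- For small t the terms below k are exactly the P j. The k-th term is bounded by homogeneity,
    -- the later ones by the geometric series.
    refine Asymptotics.IsBigO.of_bound ((C' k + ∑' j, (1 / 2 : ℝ) ^ j) * ‖η‖ ^ k) ?_
    filter_upwards [hhead] with t ht
    have h1 := (hsu (y, t • η)).sum_add_tsum_nat_add (k + 1)
    rw [Finset.sum_range_succ, Finset.sum_congr rfl ht] at h1
    have h2 : (∑' k, u k (y, t • η)) - ∑ j ∈ Finset.range k, P j (y, t • η) =
        u k (y, t • η) + ∑' j, u (j + (k + 1)) (y, t • η) := by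
      rw [← h1]; ring
    have h3 : |u k (y, t • η)| ≤ C' k * ‖t • η‖ ^ k := by
      calc |u k (y, t • η)| = |χ (T k • t • η)| * |P k (y, t • η)| := abs_mul _ _
        _ ≤ 1 * (C' k * ‖t • η‖ ^ k) := by gcongr; exacts [hχle _, hC' k y _]
        _ = _ := one_mul _
    have hs' : Summable fun j : ℕ => (1 / 2 : ℝ) ^ j * ‖t • η‖ ^ k := hsum2.mul_right _
    have h4 : ‖∑' j, u (j + (k + 1)) (y, t • η)‖ ≤ ∑' j : ℕ, (1 / 2 : ℝ) ^ j * ‖t • η‖ ^ k := by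
      refine tsum_of_norm_bounded hs'.hasSum fun j => ?_
      refine (hval (j + (k + 1)) k (by omega) y _).trans ?_
      gcongr ?_ * _
      exact pow_le_pow_of_le_one (by norm_num) (by norm_num) (by omega)
    rw [h2]
    refine (norm_add_le _ _).trans ((add_le_add h3 h4).trans_eq ?_)
    rw [tsum_mul_right, norm_smul, norm_pow, mul_pow]
    ring

end Borel

/-! ### Globally defined coordinates near a point -/

section Coordinates

variable {n : ℕ} {M : Type*} [TopologicalSpace M] [ChartedSpace (EuclideanSpace ℝ (Fin n)) M]
  [IsManifold (𝓡 n) ∞ M]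

/-- Coordinate functions near a point, extended to the whole manifold, with the coordinate vector
fields and a smooth local inverse `m` of the coordinate map. -/
structure LocalCoords (x₀ : M) where
  /-- the coordinate map -/
  φ : C^∞⟮𝓡 n, M; 𝓘(ℝ, EuclideanSpace ℝ (Fin n)), EuclideanSpace ℝ (Fin n)⟯
  /-- a local inverse of the coordinate map -/
  m : C^∞⟮𝓘(ℝ, EuclideanSpace ℝ (Fin n)), EuclideanSpace ℝ (Fin n); 𝓡 n, M⟯
  /-- the coordinate functions -/
  x : Fin n → SmoothFn n M
  /-- the coordinate vector fields -/
  e : Fin n → VectorFieldOn n M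
  /-- the domain of the coordinates -/
  W : Set M
  /-- the domain on which `m` is inverse to the coordinate map -/
  W₁ : Set M
  isOpen_W : IsOpen W
  isOpen_W₁ : IsOpen W₁
  mem : x₀ ∈ W₁
  subset : W₁ ⊆ W
  dual : DualOn W e fun i => differential (x i)
  m_mem : ∀ y, m y ∈ W
  left_inv : ∀ p ∈ W₁, m (φ p) = p

theorem contMDiff_bump_smul_frame [T2Space M] {x₀ : M} (f : SmoothBumpFunction (𝓡 n) x₀)
    (v : EuclideanSpace ℝ (Fin n)) :
    ContMDiff (𝓡 n) ((𝓡 n).prod 𝓘(ℝ, EuclideanSpace ℝ (Fin n))) ∞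
      (fun z => (⟨z, f z • (trivializationAt (EuclideanSpace ℝ (Fin n))
        (TangentSpace (𝓡 n)) x₀).symmL ℝ z v⟩ : TangentBundle (𝓡 n) M)) := by
  intro z
  by_cases hz : z ∈ (chartAt (EuclideanSpace ℝ (Fin n)) x₀).source
  · exact ContMDiffAt.smul_section (f.contMDiff z) (contMDiffAt_frame x₀ v (by simpa using hz))
  · have hn : z ∉ tsupport f := fun h => hz (f.tsupport_subset_chartAt_source h)
    have h0 : ContMDiffAt (𝓡 n) ((𝓡 n).prod 𝓘(ℝ, EuclideanSpace ℝ (Fin n))) ∞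
        (fun z => (⟨z, 0⟩ : TangentBundle (𝓡 n) M)) z :=
      contMDiff_zeroSection ℝ (TangentSpace (𝓡 n) (M := M)) z
    refine h0.congr_of_eventuallyEq ?_
    filter_upwards [(isClosed_tsupport f).isOpen_compl.mem_nhds hn] with y hy
    rw [image_eq_zero_of_notMem_tsupport hy, zero_smul]

/-- A chart times a bump function is global and equals the chart on W. For m, the model space is
first squeezed smoothly into a small ball, a smaller ball being fixed pointwise; the inverse chart
then applies everywhere and takes values in W. -/
theorem exists_localCoords [T2Space M] (x₀ : M) : Nonempty (LocalCoords (n := n) x₀) := by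
  obtain ⟨f⟩ : Nonempty (SmoothBumpFunction (𝓡 n) x₀) := inferInstance
  let E := EuclideanSpace ℝ (Fin n)
  let c := extChartAt (𝓡 n) x₀
  have hsrc : c.source = (chartAt E x₀).source := extChartAt_source _ _
  obtain ⟨W', hW'f, hW'o, hxW'⟩ := eventually_nhds_iff.1 f.eventuallyEq_one
  let W : Set M := W' ∩ c.source
  have hWo : IsOpen W := hW'o.inter (isOpen_extChartAt_source x₀)
  have hxW : x₀ ∈ W := ⟨hxW', mem_extChartAt_source x₀⟩
  have hφs : ContMDiff (𝓡 n) 𝓘(ℝ, E) ∞ (fun z => f z • c z) := by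
    refine f.contMDiff_smul ?_
    exact (contMDiffOn_extChartAt (I := 𝓡 n) (x := x₀)).of_le le_rfl
  have hφW : ∀ z ∈ W, f z • c z = c z := fun z hz => by rw [hW'f z hz.1]; simp
  have hxis : ∀ i : Fin n, ContMDiff (𝓡 n) 𝓘(ℝ, ℝ) ∞ (fun z => (f z • c z) i) := fun i =>
    (EuclideanSpace.proj (𝕜 := ℝ) i).contMDiff.comp hφs
  -- the image of `W` contains a ball
  have himg : c.target ∩ c.symm ⁻¹' W ∈ 𝓝 (c x₀) := by
    refine inter_mem (extChartAt_target_mem_nhds x₀) ?_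
    exact (continuousAt_extChartAt_symm x₀).preimage_mem_nhds
      (by rw [extChartAt_to_inv]; exact hWo.mem_nhds hxW)
  obtain ⟨r, hr0, hr⟩ := Metric.mem_nhds_iff.1 himg
  let b : ContDiffBump (c x₀) := ⟨r / 2, r, by positivity, by linarith⟩
  let s : E → E := fun y => c x₀ + b y • (y - c x₀)
  have hss : ContDiff ℝ ∞ s :=
    contDiff_const.add (b.contDiff.smul (contDiff_id.sub contDiff_const))
  have hsr : ∀ y, s y ∈ Metric.ball (c x₀) r := by
    intro y
    rw [mem_ball_iff_norm]
    simp only [s, add_sub_cancel_left, norm_smul, Real.norm_eq_abs]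
    rw [abs_of_nonneg b.nonneg]
    rcases lt_or_ge (dist y (c x₀)) r with h | h
    · rw [dist_eq_norm] at h
      exact (mul_le_of_le_one_left (norm_nonneg _) b.le_one).trans_lt h
    · rw [b.zero_of_le_dist h, zero_mul]
      exact hr0
  have hms : ContMDiff 𝓘(ℝ, E) (𝓡 n) ∞ (fun y => c.symm (s y)) := by
    have h1 : ContMDiffOn 𝓘(ℝ, E) (𝓡 n) ∞ c.symm c.target := contMDiffOn_extChartAt_symm x₀
    exact contMDiffOn_univ.1 (h1.comp hss.contMDiff.contMDiffOn fun y _ => (hr (hsr y)).1)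
  have hsid : ∀ y ∈ Metric.ball (c x₀) (r / 2), s y = y := by
    intro y hy
    have : b y = 1 := b.one_of_mem_closedBall (Metric.ball_subset_closedBall hy)
    simp [s, this]
  refine ⟨{
    φ := ⟨_, hφs⟩
    m := ⟨_, hms⟩
    x := fun i => ⟨_, hxis i⟩
    e := fun j => ⟨fun z => f z • (trivializationAt E (TangentSpace (𝓡 n)) x₀).symmL ℝ z
      (EuclideanSpace.basisFun (Fin n) ℝ j), contMDiff_bump_smul_frame f _⟩
    W := W
    W₁ := W ∩ (c.source ∩ c ⁻¹' Metric.ball (c x₀) (r / 2))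
    isOpen_W := hWo
    isOpen_W₁ := hWo.inter
      ((continuousOn_extChartAt x₀).isOpen_inter_preimage (isOpen_extChartAt_source x₀)
        Metric.isOpen_ball)
    mem := ⟨hxW, mem_extChartAt_source x₀, Metric.mem_ball_self (by positivity)⟩
    subset := Set.inter_subset_left
    dual := ?_
    m_mem := fun y => (hr (hsr y)).2
    left_inv := ?_ }⟩
  · intro z hz i j
    have hzs : z ∈ (chartAt E x₀).source := by rw [← hsrc]; exact hz.2
    have h1 : (fun z => (f z • c z) i) =ᶠ[𝓝 z] (EuclideanSpace.proj (𝕜 := ℝ) i) ∘ c := by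
      filter_upwards [hWo.mem_nhds hz] with w hw
      simp [hφW w hw]
    have h2 : MDifferentiableAt (𝓡 n) 𝓘(ℝ, E) c z := mdifferentiableAt_extChartAt hzs
    have h3 : mfderiv (𝓡 n) 𝓘(ℝ, ℝ) (fun z => (f z • c z) i) z =
        (EuclideanSpace.proj (𝕜 := ℝ) i : E →L[ℝ] ℝ).comp (mfderiv (𝓡 n) 𝓘(ℝ, E) c z) := by
      rw [h1.mfderiv_eq]
      exact ((EuclideanSpace.proj (𝕜 := ℝ) i : E →L[ℝ] ℝ).hasMFDerivAt.comp z
        h2.hasMFDerivAt).mfderiv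
    have h4 := TangentBundle.continuousLinearMapAt_trivializationAt (I := 𝓡 n) hzs
    have h5 : (trivializationAt E (TangentSpace (𝓡 n)) x₀).continuousLinearMapAt ℝ z
        ((trivializationAt E (TangentSpace (𝓡 n)) x₀).symmL ℝ z
          (EuclideanSpace.basisFun (Fin n) ℝ j)) = EuclideanSpace.basisFun (Fin n) ℝ j :=
      Trivialization.continuousLinearMapAt_symmL _ (by simpa using hzs) _
    have h6 : f z = 1 := hW'f z hz.1
    change mfderiv (𝓡 n) 𝓘(ℝ, ℝ) (fun z => (f z • c z) i) z
      (f z • (trivializationAt E (TangentSpace (𝓡 n)) x₀).symmL ℝ z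
        (EuclideanSpace.basisFun (Fin n) ℝ j)) = _
    have h7 : mfderiv (𝓡 n) 𝓘(ℝ, E) c z
        (f z • (trivializationAt E (TangentSpace (𝓡 n)) x₀).symmL ℝ z
          (EuclideanSpace.basisFun (Fin n) ℝ j)) = EuclideanSpace.basisFun (Fin n) ℝ j := by
      rw [h6, one_smul]
      exact (DFunLike.congr_fun h4 _).symm.trans h5
    refine (DFunLike.congr_fun h3 _).trans ?_
    refine (congrArg (fun w : E => w i) h7).trans ?_
    simp
  · rintro p ⟨hp, hpc, hpb⟩
    change c.symm (s (f p • c p)) = p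
    rw [hφW p hp, hsid _ hpb, c.left_inv hpc]

end Coordinates

/-! ### Dual frames -/

section Frames

variable {n : ℕ}

/-- Duality forces linear independence, and n independent vectors form a basis. -/
theorem eq_sum_of_dual {e : Fin n → EuclideanSpace ℝ (Fin n)}
    {ε : Fin n → (EuclideanSpace ℝ (Fin n) →L[ℝ] ℝ)}
    (h : ∀ i j, ε i (e j) = if i = j then 1 else 0) (v : EuclideanSpace ℝ (Fin n)) :
    v = ∑ i, ε i v • e i := by
  have hli : LinearIndependent ℝ e := by
    rw [Fintype.linearIndependent_iff]
    intro g hg i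
    have := congrArg (ε i) hg
    simpa [map_sum, h] using this
  have hspan : v ∈ Submodule.span ℝ (Set.range e) := by
    rw [hli.span_eq_top_of_card_eq_finrank' (by simp)]
    trivial
  obtain ⟨c, rfl⟩ := (Submodule.mem_span_range_iff_exists_fun ℝ).1 hspan
  refine Finset.sum_congr rfl fun i _ => ?_
  simp [map_sum, h]

variable {M : Type*} [TopologicalSpace M] [ChartedSpace (EuclideanSpace ℝ (Fin n)) M]
  [IsManifold (𝓡 n) ∞ M]

theorem DualOn.vector_eq_sum {W : Set M} {e : Fin n → VectorFieldOn n M} {ε : Fin n → OneForm n M}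
    (h : DualOn W e ε) {x : M} (hx : x ∈ W) (v : TangentSpace (𝓡 n) x) :
    v = ∑ i, (ε i x v : ℝ) • e i x :=
  eq_sum_of_dual (e := fun i => e i x) (ε := fun i => ε i x) (h x hx) v

theorem DualOn.covector_apply {W : Set M} {e : Fin n → VectorFieldOn n M} {ε : Fin n → OneForm n M}
    (h : DualOn W e ε) {x : M} (hx : x ∈ W) (ξ : CotangentFibre n x) (v : TangentSpace (𝓡 n) x) :
    (ξ v : ℝ) = ∑ i, (ξ (e i x) : ℝ) * (ε i x v : ℝ) := by
  conv_lhs => rw [h.vector_eq_sum hx v]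
  rw [map_sum]
  exact Finset.sum_congr rfl fun i _ => by rw [map_smul, smul_eq_mul, mul_comm]

theorem DualOn.covector_eq_sum {W : Set M} {e : Fin n → VectorFieldOn n M}
    {ε : Fin n → OneForm n M} (h : DualOn W e ε) {x : M} (hx : x ∈ W) (ξ : CotangentFibre n x) :
    ξ = ∑ i, (ξ (e i x) : ℝ) • ε i x := by
  ext v
  rw [_root_.sum_apply]
  exact h.covector_apply hx ξ v

end Frames

/-! ### Coordinates on the cotangent bundle -/

section Coordinates

variable {n : ℕ} {M : Type*} [TopologicalSpace M] [ChartedSpace (EuclideanSpace ℝ (Fin n)) M]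
  [IsManifold (𝓡 n) ∞ M]

/-- The model of the coordinate domains of `T*M`. -/
abbrev CoordModel (n : ℕ) : Type := EuclideanSpace ℝ (Fin n) × (Fin n → ℝ)

namespace LocalCoords

variable {x₀ : M} (C : LocalCoords (n := n) x₀)

/-- The coordinate one-forms. -/
def ε (i : Fin n) : OneForm n M := differential (C.x i)

/-- The coordinate parametrization of `T*M`. -/
def param (z : CoordModel n) : CotangentBundle n M := ⟨C.m z.1, ∑ i, z.2 i • C.ε i (C.m z.1)⟩

/-- The coordinates on `T*M`. -/
def chart (p : CotangentBundle n M) : CoordModel n := (C.φ p.1, fun i => p.2 (C.e i p.1))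

theorem contMDiff_chart :
    ContMDiff (cotangentModelWithCorners n) 𝓘(ℝ, CoordModel n) ∞ C.chart := by
  refine ContMDiff.prodMk_space (C.φ.contMDiff.comp (contMDiff_proj _)) ?_
  rw [contMDiff_pi_space]
  exact fun i => (linearFn (C.e i)).contMDiff

theorem contMDiff_param :
    ContMDiff 𝓘(ℝ, CoordModel n) (cotangentModelWithCorners n) ∞ C.param := by
  intro z₀
  rw [contMDiffAt_totalSpace]
  let e := trivializationAt (CotangentModel n) (CotangentFibre n (M := M)) (C.m z₀.1)
  have hbase : ContMDiff 𝓘(ℝ, CoordModel n) (𝓡 n) ∞ (fun z : CoordModel n => C.m z.1) :=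
    C.m.contMDiff.comp contDiff_fst.contMDiff
  refine ⟨hbase z₀, ?_⟩
  have h2 : ∀ i, ContMDiffAt 𝓘(ℝ, CoordModel n) 𝓘(ℝ, CotangentModel n) ∞
      (fun z : CoordModel n => (e (⟨C.m z.1, C.ε i (C.m z.1)⟩ : CotangentBundle n M)).2) z₀ :=
    fun i => ((contMDiffAt_totalSpace (IB := 𝓡 n)).1 (((C.ε i).contMDiff.comp hbase) z₀)).2
  have h3 : ∀ i, ContMDiffAt 𝓘(ℝ, CoordModel n) 𝓘(ℝ, ℝ) ∞ (fun z : CoordModel n => z.2 i) z₀ :=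
    fun i => (ContDiff.contMDiff (by fun_prop)) z₀
  refine (ContMDiffAt.sum (t := Finset.univ) fun i _ => (h3 i).smul (h2 i)).congr_of_eventuallyEq ?_
  have hmem : ∀ᶠ z : CoordModel n in 𝓝 z₀, C.m z.1 ∈ e.baseSet :=
    hbase.continuous.continuousAt.eventually
      (e.open_baseSet.mem_nhds (FiberBundle.mem_baseSet_trivializationAt' _))
  filter_upwards [hmem] with z hz
  have hlin : ∀ v : CotangentFibre n (C.m z.1), (e (⟨C.m z.1, v⟩ : CotangentBundle n M)).2 =
      e.linearMapAt ℝ (C.m z.1) v := fun v => by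
    rw [Trivialization.linearMapAt_apply, if_pos hz]
  change (e (⟨C.m z.1, ∑ i, z.2 i • C.ε i (C.m z.1)⟩ : CotangentBundle n M)).2 = _
  rw [hlin, map_sum]
  exact Finset.sum_congr rfl fun i _ => by
    rw [map_smul]
    exact congrArg (z.2 i • ·) (hlin _).symm

theorem param_chart {p : CotangentBundle n M} (hp : p.1 ∈ C.W₁) : C.param (C.chart p) = p := by
  obtain ⟨x, ξ⟩ := p
  have h1 : C.m (C.φ x) = x := C.left_inv x hp
  have h2 : ∑ i, (ξ (C.e i x) : ℝ) • C.ε i x = ξ :=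
    (C.dual.covector_eq_sum (C.subset hp) ξ).symm
  change (⟨C.m (C.φ x), ∑ i, (ξ (C.e i x) : ℝ) • C.ε i (C.m (C.φ x))⟩ : CotangentBundle n M) = ⟨x, ξ⟩
  rw [h1, h2]

theorem param_zero (y : EuclideanSpace ℝ (Fin n)) : C.param (y, 0) = ⟨C.m y, 0⟩ := by
  simp [param]

theorem param_smul (y : EuclideanSpace ℝ (Fin n)) (t : ℝ) (η : Fin n → ℝ) :
    C.param (y, t • η) = ⟨C.m y, t • (C.param (y, η)).2⟩ := by
  refine congrArg (TotalSpace.mk (C.m y)) ?_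
  exact (Finset.sum_congr rfl fun i _ => (smul_smul t (η i) _).symm).trans Finset.smul_sum.symm

theorem chart_smul (x : M) (t : ℝ) (ξ : CotangentFibre n x) :
    C.chart ⟨x, t • ξ⟩ = (C.φ x, t • (C.chart ⟨x, ξ⟩).2) := by
  simp only [chart, Prod.mk.injEq, true_and]
  funext i
  rfl

theorem param_snd_ne_zero (y : EuclideanSpace ℝ (Fin n)) {η : Fin n → ℝ} (hη : η ≠ 0) :
    (C.param (y, η)).2 ≠ 0 := by
  intro h
  apply hη
  funext j
  have h1 := DFunLike.congr_fun h (C.e j (C.m y))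
  have h2 : (∑ i, η i • C.ε i (C.m y)) (C.e j (C.m y)) = η j := by
    rw [_root_.sum_apply]
    have h3 : ∀ i, ((η i • C.ε i (C.m y)) (C.e j (C.m y)) : ℝ) = η i * if i = j then 1 else 0 :=
      fun i => congrArg (η i * ·) (C.dual (C.m y) (C.m_mem y) i j)
    exact (Finset.sum_congr rfl fun i _ => h3 i).trans (by simp)
  rw [← h2]
  exact h1

/-- The smooth function on `T*M` given by a smooth function of the coordinates. -/
def push {f : CoordModel n → ℝ} (hf : ContDiff ℝ ∞ f) : SmoothFnCot n M :=
  ⟨fun p => f (C.chart p), hf.contMDiff.comp C.contMDiff_chart⟩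

theorem contDiff_pull (F : SmoothFnCot n M) : ContDiff ℝ ∞ fun z => F (C.param z) :=
  (F.contMDiff.comp C.contMDiff_param).contDiff

end LocalCoords

end Coordinates

/-! ### Functions flat along the zero section -/

section Flat

variable {n : ℕ} {M : Type*} [TopologicalSpace M] [ChartedSpace (EuclideanSpace ℝ (Fin n)) M]
  [IsManifold (𝓡 n) ∞ M]

/-- The ideal of the functions on `T*M` that vanish at the zero covector over `y`. -/
def cotPointIdeal (y : M) : Ideal (SmoothFnCot n M) :=
  RingHom.ker ((ContMDiffMap.evalRingHom y).comp (restrictZero (n := n) (M := M)).toRingHom)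

theorem zeroIdeal_le_cotPointIdeal (y : M) : zeroIdeal n M ≤ cotPointIdeal y := by
  intro F hF
  have : restrictZero F = 0 := hF
  exact congrArg (fun f : SmoothFn n M => f y) this

theorem VanishesTo.add {X : Type*} [NormedAddCommGroup X] [NormedSpace ℝ X] {k : ℕ}
    {f g : X → ℝ} {z : X} (hf : ContDiff ℝ ∞ f) (hg : ContDiff ℝ ∞ g) (hfz : VanishesTo k f z)
    (hgz : VanishesTo k g z) : VanishesTo k (fun x => f x + g x) z := by
  intro i hi
  have := iteratedFDeriv_add_apply (i := i) (x := z)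
    (hf.contDiffAt.of_le (by exact_mod_cast le_top)) (hg.contDiffAt.of_le (by exact_mod_cast le_top))
  rw [hfz i hi, hgz i hi, add_zero] at this
  exact this

theorem LocalCoords.vanishesTo {x₀ : M} (C : LocalCoords (n := n) x₀) (y : EuclideanSpace ℝ (Fin n))
    (k : ℕ) : ∀ F ∈ cotPointIdeal (n := n) (C.m y) ^ k,
      VanishesTo k (fun z => F (C.param z)) (y, (0 : Fin n → ℝ)) := by
  induction k with
  | zero => exact fun F _ i hi => absurd hi (Nat.not_lt_zero i)
  | succ k ih =>
    intro F hF
    rw [pow_succ] at hF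
    refine Submodule.mul_induction_on hF (fun a ha b hb => ?_) fun a b ha hb => ?_
    · refine VanishesTo.mul (C.contDiff_pull a) (C.contDiff_pull b) (ih a ha) fun i hi => ?_
      rw [Nat.lt_one_iff] at hi
      subst hi
      rw [← norm_eq_zero, norm_iteratedFDeriv_zero, norm_eq_zero]
      rw [C.param_zero]
      exact hb
    · exact VanishesTo.add (C.contDiff_pull a) (C.contDiff_pull b) ha hb

theorem LocalCoords.isFlat {x₀ : M} (C : LocalCoords (n := n) x₀) {F : SmoothFnCot n M}
    (hF : ∀ y k, F ∈ cotPointIdeal (n := n) (M := M) y ^ k) : IsFlat fun z => F (C.param z) where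
  smooth := C.contDiff_pull F
  zero k y := C.vanishesTo y (k + 1) F (hF _ _) k (Nat.lt_succ_self k)

variable [T2Space M] [SigmaCompactSpace M]

/-- A partition of unity subordinate to a family of neighbourhoods of the points. -/
theorem exists_partition {U : M → Set M} (ho : ∀ x, IsOpen (U x)) (hU : ∀ x, x ∈ U x) :
    ∃ ρ : SmoothPartitionOfUnity M (𝓡 n) M Set.univ, ρ.IsSubordinate U :=
  SmoothPartitionOfUnity.exists_isSubordinate (𝓡 n) isClosed_univ U ho
    fun x _ => Set.mem_iUnion.2 ⟨x, hU x⟩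

/-- Functions on `T*M` can be glued with a partition of unity on `M`. -/
def glue {ι : Type*} (ρ : SmoothPartitionOfUnity ι (𝓡 n) M Set.univ) (H : ι → SmoothFnCot n M) :
    SmoothFnCot n M :=
  ⟨fun p => ∑ᶠ i, ρ i p.1 * H i p, by
    refine contMDiff_finsum (fun i => ?_) ?_
    · exact ((ρ i).contMDiff.comp (contMDiff_proj _)).mul (H i).contMDiff
    · have h1 : LocallyFinite fun i => (fun p : CotangentBundle n M => p.1) ⁻¹'
          Function.support (ρ i) := ρ.locallyFinite.preimage_continuous
            (contMDiff_proj (IB := 𝓡 n) (n := ∞) (CotangentFibre n (M := M))).continuous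
      refine h1.subset fun i p hp => ?_
      have hp' : ρ i p.1 * H i p ≠ 0 := hp
      exact left_ne_zero_of_mul hp'⟩

theorem glue_apply {ι : Type*} (ρ : SmoothPartitionOfUnity ι (𝓡 n) M Set.univ)
    (H : ι → SmoothFnCot n M) (p : CotangentBundle n M) : glue ρ H p = ∑ᶠ i, ρ i p.1 * H i p := rfl

/-- There is a smooth function on `T*M` that is a positive definite quadratic form on the
fibres. -/
theorem exists_quadratic : ∃ q : SmoothFnCot n M,
    (∀ (x : M) (t : ℝ) (ξ : CotangentFibre n x), q ⟨x, t • ξ⟩ = t ^ 2 * q ⟨x, ξ⟩) ∧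
      ∀ (x : M) (ξ : CotangentFibre n x), ξ ≠ 0 → 0 < q ⟨x, ξ⟩ := by
  obtain ⟨C⟩ : Nonempty (∀ x : M, LocalCoords (n := n) x) :=
    ⟨fun x => (exists_localCoords (n := n) x).some⟩
  obtain ⟨ρ, hρ⟩ := exists_partition (n := n) (fun x => (C x).isOpen_W) fun x =>
    (C x).subset (C x).mem
  -- Sums of squares of local fibre coordinates: nonnegative everywhere and definite over the
  -- coordinate domain, so the glued function stays definite.
  let H : M → SmoothFnCot n M := fun i => ∑ j, linearFn ((C i).e j) ^ 2
  have hH : ∀ i (p : CotangentBundle n M), H i p = ∑ j, (p.2 ((C i).e j p.1) : ℝ) ^ 2 := by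
    intro i p
    change ContMDiffMap.evalRingHom p (∑ j, linearFn ((C i).e j) ^ 2) = _
    rw [map_sum]
    rfl
  have hH0 : ∀ i p, 0 ≤ H i p := fun i p => by
    rw [hH]; exact Finset.sum_nonneg fun j _ => sq_nonneg _
  refine ⟨glue ρ H, fun x t ξ => ?_, fun x ξ hξ => ?_⟩
  · rw [glue_apply, glue_apply, ← smul_eq_mul, smul_finsum]
    · refine finsum_congr fun i => ?_
      rw [hH, hH]
      have : ∀ j, (((t • ξ) ((C i).e j x) : ℝ)) ^ 2 = t ^ 2 * (ξ ((C i).e j x) : ℝ) ^ 2 :=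
        fun j => mul_pow t (ξ ((C i).e j x) : ℝ) 2
      simp only [this, ← Finset.mul_sum, smul_eq_mul]
      ring
  · rw [glue_apply]
    obtain ⟨i, hi⟩ := ρ.exists_pos_of_mem (Set.mem_univ x)
    refine finsum_pos (fun i => mul_nonneg (ρ.nonneg i x) (hH0 i _)) ⟨i, ?_⟩ ?_
    · refine mul_pos hi ?_
      rw [hH]
      have hx : x ∈ (C i).W := hρ i (subset_tsupport _ hi.ne')
      by_contra hn
      apply hξ
      have hz : ∀ j, (ξ ((C i).e j x) : ℝ) = 0 := by
        have h0 : ∑ j, (ξ ((C i).e j x) : ℝ) ^ 2 = 0 :=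
          le_antisymm (not_lt.1 hn) (Finset.sum_nonneg fun j _ => sq_nonneg _)
        rw [Finset.sum_eq_zero_iff_of_nonneg fun j _ => sq_nonneg _] at h0
        exact fun j => pow_eq_zero_iff two_ne_zero |>.1 (h0 j (Finset.mem_univ j))
      rw [(C i).dual.covector_eq_sum hx ξ]
      exact Finset.sum_eq_zero fun j _ => by rw [hz, zero_smul]
    · exact (ρ.locallyFinite.point_finite x).subset fun i hi => left_ne_zero_of_mul hi

/-- A function on `T*M` that is flat along the zero section lies in all powers of its ideal. -/
theorem mem_flatIdeal_of_forall {F : SmoothFnCot n M}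
    (hF : ∀ y k, F ∈ cotPointIdeal (n := n) (M := M) y ^ k) : F ∈ flatIdeal n M := by
  obtain ⟨q, hq2, hqpos⟩ := exists_quadratic (n := n) (M := M)
  have hq0 : ∀ x : M, q ⟨x, 0⟩ = 0 := fun x => by
    have h := hq2 x 0 0
    rwa [smul_zero, zero_pow two_ne_zero, zero_mul] at h
  rw [flatIdeal, Submodule.mem_iInf]
  intro k
  -- In coordinates this is a flat function over a power of a fibre norm, so `IsFlat.contDiff_div`
  -- gives smoothness across Z.
  have hG : ContMDiff (cotangentModelWithCorners n) 𝓘(ℝ, ℝ) ∞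
      (fun p : CotangentBundle n M => F p / q p ^ k) := by
    intro p
    obtain ⟨C⟩ := exists_localCoords (n := n) p.1
    have hqn : IsFibreNorm fun z => q (C.param z) :=
      ⟨C.contDiff_pull q, fun y t η => by rw [C.param_smul]; exact hq2 _ _ _, fun y η hη =>
        hqpos _ _ (C.param_snd_ne_zero y hη)⟩
    refine ((C.push ((C.isFlat hF).contDiff_div hqn k)).contMDiff p).congr_of_eventuallyEq ?_
    have hc : Continuous fun p : CotangentBundle n M => p.1 :=
      (contMDiff_proj (IB := 𝓡 n) (n := ∞) (CotangentFibre n (M := M))).continuous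
    filter_upwards [hc.continuousAt.preimage_mem_nhds (C.isOpen_W₁.mem_nhds C.mem)] with p' hp'
    change _ = F (C.param (C.chart p')) / q (C.param (C.chart p')) ^ k
    rw [C.param_chart hp']
  let G : SmoothFnCot n M := ⟨_, hG⟩
  have hFG : F = q ^ k * G := by
    ext p
    change F p = q p ^ k * (F p / q p ^ k)
    obtain ⟨x, ξ⟩ := p
    rcases eq_or_ne ξ 0 with rfl | hξ
    · have h0 : F ⟨x, 0⟩ = 0 := by
        have := hF x 1
        rw [pow_one] at this
        exact this
      rw [h0, zero_div, mul_zero]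
    · rw [mul_div_cancel₀]
      exact pow_ne_zero _ (hqpos x ξ hξ).ne'
  rw [hFG]
  refine Ideal.mul_mem_right _ _ (Ideal.pow_mem_pow ?_ k)
  ext x
  exact hq0 x

end Flat

/-! ### Lie brackets as commutators of derivatives -/

section LieBracket

variable {n : ℕ} {M : Type*} [TopologicalSpace M] [ChartedSpace (EuclideanSpace ℝ (Fin n)) M]
  [IsManifold (𝓡 n) ∞ M]

local notation "𝔼" => EuclideanSpace ℝ (Fin n)

/-- A vector field in the chart at `x`. -/
def inChart (X : ∀ y : M, TangentSpace (𝓡 n) y) (x : M) : 𝔼 → 𝔼 :=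
  VectorField.mpullbackWithin 𝓘(ℝ, 𝔼) (𝓡 n) (extChartAt (𝓡 n) x).symm X (Set.range (𝓡 n))

theorem fderiv_inChart (X : ∀ y : M, TangentSpace (𝓡 n) y) (x : M) {g : M → ℝ} {y : 𝔼}
    (hy : y ∈ (extChartAt (𝓡 n) x).target)
    (hg : MDifferentiableAt (𝓡 n) 𝓘(ℝ, ℝ) g ((extChartAt (𝓡 n) x).symm y)) :
    fderiv ℝ (g ∘ (extChartAt (𝓡 n) x).symm) y (inChart X x y) =
      mvfderiv (𝓡 n) g ((extChartAt (𝓡 n) x).symm y) (X ((extChartAt (𝓡 n) x).symm y)) := by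
  set c := extChartAt (𝓡 n) x
  have hinv : (mfderivWithin 𝓘(ℝ, 𝔼) (𝓡 n) c.symm (Set.range (𝓡 n)) y).IsInvertible :=
    isInvertible_mfderivWithin_extChartAt_symm hy
  have hc : MDifferentiableWithinAt 𝓘(ℝ, 𝔼) (𝓡 n) c.symm (Set.range (𝓡 n)) y :=
    mdifferentiableWithinAt_extChartAt_symm hy
  have hcomp := hg.hasMFDerivAt.comp_hasMFDerivWithinAt y hc.hasMFDerivWithinAt
  have hr : ∀ (f : 𝔼 → ℝ) (L : 𝔼 →L[ℝ] ℝ),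
      HasFDerivWithinAt f L (Set.range (𝓡 n)) y → fderiv ℝ f y = L := by
    intro f L h
    have hr : Set.range (𝓡 n) = Set.univ := by simp
    rw [hr, hasFDerivWithinAt_univ] at h
    exact h.fderiv
  have h2 := hr (g ∘ c.symm)
    ((mfderiv (𝓡 n) 𝓘(ℝ, ℝ) g (c.symm y) : 𝔼 →L[ℝ] ℝ).comp
      (mfderivWithin 𝓘(ℝ, 𝔼) (𝓡 n) c.symm (Set.range (𝓡 n)) y : 𝔼 →L[ℝ] 𝔼))
    hcomp.hasFDerivWithinAt
  rw [h2]
  have h3 : mfderivWithin 𝓘(ℝ, 𝔼) (𝓡 n) c.symm (Set.range (𝓡 n)) y (inChart X x y) =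
      X (c.symm y) := by
    exact hinv.self_apply_inverse _
  exact congrArg (fun v => mvfderiv (𝓡 n) g (c.symm y) v) h3

theorem mvfderiv_eq_fderiv_chart {g : M → ℝ} {x : M} (hg : MDifferentiableAt (𝓡 n) 𝓘(ℝ, ℝ) g x)
    (v : 𝔼) : mvfderiv (𝓡 n) g x v =
      fderiv ℝ (g ∘ (extChartAt (𝓡 n) x).symm) (extChartAt (𝓡 n) x x) v := by
  have h := hg.mfderiv
  have h2 : mvfderiv (𝓡 n) g x v = mfderiv (𝓡 n) 𝓘(ℝ, ℝ) g x v := rfl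
  rw [h2, h]
  simp only [modelWithCornersSelf_coe, Set.range_id, fderivWithin_univ]
  rfl

theorem contDiffAt_comp_chart_symm {g : M → ℝ} (hg : ContMDiff (𝓡 n) 𝓘(ℝ, ℝ) ∞ g) (x : M) {y : 𝔼}
    (hy : y ∈ (extChartAt (𝓡 n) x).target) :
    ContDiffAt ℝ ∞ (g ∘ (extChartAt (𝓡 n) x).symm) y := by
  have h1 : ContMDiffOn 𝓘(ℝ, 𝔼) 𝓘(ℝ, ℝ) ∞ (g ∘ (extChartAt (𝓡 n) x).symm)
      (extChartAt (𝓡 n) x).target :=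
    hg.comp_contMDiffOn (contMDiffOn_extChartAt_symm x)
  exact (h1.contMDiffAt ((isOpen_extChartAt_target x).mem_nhds hy)).contDiffAt

/-- The derivative of a function along a Lie bracket of vector fields. -/
theorem mvfderiv_mlieBracket (X Y : VectorFieldOn n M) (h : SmoothFn n M) (x : M) :
    mvfderiv (𝓡 n) h x (VectorField.mlieBracket (𝓡 n) X Y x) =
      mvfderiv (𝓡 n) (fieldDeriv Y h) x (X x) - mvfderiv (𝓡 n) (fieldDeriv X h) x (Y x) := by
  set c := extChartAt (𝓡 n) x with hc
  have hcx : c x ∈ c.target := mem_extChartAt_target x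
  have hxx : c.symm (c x) = x := extChartAt_to_inv x
  have hmd : ∀ (g : SmoothFn n M) (y : M), MDifferentiableAt (𝓡 n) 𝓘(ℝ, ℝ) g y := fun g y =>
    (g.contMDiff y).mdifferentiableAt (by simp)
  have hdiff : ∀ X : VectorFieldOn n M, DifferentiableAt ℝ (inChart X x) (c x) := by
    intro X
    have h1 : DifferentiableWithinAt ℝ (inChart X x) (c.symm ⁻¹' Set.univ ∩ Set.range (𝓡 n))
        (c x) := ((X.contMDiff x).mdifferentiableAt (by simp)).mdifferentiableWithinAt
          (s := Set.univ) |>.differentiableWithinAt_mpullbackWithin_vectorField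
    have hs : c.symm ⁻¹' Set.univ ∩ Set.range (𝓡 n) = Set.univ := by simp
    rwa [hs, differentiableWithinAt_univ] at h1
  set f : 𝔼 → ℝ := h ∘ c.symm with hf
  have hfd : ContDiffAt ℝ ∞ f (c x) := contDiffAt_comp_chart_symm h.contMDiff x hcx
  have hf' : DifferentiableAt ℝ (fderiv ℝ f) (c x) :=
    (hfd.fderiv_right (m := 1) (by norm_cast)).differentiableAt (by simp)
  have hYh : ∀ Y : VectorFieldOn n M, fieldDeriv Y h ∘ c.symm =ᶠ[𝓝 (c x)]
      fun y => fderiv ℝ f y (inChart Y x y) := by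
    intro Y
    filter_upwards [(isOpen_extChartAt_target x).mem_nhds hcx] with y hy
    exact (fderiv_inChart Y x hy (hmd h _)).symm
  have htrans : ∀ (g : SmoothFn n M) (X : VectorFieldOn n M) (z : M), z = x →
      mvfderiv (𝓡 n) g z (X z) = mvfderiv (𝓡 n) g x (X x) := by
    rintro g X _ rfl; rfl
  have hterm : ∀ X Y : VectorFieldOn n M, mvfderiv (𝓡 n) (fieldDeriv Y h) x (X x) =
      fderiv ℝ (fderiv ℝ f) (c x) (inChart X x (c x)) (inChart Y x (c x)) +
        fderiv ℝ f (c x) (fderiv ℝ (inChart Y x) (c x) (inChart X x (c x))) := by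
    intro X Y
    rw [← htrans (fieldDeriv Y h) X _ hxx, ← fderiv_inChart X x hcx (hmd _ _), (hYh Y).fderiv_eq,
      (hf'.hasFDerivAt.clm_apply (hdiff Y).hasFDerivAt).fderiv, add_comm]
    rfl
  -- Symmetry of the second derivative cancels the second-order terms of X(Yh) - Y(Xh).
  have hsymm := (hfd.isSymmSndFDerivAt (by rw [minSmoothness_of_isRCLikeNormedField]; norm_cast))
    (inChart X x (c x)) (inChart Y x (c x))
  have hbr : VectorField.mlieBracket (𝓡 n) X Y x =
      fderiv ℝ (inChart Y x) (c x) (inChart X x (c x)) -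
        fderiv ℝ (inChart X x) (c x) (inChart Y x (c x)) := by
    -- The preferred chart at x has identity differential at x, so the bracket computed in the chart
    -- is the bracket at x without transport.
    have hid : mfderiv (𝓡 n) 𝓘(ℝ, 𝔼) c x = ContinuousLinearMap.id ℝ 𝔼 := mfderiv_extChartAt_self
    have hs : c.symm ⁻¹' Set.univ ∩ Set.range (𝓡 n) = Set.univ := by simp
    have h1 : VectorField.lieBracketWithin ℝ (inChart X x) (inChart Y x)
        (c.symm ⁻¹' Set.univ ∩ Set.range (𝓡 n)) (c x) =
        fderiv ℝ (inChart Y x) (c x) (inChart X x (c x)) -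
          fderiv ℝ (inChart X x) (c x) (inChart Y x (c x)) := by
      rw [hs, VectorField.lieBracketWithin_univ]
      rfl
    rw [← h1]
    refine (congrArg (fun L : 𝔼 →L[ℝ] 𝔼 => L.inverse (VectorField.lieBracketWithin ℝ (inChart X x)
      (inChart Y x) (c.symm ⁻¹' Set.univ ∩ Set.range (𝓡 n)) (c x))) hid).trans ?_
    simp
  rw [hterm, hterm, hsymm, hbr]
  refine (mvfderiv_eq_fderiv_chart (hmd h x) _).trans ?_
  rw [map_sub]
  ring

end LieBracket

/-! ### Localization of one-forms -/

section LocalDecomposition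

variable {n : ℕ} {M : Type*} [TopologicalSpace M] [ChartedSpace (EuclideanSpace ℝ (Fin n)) M]
  [IsManifold (𝓡 n) ∞ M]

theorem exists_bump [T2Space M] {W : Set M} (hW : IsOpen W) {x : M} (hx : x ∈ W) :
    ∃ χ : SmoothFn n M, (∀ᶠ y in 𝓝 x, χ y = 1) ∧ tsupport χ ⊆ W := by
  obtain ⟨f, -, hf⟩ := (SmoothBumpFunction.nhds_basis_tsupport (I := 𝓡 n) x).mem_iff.1
    (hW.mem_nhds hx)
  exact ⟨⟨f, f.contMDiff⟩, f.eventuallyEq_one, hf⟩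

theorem DualOn.fnSmul_eq_sum {W : Set M} {e : Fin n → VectorFieldOn n M} {ε : Fin n → OneForm n M}
    (h : DualOn W e ε) {χ : SmoothFn n M} (hχ : ∀ y, y ∉ W → χ y = 0) (α : OneForm n M) :
    fnSmul χ α = ∑ i, fnSmul (χ * pairing α (e i)) (ε i) := by
  ext1 y
  have h1 : (∑ i, fnSmul (χ * pairing α (e i)) (ε i)) y =
      ∑ i, (χ y * (α y (e i y) : ℝ)) • ε i y := by
    have := congrFun (map_sum (ContMDiffSection.coeAddHom (𝓡 n) (CotangentModel n) ∞
      (CotangentFibre n (M := M))) (fun i => fnSmul (χ * pairing α (e i)) (ε i)) Finset.univ) y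
    refine this.trans ?_
    rw [Finset.sum_apply]
    rfl
  rw [h1]
  by_cases hy : y ∈ W
  · change χ y • α y = _
    conv_lhs => rw [h.covector_eq_sum hy (α y)]
    rw [Finset.smul_sum]
    exact Finset.sum_congr rfl fun i _ => smul_smul _ _ _
  · change χ y • α y = _
    simp [hχ y hy]

/-- A `C^∞(M)`-linear functional on one-forms at `x` that vanishes on exact forms is zero. -/
theorem eq_zero_of_differential [T2Space M] {x : M} (L : OneForm n M →+ ℝ)
    (hsmul : ∀ (f : SmoothFn n M) (α : OneForm n M), L (fnSmul f α) = f x * L α)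
    (hd : ∀ f : SmoothFn n M, L (differential f) = 0) (α : OneForm n M) : L α = 0 := by
  obtain ⟨C⟩ := exists_localCoords (n := n) x
  obtain ⟨χ, hχ1, hχ⟩ := exists_bump (n := n) C.isOpen_W (C.subset C.mem)
  -- The bump χ turns the frame expansion of α into a global identity; as χ(x) = 1, it does not
  -- change L α.
  have h1 : L (fnSmul χ α) = 0 := by
    rw [C.dual.fnSmul_eq_sum (fun y hy => image_eq_zero_of_notMem_tsupport fun h => hy (hχ h)),
      map_sum]
    exact Finset.sum_eq_zero fun i _ => by rw [hsmul, hd, mul_zero]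
  rwa [hsmul, hχ1.self_of_nhds, one_mul] at h1

end LocalDecomposition

/-! ### The bundle map # respects brackets -/

section Sharp

variable {n : ℕ} {M : Type*} [TopologicalSpace M] [ChartedSpace (EuclideanSpace ℝ (Fin n)) M]
  [IsManifold (𝓡 n) ∞ M]

namespace PoissonStructure

variable (P : PoissonStructure n M)

theorem bivector_skew (α β : OneForm n M) : P.bivector α β = -P.bivector β α := by
  ext x
  exact P.skew x (α x) (β x)

theorem bivector_add_left (α α' β : OneForm n M) :
    P.bivector (α + α') β = P.bivector α β + P.bivector α' β := by
  ext x
  change (β x (P.sharp x (α x + α' x)) : ℝ) = _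
  rw [map_add, map_add]
  rfl

theorem bivector_fnSmul_left (f : SmoothFn n M) (α β : OneForm n M) :
    P.bivector (fnSmul f α) β = f * P.bivector α β := by
  ext x
  change (β x (P.sharp x (f x • α x)) : ℝ) = _
  rw [map_smul, map_smul]
  rfl

theorem sharpField_add (α β : OneForm n M) :
    P.sharpField (α + β) = P.sharpField α + P.sharpField β := by
  ext1 x
  exact map_add (P.sharp x) (α x) (β x)

/-- The obstruction to `#` being a homomorphism, as a tensor. -/
def bracketDefect (f : SmoothFn n M) (α β : OneForm n M) (x : M) : ℝ :=
  (β x (VectorField.mlieBracket (𝓡 n) (P.sharpField α) (P.sharpField (differential f)) x) : ℝ) -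
    (α x (VectorField.mlieBracket (𝓡 n) (P.sharpField β) (P.sharpField (differential f)) x) : ℝ) +
    fieldDeriv (P.sharpField (differential f)) (P.bivector α β) x

theorem bracketDefect_skew (f : SmoothFn n M) (α β : OneForm n M) (x : M) :
    P.bracketDefect f α β x = -P.bracketDefect f β α x := by
  have h : fieldDeriv (P.sharpField (differential f)) (P.bivector α β) x =
      -fieldDeriv (P.sharpField (differential f)) (P.bivector β α) x := by
    rw [P.bivector_skew α β]
    exact DFunLike.congr_fun (mvfderiv_neg (I := 𝓡 n) (g := P.bivector β α) (x := x)) _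
  unfold bracketDefect
  rw [h]
  ring

theorem mdifferentiableAt_fn (f : SmoothFn n M) (x : M) :
    MDifferentiableAt (𝓡 n) 𝓘(ℝ, ℝ) f x := (f.contMDiff x).mdifferentiableAt (by simp)

theorem bracketDefect_add (f : SmoothFn n M) (α α' β : OneForm n M) (x : M) :
    P.bracketDefect f (α + α') β x = P.bracketDefect f α β x + P.bracketDefect f α' β x := by
  have := isManifold_minSmoothness (n := n) (M := M)
  have h1 : VectorField.mlieBracket (𝓡 n) (P.sharpField (α + α'))
      (P.sharpField (differential f)) x =
      VectorField.mlieBracket (𝓡 n) (P.sharpField α) (P.sharpField (differential f)) x +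
      VectorField.mlieBracket (𝓡 n) (P.sharpField α') (P.sharpField (differential f)) x := by
    rw [sharpField_add]
    exact VectorField.mlieBracket_add_left
      (((P.sharpField α).contMDiff x).mdifferentiableAt (by simp))
      (((P.sharpField α').contMDiff x).mdifferentiableAt (by simp))
  have h2 : fieldDeriv (P.sharpField (differential f)) (P.bivector (α + α') β) x =
      fieldDeriv (P.sharpField (differential f)) (P.bivector α β) x +
      fieldDeriv (P.sharpField (differential f)) (P.bivector α' β) x := by
    rw [bivector_add_left]
    exact DFunLike.congr_fun (mvfderiv_add (mdifferentiableAt_fn (P.bivector α β) x)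
      (mdifferentiableAt_fn (P.bivector α' β) x)) _
  unfold bracketDefect
  rw [h1, h2, map_add]
  change _ - ((α x _ : ℝ) + (α' x _ : ℝ)) + _ = _
  ring

/-- With Y = #df, the bracket [h #α, Y] produces -(Yh) Π(α, β), which cancels the Leibniz term of
Y(h Π(α, β)). -/
theorem bracketDefect_fnSmul (f h : SmoothFn n M) (α β : OneForm n M) (x : M) :
    P.bracketDefect f (fnSmul h α) β x = h x * P.bracketDefect f α β x := by
  have := isManifold_minSmoothness (n := n) (M := M)
  have h0 : (P.sharpField (fnSmul h α) : ∀ y, TangentSpace (𝓡 n) y) =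
      (h : M → ℝ) • (P.sharpField α : ∀ y, TangentSpace (𝓡 n) y) := by
    funext y
    exact map_smul (P.sharp y) (h y) (α y)
  have h1 := VectorField.mlieBracket_smul_left (I := 𝓡 n) (W := P.sharpField (differential f))
    (mdifferentiableAt_fn h x)
    (((P.sharpField α).contMDiff x).mdifferentiableAt (by simp))
  have h2 : fieldDeriv (P.sharpField (differential f)) (P.bivector (fnSmul h α) β) x =
      h x * fieldDeriv (P.sharpField (differential f)) (P.bivector α β) x +
      (P.bivector α β x) * mvfderiv (𝓡 n) h x (P.sharpField (differential f) x) := by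
    rw [bivector_fnSmul_left]
    exact DFunLike.congr_fun (mvfderiv_mul (mdifferentiableAt_fn h x)
      (mdifferentiableAt_fn (P.bivector α β) x)) _
  unfold bracketDefect
  rw [h2, h0, h1, map_add, map_smul, map_smul]
  change -(mvfderiv (𝓡 n) h x (P.sharpField (differential f) x) : ℝ) * (P.bivector α β x) +
    h x * (β x _ : ℝ) - h x * (α x _ : ℝ) + _ = _
  ring

/-- On exact forms every term is a double Poisson bracket of f, a, b, and their sum vanishes by the
Jacobi identity. -/
theorem bracketDefect_differential (f a b : SmoothFn n M) (x : M) :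
    P.bracketDefect f (differential a) (differential b) x = 0 := by
  have hskew : ∀ u v, bracketOf P.sharp u v = -bracketOf P.sharp v u := fun u v =>
    P.bivector_skew (differential u) (differential v)
  have hneg : ∀ u v, bracketOf P.sharp u (-v) = -bracketOf P.sharp u v := by
    intro u v
    ext y
    exact DFunLike.congr_fun (mvfderiv_neg (I := 𝓡 n) (g := v) (x := y)) _
  have h1 : ∀ u v : SmoothFn n M, (differential v x (VectorField.mlieBracket (𝓡 n)
      (P.sharpField (differential u)) (P.sharpField (differential f)) x) : ℝ) =
      bracketOf P.sharp u (bracketOf P.sharp f v) x -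
        bracketOf P.sharp f (bracketOf P.sharp u v) x := fun u v =>
    mvfderiv_mlieBracket (P.sharpField (differential u)) (P.sharpField (differential f)) v x
  have hj := DFunLike.congr_fun (P.jacobi f a b) x
  rw [hskew b f, hneg] at hj
  have hj' : bracketOf P.sharp f (bracketOf P.sharp a b) x +
      -bracketOf P.sharp a (bracketOf P.sharp f b) x +
      bracketOf P.sharp b (bracketOf P.sharp f a) x = 0 := hj
  have h2 : bracketOf P.sharp f (bracketOf P.sharp b a) x =
      -bracketOf P.sharp f (bracketOf P.sharp a b) x := by
    rw [hskew b a, hneg]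
    rfl
  unfold bracketDefect
  rw [h1, h1, h2]
  change _ + bracketOf P.sharp f (bracketOf P.sharp a b) x = 0
  linear_combination -hj'

/-- Tensoriality reduces one argument to exact forms; skew-symmetry then allows the same reduction
for the other. -/
theorem bracketDefect_eq_zero [T2Space M] (f : SmoothFn n M) (α β : OneForm n M) (x : M) :
    P.bracketDefect f α β x = 0 := by
  have key : ∀ γ : OneForm n M, (∀ g, P.bracketDefect f (differential g) γ x = 0) →
      ∀ α, P.bracketDefect f α γ x = 0 := fun γ hγ α =>
    eq_zero_of_differential (x := x)
      (AddMonoidHom.mk' (fun α => P.bracketDefect f α γ x) fun α α' =>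
        P.bracketDefect_add f α α' γ x)
      (fun h α => P.bracketDefect_fnSmul f h α γ x) hγ α
  refine key β (fun g => ?_) α
  rw [bracketDefect_skew, key _ fun h => P.bracketDefect_differential f h g x, neg_zero]

/-- The map `#` is compatible with the brackets of one-forms and of vector fields. -/
theorem fieldDeriv_formBracket [T2Space M] (α β : OneForm n M) (f : SmoothFn n M) :
    fieldDeriv (P.sharpField (P.formBracket α β)) f =
      fieldDeriv (P.sharpField α) (fieldDeriv (P.sharpField β) f) -
        fieldDeriv (P.sharpField β) (fieldDeriv (P.sharpField α) f) := by
  ext x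
  -- Since (#γ) f = -⟨γ, #df⟩, the claim is read off by evaluating [α, β] on Y; what remains is the
  -- tensor `bracketDefect`.
  set Y := P.sharpField (differential f) with hY
  have hmY := (Y.contMDiff x).mdifferentiableAt (by simp : (∞ : ℕ∞ω) ≠ 0)
  have hYp : ∀ γ : OneForm n M, (fun y => (γ y (Y y) : ℝ)) =
      fun y => -fieldDeriv (P.sharpField γ) f y := fun γ => by
    funext y
    exact P.skew y (differential f y) (γ y)
  have h1 : ∀ γ δ : OneForm n M, (lieDerivFun (P.sharpField γ) δ x (Y x) : ℝ) =
      -fieldDeriv (P.sharpField γ) (fieldDeriv (P.sharpField δ) f) x -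
        (δ x (VectorField.mlieBracket (𝓡 n) (P.sharpField γ) Y x) : ℝ) := by
    intro γ δ
    rw [lieDerivFun_apply _ _ hmY, lieDerivAux, hYp δ]
    congr 1
    exact DFunLike.congr_fun (mvfderiv_neg (I := 𝓡 n)
      (g := fieldDeriv (P.sharpField δ) f) (x := x)) _
  have h2 : fieldDeriv (P.sharpField (P.formBracket α β)) f x =
      -((lieDerivFun (P.sharpField α) β x (Y x) : ℝ) - (lieDerivFun (P.sharpField β) α x (Y x) : ℝ) -
        fieldDeriv Y (P.bivector α β) x) := P.skew x (P.formBracket α β x) (differential f x)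
  have h3 := P.bracketDefect_eq_zero f α β x
  unfold bracketDefect at h3
  rw [← hY] at h3
  rw [h2, h1, h1]
  change _ = fieldDeriv (P.sharpField α) (fieldDeriv (P.sharpField β) f) x -
    fieldDeriv (P.sharpField β) (fieldDeriv (P.sharpField α) f) x
  linear_combination h3

end PoissonStructure

end Sharp

/-! ### Separated quotients and induced derivations -/

section Completion

variable {A : Type*} [CommRing A] [Algebra ℝ A] (I : Ideal A)

/-- The quotient of a ring by the intersection of the powers of an ideal. -/
def Separation : Type _ := A ⧸ (⨅ k : ℕ, I ^ k)

instance : CommRing (Separation I) := inferInstanceAs (CommRing (A ⧸ (⨅ k : ℕ, I ^ k)))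

instance : Algebra ℝ (Separation I) := inferInstanceAs (Algebra ℝ (A ⧸ (⨅ k : ℕ, I ^ k)))

/-- The projection to the separation. -/
def toSeparation : A →ₐ[ℝ] Separation I := Ideal.Quotient.mkₐ ℝ (⨅ k : ℕ, I ^ k)

theorem toSeparation_surjective : Function.Surjective (toSeparation I) :=
  Ideal.Quotient.mkₐ_surjective ℝ _

variable {I}

theorem toSeparation_eq_zero {a : A} : toSeparation I a = 0 ↔ ∀ k, a ∈ I ^ k :=
  Ideal.Quotient.eq_zero_iff_mem.trans (Submodule.mem_iInf _)

/-- The kernel of the projection lies in every power of I, so membership in a power is reflected. -/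
theorem mem_pow_of_toSeparation {a : A} {k : ℕ}
    (h : toSeparation I a ∈ I.map (toSeparation I).toRingHom ^ k) : a ∈ I ^ k := by
  rw [← Ideal.map_pow] at h
  obtain ⟨b, hb, hab⟩ := (Ideal.mem_map_iff_of_surjective (toSeparation I).toRingHom
    (toSeparation_surjective I)).1 h
  have h1 : toSeparation I (b - a) = 0 := by
    rw [map_sub, sub_eq_zero]
    exact hab
  have := sub_mem hb (toSeparation_eq_zero.1 h1 k)
  rwa [sub_sub_cancel] at this

theorem separation_separated (a : Separation I)
    (h : ∀ k, a ∈ I.map (toSeparation I).toRingHom ^ k) : a = 0 := by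
  obtain ⟨a, rfl⟩ := toSeparation_surjective I a
  exact toSeparation_eq_zero.2 fun k => mem_pow_of_toSeparation (h k)

theorem derivation_separation (d : Derivation ℝ A A) {a : A} (ha : toSeparation I a = 0) :
    toSeparation I (d a) = 0 :=
  toSeparation_eq_zero.2 fun k => derivation_pow d I k a (toSeparation_eq_zero.1 ha (k + 1))

variable (I) in
/-- The derivation of the separation defined by a derivation. -/
def separationDerivation (d : Derivation ℝ A A) : Derivation ℝ (Separation I) (Separation I) :=
  Derivation.liftOfSurjective (f := toSeparation I) (toSeparation_surjective I)
    fun _ => derivation_separation d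

theorem separationDerivation_apply (d : Derivation ℝ A A) (a : A) :
    separationDerivation I d (toSeparation I a) = toSeparation I (d a) :=
  Derivation.liftOfSurjective_apply (f := toSeparation I) (toSeparation_surjective I)
    (fun _ => derivation_separation d) a

theorem separationDerivation_ext {d d' : Derivation ℝ (Separation I) (Separation I)}
    (h : ∀ a, d (toSeparation I a) = d' (toSeparation I a)) : d = d' := by
  ext a
  obtain ⟨a, rfl⟩ := toSeparation_surjective I a
  exact h a

theorem separationDerivation_add (d d' : Derivation ℝ A A) :
    separationDerivation I (d + d') = separationDerivation I d + separationDerivation I d' :=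
  separationDerivation_ext fun a => by
    simp only [Derivation.add_apply, separationDerivation_apply, map_add]

theorem separationDerivation_smul (c : A) (d : Derivation ℝ A A) :
    separationDerivation I (c • d) = toSeparation I c • separationDerivation I d :=
  separationDerivation_ext fun a => by
    simp only [Derivation.smul_apply, separationDerivation_apply, smul_eq_mul, map_mul]

theorem toSeparation_add (a b : A) : toSeparation I (a + b) = toSeparation I a + toSeparation I b :=
  map_add _ a b

theorem separationDerivation_lie (d d' : Derivation ℝ A A) :
    separationDerivation I ⁅d, d'⁆ = ⁅separationDerivation I d, separationDerivation I d'⁆ :=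
  separationDerivation_ext fun a => by
    simp only [Derivation.commutator_apply, separationDerivation_apply, map_sub]

theorem separationDerivation_sum_smul {ι : Type*} [Fintype ι] (c : ι → A)
    (d : ι → Derivation ℝ A A) : separationDerivation I (∑ i, c i • d i) =
      ∑ i, toSeparation I (c i) • separationDerivation I (d i) :=
  separationDerivation_ext fun a => by
    rw [separationDerivation_apply, derivation_sum_smul_apply, derivation_sum_smul_apply, map_sum]
    exact Finset.sum_congr rfl fun i _ => by rw [map_mul, separationDerivation_apply]

/-- From χ a = 0 follows a = (1 - χ)^k a for every k. -/
theorem toSeparation_eq_zero_of_mul {a χ : A} (hχ : 1 - χ ∈ I) (h : χ * a = 0) :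
    toSeparation I a = 0 := by
  rw [toSeparation_eq_zero]
  intro k
  have h1 : ∀ k : ℕ, (1 - χ) ^ k * a = a := by
    intro k
    induction k with
    | zero => simp
    | succ k ih => rw [pow_succ, mul_assoc, sub_mul, h, one_mul, sub_zero, ih]
  rw [← h1 k]
  exact Ideal.mul_mem_right _ _ (Ideal.pow_mem_pow hχ k)

end Completion

/-! ### Stalks of formal functions at points of the zero section -/

section Points

variable {n : ℕ} {M : Type*} [TopologicalSpace M] [ChartedSpace (EuclideanSpace ℝ (Fin n)) M]
  [IsManifold (𝓡 n) ∞ M]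

variable (n M) in
/-- The pull-back of functions, as a homomorphism. -/
def pullbackHom : SmoothFn n M →ₐ[ℝ] FormalFn n M where
  toFun := pullback
  map_one' := rfl
  map_mul' _ _ := rfl
  map_zero' := rfl
  map_add' _ _ := rfl
  commutes' _ := rfl

theorem pullbackHom_apply (f : SmoothFn n M) : pullbackHom n M f = pullback f := rfl

theorem toFormal_surjective (F : FormalFn n M) : ∃ G : SmoothFnCot n M, toFormal G = F :=
  Ideal.Quotient.mk_surjective F

theorem restrict_pullback (f : SmoothFn n M) : restrict (pullback f) = f := rfl

theorem restrict_hatField (X : VectorFieldOn n M) : restrict (hatField X) = 0 := rfl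

/-- The ideal of the formal functions that vanish at the zero covector over `y`. -/
def pointIdeal (y : M) : Ideal (FormalFn n M) :=
  RingHom.ker ((ContMDiffMap.evalRingHom y).comp (restrict (n := n) (M := M)).toRingHom)

theorem mem_pointIdeal {y : M} {F : FormalFn n M} : F ∈ pointIdeal y ↔ restrict F y = 0 := Iff.rfl

theorem map_cotPointIdeal (y : M) :
    (cotPointIdeal y).map (Ideal.Quotient.mk (flatIdeal n M)) = pointIdeal y := by
  ext F
  rw [Ideal.mem_map_iff_of_surjective _ Ideal.Quotient.mk_surjective]
  constructor
  · rintro ⟨G, hG, rfl⟩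
    exact hG
  · intro hF
    obtain ⟨G, rfl⟩ := Ideal.Quotient.mk_surjective F
    exact ⟨G, hF, rfl⟩

theorem toFormal_mem_pow {y : M} {G : SmoothFnCot n M} {k : ℕ} :
    toFormal G ∈ pointIdeal y ^ k ↔ G ∈ cotPointIdeal y ^ k := by
  rw [← map_cotPointIdeal, ← Ideal.map_pow]
  constructor
  · intro h
    obtain ⟨G', hG', h2⟩ :=
      (Ideal.mem_map_iff_of_surjective _ Ideal.Quotient.mk_surjective).1 h
    have h3 : G' - G ∈ flatIdeal n M := Ideal.Quotient.eq.1 h2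
    rw [flatIdeal, Submodule.mem_iInf] at h3
    have := sub_mem hG' (Ideal.pow_right_mono (zeroIdeal_le_cotPointIdeal y) k (h3 k))
    rwa [sub_sub_cancel] at this
  · exact fun h => Ideal.mem_map_of_mem _ h

/-- The formal germs at `y`. -/
abbrev Stalk (y : M) : Type _ := Separation (pointIdeal (n := n) y)

variable (n) in
/-- The germ of a formal function. -/
abbrev toStalk (y : M) : FormalFn n M →ₐ[ℝ] Stalk (n := n) y := toSeparation (pointIdeal y)

/-- The germ of a formal vector field. -/
abbrev stalkDer (y : M) (U : FormalVectorField n M) :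
    Derivation ℝ (Stalk (n := n) y) (Stalk (n := n) y) := separationDerivation (pointIdeal y) U

/-- The germ of the pull-back of a function. -/
def stalkPull (y : M) : SmoothFn n M →ₐ[ℝ] Stalk (n := n) y := (toStalk n y).comp (pullbackHom n M)

theorem stalkPull_apply (y : M) (f : SmoothFn n M) : stalkPull y f = toStalk n y (pullback f) := rfl

/-- A stalk retains only the infinite jet at a zero covector; that these jets suffice is the
divisibility of flat functions, `mem_flatIdeal_of_forall`. -/
theorem eq_zero_of_toStalk [T2Space M] [SigmaCompactSpace M] {F : FormalFn n M}
    (h : ∀ y, toStalk n y F = 0) : F = 0 := by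
  obtain ⟨G, rfl⟩ := toFormal_surjective F
  refine Ideal.Quotient.eq_zero_iff_mem.2 (mem_flatIdeal_of_forall fun y k => ?_)
  exact toFormal_mem_pow.1 (toSeparation_eq_zero.1 (h y) k)

theorem toStalk_eq_zero_of_mul {y : M} {χ : SmoothFn n M} (hχ : χ y = 1) {F : FormalFn n M}
    (h : pullback χ * F = 0) : toStalk n y F = 0 := by
  refine toSeparation_eq_zero_of_mul (χ := pullback χ) ?_ h
  rw [mem_pointIdeal]
  change 1 - χ y = 0
  rw [hχ, sub_self]

/-- A formal function that does not vanish at a point is invertible near it. -/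
theorem exists_local_inverse {x : M} {F : FormalFn n M} (hF : restrict F x ≠ 0) :
    ∃ K : FormalFn n M, ∀ᶠ y in 𝓝 x, toStalk n y (F * K) = 1 := by
  obtain ⟨G, rfl⟩ := toFormal_surjective F
  set c : ℝ := G ⟨x, 0⟩ with hc
  have hc0 : c ≠ 0 := hF
  obtain ⟨κ, τ, hκ, hτ, hτ0, h⟩ := exists_smooth_inverse
  -- After normalization G' exceeds 3/4 on Z near x, where T therefore vanishes. Then G' K - 1 = (G'
  -- K - 1) T^k has infinite order at all nearby points of Z.
  let G' : SmoothFnCot n M := c⁻¹ • G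
  have hG' : G' ⟨x, 0⟩ = 1 := inv_mul_cancel₀ hc0
  let K : SmoothFnCot n M := ⟨fun p => κ (G' p), hκ.contMDiff.comp G'.contMDiff⟩
  let T : SmoothFnCot n M := ⟨fun p => τ (G' p), hτ.contMDiff.comp G'.contMDiff⟩
  have hev : ∀ᶠ y in 𝓝 x, 3 / 4 < restrictZero G' y := by
    refine (restrictZero G').contMDiff.continuous.continuousAt.eventually_const_lt ?_
    change 3 / 4 < G' ⟨x, 0⟩
    rw [hG']
    norm_num
  refine ⟨toFormal (c⁻¹ • K), ?_⟩
  filter_upwards [hev] with y hy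
  have h1 : toStalk n y (toFormal (G' * K - 1)) = 0 := by
    rw [toSeparation_eq_zero]
    intro k
    rw [toFormal_mem_pow]
    have h2 : G' * K - 1 = (G' * K - 1) * T ^ k := by
      ext p
      exact h (G' p) k
    rw [h2]
    exact Ideal.mul_mem_left _ _ (Ideal.pow_mem_pow (hτ0 _ hy.le) k)
  have h4 : toFormal G * toFormal (c⁻¹ • K) - 1 = toFormal (G' * K - 1) := by
    have : G' * K = G * (c⁻¹ • K) := by
      simp only [G', smul_mul_assoc, mul_smul_comm]
    rw [this]
    rfl
  rw [← sub_eq_zero, ← map_one (toStalk n y), ← map_sub, h4, h1]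

theorem isUnit_toStalk {y : M} {F : FormalFn n M} (hF : restrict F y ≠ 0) :
    IsUnit (toStalk n y F) := by
  obtain ⟨K, hK⟩ := exists_local_inverse hF
  exact isUnit_iff_exists_inv.2 ⟨toStalk n y K, (map_mul _ _ _).symm.trans hK.self_of_nhds⟩

variable [T2Space M]

theorem toStalk_congr {U : Set M} (hU : IsOpen U) {y : M} (hy : y ∈ U) {F G : SmoothFnCot n M}
    (h : ∀ p : CotangentBundle n M, p.1 ∈ U → F p = G p) :
    toStalk n y (toFormal F) = toStalk n y (toFormal G) := by
  obtain ⟨χ, hχ1, hχ⟩ := exists_bump (n := n) hU hy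
  rw [← sub_eq_zero, ← map_sub]
  refine toStalk_eq_zero_of_mul hχ1.self_of_nhds ?_
  have : pullbackFn χ * (F - G) = 0 := by
    ext p
    change χ p.1 * (F p - G p) = 0
    by_cases hp : p.1 ∈ U
    · rw [h p hp, sub_self, mul_zero]
    · rw [image_eq_zero_of_notMem_tsupport fun h => hp (hχ h), zero_mul]
  change toFormal (pullbackFn χ * (F - G)) = 0
  rw [this]
  rfl

theorem stalkPull_congr {y : M} {f g : SmoothFn n M} (h : ∀ᶠ x in 𝓝 y, f x = g x) :
    stalkPull y f = stalkPull y g := by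
  obtain ⟨U, hU, ho, hy⟩ := eventually_nhds_iff.1 h
  exact toStalk_congr (F := pullbackFn f) (G := pullbackFn g) ho hy fun p hp => hU _ hp

theorem toStalk_hatField {W : Set M} (hW : IsOpen W) {e : Fin n → VectorFieldOn n M}
    {ε : Fin n → OneForm n M} (h : DualOn W e ε) {y : M} (hy : y ∈ W) (X : VectorFieldOn n M) :
    toStalk n y (hatField X) =
      ∑ i, stalkPull y (pairing (ε i) X) * toStalk n y (hatField (e i)) := by
  have h1 : toStalk n y (hatField X) = toStalk n y (toFormal
      (∑ i, pullbackFn (pairing (ε i) X) * linearFn (e i))) := by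
    refine toStalk_congr hW hy fun p hp => ?_
    have h2 : (∑ i, pullbackFn (pairing (ε i) X) * linearFn (e i)) p =
        ∑ i, (ε i p.1 (X p.1) : ℝ) * (p.2 (e i p.1) : ℝ) :=
      map_sum (ContMDiffMap.evalRingHom p)
        (fun i => pullbackFn (pairing (ε i) X) * linearFn (e i)) Finset.univ
    rw [h2]
    refine (h.covector_apply hp p.2 (X p.1)).trans (Finset.sum_congr rfl fun i _ => mul_comm _ _)
  rw [h1]
  refine (map_sum ((toStalk n y).toRingHom.comp (Ideal.Quotient.mk (flatIdeal n M)))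
    (fun i => pullbackFn (pairing (ε i) X) * linearFn (e i)) Finset.univ).trans ?_
  exact Finset.sum_congr rfl fun i _ => map_mul _ _ _

end Points

/-! ### Vertical fields and the action of a connection on basic functions -/

section Vertical

variable {n : ℕ} {M : Type*} [TopologicalSpace M] [ChartedSpace (EuclideanSpace ℝ (Fin n)) M]
  [IsManifold (𝓡 n) ∞ M]

theorem hatForm_hatField (α : OneForm n M) (X : VectorFieldOn n M) :
    hatForm α (hatField X) = pullback (pairing α X) := by
  refine (formalOfDerivation_apply _ _).trans (congrArg toFormal ?_)
  ext p
  change deriv (fun t : ℝ => ((p.2 + t • α p.1) (X p.1) : ℝ)) 0 = α p.1 (X p.1)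
  have h : (fun t : ℝ => ((p.2 + t • α p.1) (X p.1) : ℝ)) =
      fun t => (p.2 (X p.1) : ℝ) + t * (α p.1 (X p.1) : ℝ) := by
    funext t
    rfl
  rw [h]
  simp

theorem isVertical_hatForm (α : OneForm n M) : IsVertical (hatForm α) := by
  intro f
  refine (formalOfDerivation_apply _ _).trans ?_
  have : fibreDerivation α (pullbackFn f) = 0 := by
    ext p
    exact deriv_const (0 : ℝ) (f p.1)
  rw [this]
  rfl

namespace FormalConnection

variable {P : PoissonStructure n M} (D : FormalConnection P)

theorem op_pullback_apply (α : OneForm n M) (f : SmoothFn n M) :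
    D.op α (pullback f) = pullback (fieldDeriv (P.sharpField α) f) := by
  have h : D.op α (pullback f * 1) - pullback f * D.op α 1 =
      pullback (fieldDeriv (P.sharpField α) f) * 1 :=
    LinearMap.congr_fun (D.op_pullback α f) (1 : FormalFn n M)
  simpa using h

/-- Only order one of the filtration matters: a fibrewise linear function vanishes on Z, so D^α and
its leading term give it the same restriction. -/
theorem restrict_op_hatField {ψ : CotEnd n M} (h : D.HasLeadingTerm ψ) (α : OneForm n M)
    (X : VectorFieldOn n M) :
    restrict (D.op α (hatField X)) = pairing (ψ.app α) X := by
  have hp : RingHom.ker (restrict (n := n) (M := M)) ^ 1 = RingHom.ker restrict := pow_one _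
  have h1 := h α 1 (hatField X) (by rw [hp]; exact restrict_hatField X)
  rw [hp, RingHom.mem_ker, Derivation.sub_apply, hatForm_hatField, map_sub,
    restrict_pullback, sub_eq_zero] at h1
  exact h1

/-- On pull-backs D^α acts as the vector field #α, and # respects brackets. -/
theorem isVertical_curvature [T2Space M] (α β : OneForm n M) : IsVertical (D.curvature α β) := by
  intro f
  change ⁅D.op α, D.op β⁆ (pullback f) - D.op (P.formBracket α β) (pullback f) = 0
  rw [Derivation.commutator_apply]
  simp only [op_pullback_apply]
  rw [P.fieldDeriv_formBracket]
  simp only [← pullbackHom_apply]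
  rw [map_sub, sub_self]

theorem op_hat_sharp_of_associated {D' : FormalConnection P} (h : D.Associated D')
    (α β : OneForm n M) :
    D'.op α (hatField (P.sharpField β)) =
      D.op β (hatField (P.sharpField α)) + hatField (P.sharpField (P.formBracket α β)) := by
  have h1 : (D'.op α (hatField (P.sharpField β) * 1) - hatField (P.sharpField β) * D'.op α 1) -
      (D.op β (hatField (P.sharpField α) * 1) - hatField (P.sharpField α) * D.op β 1) -
      hatField (P.sharpField (P.formBracket α β)) * 1 = 0 :=
    LinearMap.congr_fun (h α β) (1 : FormalFn n M)
  simp only [mul_one, Derivation.map_one_eq_zero, mul_zero, sub_zero] at h1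
  linear_combination h1

end FormalConnection

end Vertical

theorem LocalCoords.dualOn {n : ℕ} {M : Type*} [TopologicalSpace M]
    [ChartedSpace (EuclideanSpace ℝ (Fin n)) M] [IsManifold (𝓡 n) ∞ M] {x₀ : M}
    (C : LocalCoords (n := n) x₀) : DualOn C.W C.e C.ε := C.dual

/-- Isolates the cancellation in the association condition: a, a' are entries of p, v, v' entries of
the connection matrices, and r, s the derivatives of p, which match the bracket term. -/
theorem sum_mul_eq_of_cancel {S ι : Type*} [CommRing S] [Fintype ι] {a v a' v' ξ r s : ι → S}
    (h : ∑ l, (a l * v l + ξ l * r l) =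
      ∑ l, (a' l * v' l + ξ l * s l) + ∑ l, (r l - s l) * ξ l) :
    ∑ l, v l * a l = ∑ l, a' l * v' l := by
  simp only [Finset.sum_add_distrib, sub_mul, Finset.sum_sub_distrib, mul_comm (ξ _)] at h
  simp only [mul_comm (v _)]
  linear_combination h

/-! ### The kernel of the fibrewise presymplectic form -/

section Kernel

variable {n : ℕ} {M : Type*} [TopologicalSpace M] [ChartedSpace (EuclideanSpace ℝ (Fin n)) M]
  [IsManifold (𝓡 n) ∞ M] {P : PoissonStructure n M}
  {W : Set M} {e : Fin n → VectorFieldOn n M} {ε : Fin n → OneForm n M} {y : M}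

theorem stalkDer_stalkPull {U : FormalVectorField n M} (hU : IsVertical U) (f : SmoothFn n M) :
    stalkDer y U (stalkPull y f) = 0 := by
  rw [stalkPull_apply, separationDerivation_apply, hU f, map_zero]

/-- By skew-symmetry of Π the two halves of dξ_i ∧ dξ_j contribute equally, which absorbs the factor
1/2. -/
theorem localPresymplectic_eq (U V : FormalVectorField n M) :
    localPresymplectic P e ε U V =
      ∑ j, (∑ i, pullback (P.bivector (ε i) (ε j)) * U (hatField (e i))) * V (hatField (e j)) := by
  have hskew : ∀ i j, pullback (P.bivector (ε i) (ε j)) = -pullback (P.bivector (ε j) (ε i)) := by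
    intro i j
    rw [P.bivector_skew]
    rfl
  have h1 : ∀ i j, pullback (P.bivector (ε i) (ε j)) *
      (U (hatField (e i)) * V (hatField (e j)) - U (hatField (e j)) * V (hatField (e i))) =
      pullback (P.bivector (ε i) (ε j)) * U (hatField (e i)) * V (hatField (e j)) +
      pullback (P.bivector (ε j) (ε i)) * U (hatField (e j)) * V (hatField (e i)) := by
    intro i j
    rw [hskew j i]
    ring
  unfold localPresymplectic
  simp only [h1, Finset.sum_add_distrib]
  rw [Finset.sum_comm, ← two_smul ℝ, smul_smul]
  norm_num [Finset.sum_mul]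

variable [T2Space M]

theorem stalkDer_hat_sharp (hW : IsOpen W) (h : DualOn W e ε) (hy : y ∈ W)
    {U : FormalVectorField n M} (hU : IsVertical U) (γ : OneForm n M) :
    stalkDer y U (toStalk n y (hatField (P.sharpField γ))) =
      ∑ i, stalkPull y (P.bivector γ (ε i)) * stalkDer y U (toStalk n y (hatField (e i))) := by
  rw [toStalk_hatField hW h hy, map_sum]
  refine Finset.sum_congr rfl fun i _ => ?_
  rw [Derivation.leibniz, stalkDer_stalkPull hU, smul_zero, add_zero]
  rfl

/-- A vertical U passes through the basic coefficients of the linear function of #ε_j, so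
contracting U ξ_i with Π gives its value on that function up to sign. -/
theorem toStalk_localPresymplectic (hW : IsOpen W) (h : DualOn W e ε) (hy : y ∈ W)
    {U : FormalVectorField n M} (hU : IsVertical U) (V : FormalVectorField n M) :
    toStalk n y (localPresymplectic P e ε U V) =
      -∑ j, toStalk n y (U (hatField (P.sharpField (ε j)))) * toStalk n y (V (hatField (e j))) := by
  have h1 : ∀ j, toStalk n y (U (hatField (P.sharpField (ε j)))) =
      -toStalk n y (∑ i, pullback (P.bivector (ε i) (ε j)) * U (hatField (e i))) := by
    intro j
    rw [← separationDerivation_apply]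
    refine (stalkDer_hat_sharp hW h hy hU (ε j)).trans ?_
    rw [map_sum, ← Finset.sum_neg_distrib]
    refine Finset.sum_congr rfl fun i _ => ?_
    rw [P.bivector_skew, map_neg, separationDerivation_apply, map_mul, stalkPull_apply, neg_mul]
  rw [localPresymplectic_eq, map_sum, ← Finset.sum_neg_distrib]
  refine Finset.sum_congr rfl fun j _ => ?_
  rw [h1, map_mul, neg_mul, neg_neg]

/-- A one-form is a combination of the frame near a point. -/
theorem map_fnSmul_eq_sum {G : Type*} [AddCommGroup G] [Module (Stalk (n := n) y) G]
    (hW : IsOpen W) (h : DualOn W e ε) (hy : y ∈ W) (L : OneForm n M →+ G)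
    (hL : ∀ (f : SmoothFn n M) (α : OneForm n M), L (fnSmul f α) = stalkPull y f • L α)
    (α : OneForm n M) : L α = ∑ i, stalkPull y (pairing α (e i)) • L (ε i) := by
  obtain ⟨χ, hχ1, hχ⟩ := exists_bump (n := n) hW hy
  have h1 : stalkPull y χ = 1 := by
    rw [← map_one (stalkPull y)]
    exact stalkPull_congr hχ1
  have h2 := congrArg L (h.fnSmul_eq_sum
    (fun y hy => image_eq_zero_of_notMem_tsupport fun h => hy (hχ h)) α)
  rw [hL, h1, one_smul, map_sum] at h2
  rw [h2]
  exact Finset.sum_congr rfl fun i _ => by rw [hL, map_mul, h1, one_mul]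

theorem sharpField_fnSmul (f : SmoothFn n M) (α : OneForm n M) :
    hatField (P.sharpField (fnSmul f α)) = pullback f * hatField (P.sharpField α) := by
  refine congrArg toFormal (?_ : _ = pullbackFn f * linearFn (P.sharpField α))
  ext p
  change (p.2 (P.sharp p.1 (f p.1 • α p.1)) : ℝ) = f p.1 * (p.2 (P.sharp p.1 (α p.1)) : ℝ)
  rw [map_smul, map_smul]
  rfl

theorem hatField_add (X Y : VectorFieldOn n M) : hatField (X + Y) = hatField X + hatField Y := by
  refine congrArg toFormal (?_ : _ = linearFn X + linearFn Y)
  ext p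
  exact map_add p.2 (X p.1) (Y p.1)

theorem toStalk_hat_sharp_eq_zero (hW : IsOpen W) (h : DualOn W e ε) (hy : y ∈ W)
    {U : FormalVectorField n M} (hU : IsVertical U)
    (h0 : ∀ j, toStalk n y (U (hatField (P.sharpField (ε j)))) = 0) (γ : OneForm n M) :
    toStalk n y (U (hatField (P.sharpField γ))) = 0 := by
  let L : OneForm n M →+ Stalk (n := n) y :=
    AddMonoidHom.mk' (fun γ => toStalk n y (U (hatField (P.sharpField γ)))) fun α β => by
      rw [P.sharpField_add, hatField_add]
      exact (congrArg (toStalk n y) (Derivation.map_add U _ _)).trans (toSeparation_add _ _)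
  have h5 := map_fnSmul_eq_sum hW h hy L (fun f α => by
    change toStalk n y (U (hatField (P.sharpField (fnSmul f α)))) = _
    rw [sharpField_fnSmul, Derivation.leibniz, hU f, smul_zero, add_zero, smul_eq_mul, map_mul]
    rfl) γ
  refine h5.trans (Finset.sum_eq_zero fun i _ => ?_)
  have : L (ε i) = 0 := h0 i
  rw [this, smul_zero]

/-- A vertical formal vector field is in the kernel of the fibrewise form if and only if it
annihilates the functions defined by the fields `#γ`. -/
theorem inKernel_iff [SigmaCompactSpace M] {U : FormalVectorField n M} (hU : IsVertical U) :
    InKernel P U ↔ ∀ γ : OneForm n M, U (hatField (P.sharpField γ)) = 0 := by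
  constructor
  · intro h γ
    refine eq_zero_of_toStalk fun y => ?_
    obtain ⟨C⟩ := exists_localCoords (n := n) y
    have hyW := C.subset C.mem
    obtain ⟨χ, hχ1, hχ⟩ := exists_bump (n := n) C.isOpen_W hyW
    have h0 : ∀ j, toStalk n y (U (hatField (P.sharpField (C.ε j)))) = 0 := by
      intro j
      -- The test field ∂/∂ξ_j isolates the j-th coefficient of ι(U)Ω.
      have h1 := h C.W C.isOpen_W C.e C.ε C.dualOn χ hχ (hatForm (C.ε j)) (isVertical_hatForm _)
      have h2 := toStalk_eq_zero_of_mul hχ1.self_of_nhds h1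
      rw [toStalk_localPresymplectic C.isOpen_W C.dualOn hyW hU, neg_eq_zero] at h2
      have h3 : ∀ i, toStalk n y (hatForm (C.ε j) (hatField (C.e i))) = if j = i then 1 else 0 := by
        intro i
        rw [hatForm_hatField, ← stalkPull_apply]
        have h4 : (if j = i then (1 : Stalk (n := n) y) else 0) =
            stalkPull y (if j = i then 1 else 0) := by split_ifs <;> simp
        rw [h4]
        refine stalkPull_congr ?_
        filter_upwards [C.isOpen_W.mem_nhds hyW] with z hz
        refine (C.dualOn z hz j i).trans ?_
        split_ifs <;> rfl
      simpa [h3] using h2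
    exact toStalk_hat_sharp_eq_zero C.isOpen_W C.dualOn hyW hU h0 γ
  · intro h W hW e ε hd f hf V hV
    refine eq_zero_of_toStalk fun y => ?_
    rw [map_mul]
    by_cases hy : y ∈ W
    · rw [toStalk_localPresymplectic hW hd hy hU]
      simp [h]
    · have : stalkPull y f = 0 := by
        rw [← map_zero (stalkPull y)]
        refine stalkPull_congr ?_
        filter_upwards [(isClosed_tsupport f).isOpen_compl.mem_nhds fun h => hy (hf h)] with z hz
        exact image_eq_zero_of_notMem_tsupport hz
      rw [← stalkPull_apply, this, zero_mul]

end Kernel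

/-! ### The connection matrix and the formal frame of a stalk -/

section Frame

open Matrix

variable {n : ℕ} {M : Type*} [TopologicalSpace M] [ChartedSpace (EuclideanSpace ℝ (Fin n)) M]
  [IsManifold (𝓡 n) ∞ M] {P : PoissonStructure n M}

theorem derivation_stalkPull (D : FormalConnection P) (α : OneForm n M) (f : SmoothFn n M) (y : M) :
    stalkDer y (D.op α) (stalkPull y f) = stalkPull y (fieldDeriv (P.sharpField α) f) := by
  rw [stalkPull_apply, separationDerivation_apply, D.op_pullback_apply, stalkPull_apply]

namespace LocalCoords

variable {x₀ : M} (C : LocalCoords (n := n) x₀) {y : M}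

/-- The germs of the fibre coordinates. -/
def ξ (y : M) (i : Fin n) : Stalk (n := n) y := toStalk n y (hatField (C.e i))

/-- The germs of the derivations `D^{dx_i}`. -/
def der (D : FormalConnection P) (y : M) (i : Fin n) :
    Derivation ℝ (Stalk (n := n) y) (Stalk (n := n) y) := stalkDer y (D.op (C.ε i))

/-- The germ of the matrix of the Poisson bivector. -/
def bivectorMatrix (P : PoissonStructure n M) (y : M) :
    Matrix (Fin n) (Fin n) (Stalk (n := n) y) :=
  Matrix.of fun i j => stalkPull y (P.bivector (C.ε i) (C.ε j))

theorem transpose_bivectorMatrix : (C.bivectorMatrix P y)ᵀ = -C.bivectorMatrix P y := by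
  ext i j
  change stalkPull y (P.bivector (C.ε j) (C.ε i)) = -stalkPull y (P.bivector (C.ε i) (C.ε j))
  rw [P.bivector_skew, map_neg]

theorem der_coord (D : FormalConnection P) (i j : Fin n) :
    C.der D y i (stalkPull y (C.x j)) = C.bivectorMatrix P y i j :=
  derivation_stalkPull D (C.ε i) (C.x j) y

/-- The matrix of the functions `D^{dx_i} ξ_j`. -/
def frameMatrix (D : FormalConnection P) : Matrix (Fin n) (Fin n) (FormalFn n M) :=
  Matrix.of fun i j => D.op (C.ε i) (hatField (C.e j))

theorem map_frameMatrix (D : FormalConnection P) (y : M) :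
    (toStalk n y).toRingHom.mapMatrix (C.frameMatrix D) =
      Matrix.of (fun i j => C.der D y i (C.ξ y j)) := by
  ext i j
  exact (separationDerivation_apply _ _).symm

/-- On Z the matrix is that of ψ in the coordinate frame; a null row vector would give a nonzero
covector annihilated by ψ. -/
theorem restrict_det_ne_zero {D : FormalConnection P} (h : D.IsInvertible) (hy : y ∈ C.W) :
    restrict (C.frameMatrix D).det y ≠ 0 := by
  obtain ⟨ψ, hψ, hb⟩ := h
  set V := C.frameMatrix D
  let ev : FormalFn n M →+* ℝ :=
    (ContMDiffMap.evalRingHom y).comp (restrict (n := n) (M := M)).toRingHom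
  have h2 : restrict V.det y = (ev.mapMatrix V).det := RingHom.map_det ev V
  rw [h2]
  intro hdet
  obtain ⟨r, hr0, hr⟩ := Matrix.exists_vecMul_eq_zero_iff.2 hdet
  apply hr0
  have h3 : ∀ i j, ev.mapMatrix V i j = (ψ y (C.ε i y) (C.e j y) : ℝ) := fun i j =>
    DFunLike.congr_fun (D.restrict_op_hatField hψ (C.ε i) (C.e j)) y
  have h4 : ψ y (∑ i, r i • C.ε i y) = 0 := by
    rw [C.dualOn.covector_eq_sum hy (ψ y _)]
    refine Finset.sum_eq_zero fun j _ => ?_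
    have h5 : (ψ y (∑ i, r i • C.ε i y) (C.e j y) : ℝ) = (r ᵥ* ev.mapMatrix V) j := by
      have h6 : ψ y (∑ i, r i • C.ε i y) = ∑ i, r i • ψ y (C.ε i y) :=
        (map_sum (ψ y).toLinearMap _ _).trans
          (Finset.sum_congr rfl fun i _ => (ψ y).map_smul (r i) (C.ε i y))
      rw [h6]
      refine (_root_.sum_apply _ _ _).trans ?_
      exact Finset.sum_congr rfl fun i _ => congrArg (r i * ·) (h3 i j).symm
    rw [h5, hr]
    simp
  have h6 : ∑ i, r i • C.ε i y = 0 := (hb y).1 (h4.trans (ψ y).map_zero.symm)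
  funext j
  have h7 := DFunLike.congr_fun h6 (C.e j y)
  have h8 : ((∑ i, r i • C.ε i y) (C.e j y) : ℝ) = r j := by
    refine (_root_.sum_apply _ _ _).trans ?_
    have h3 : ∀ i, ((r i • C.ε i y) (C.e j y) : ℝ) = r i * if i = j then 1 else 0 :=
      fun i => congrArg (r i * ·) (C.dualOn y hy i j)
    exact (Finset.sum_congr rfl fun i _ => h3 i).trans (by simp)
  rw [← h8]
  exact h7

theorem isUnit_matrix {D : FormalConnection P} (h : D.IsInvertible) (hy : y ∈ C.W) :
    IsUnit (Matrix.of (fun i j => C.der D y i (C.ξ y j))) := by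
  rw [Matrix.isUnit_iff_isUnit_det, ← C.map_frameMatrix, ← RingHom.map_det]
  exact isUnit_toStalk (C.restrict_det_ne_zero h hy)

variable [T2Space M]

theorem stalkDer_op (hy : y ∈ C.W) (D : FormalConnection P) (α : OneForm n M) :
    stalkDer y (D.op α) = ∑ i, stalkPull y (pairing α (C.e i)) • C.der D y i := by
  let L : OneForm n M →+ Derivation ℝ (Stalk (n := n) y) (Stalk (n := n) y) :=
    AddMonoidHom.mk' (fun α => stalkDer y (D.op α)) fun α β =>
      (congrArg (stalkDer y) (D.op_add α β)).trans (separationDerivation_add _ _)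
  exact map_fnSmul_eq_sum C.isOpen_W C.dualOn hy L (fun f α =>
    (congrArg (stalkDer y) (D.op_fnSmul f α)).trans (separationDerivation_smul _ _)) α

/-- D_i acts on basic functions through #dx_i = Σ p_ij e_j, so z_j is the germ of e_j f. -/
theorem exists_der_stalkPull (hy : y ∈ C.W) (D : FormalConnection P) (f : SmoothFn n M) :
    ∃ z : Fin n → Stalk (n := n) y, ∀ i,
      C.der D y i (stalkPull y f) = ∑ j, C.bivectorMatrix P y i j * z j := by
  refine ⟨fun j => stalkPull y (fieldDeriv (C.e j) f), fun i => ?_⟩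
  refine (derivation_stalkPull D (C.ε i) f y).trans ?_
  have h1 : stalkPull y (fieldDeriv (P.sharpField (C.ε i)) f) = stalkPull y
      (∑ j, P.bivector (C.ε i) (C.ε j) * fieldDeriv (C.e j) f) := by
    refine stalkPull_congr ?_
    filter_upwards [C.isOpen_W.mem_nhds hy] with z hz
    have h2 : (∑ j, P.bivector (C.ε i) (C.ε j) * fieldDeriv (C.e j) f) z =
        ∑ j, (C.ε j z (P.sharpField (C.ε i) z) : ℝ) * (differential f z (C.e j z) : ℝ) :=
      map_sum (ContMDiffMap.evalRingHom z)
        (fun j => P.bivector (C.ε i) (C.ε j) * fieldDeriv (C.e j) f) Finset.univ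
    rw [h2]
    exact (C.dualOn.covector_apply hz (differential f z) _).trans
      (Finset.sum_congr rfl fun i _ => mul_comm _ _)
  rw [h1, map_sum]
  exact Finset.sum_congr rfl fun j _ => map_mul _ _ _

/-- The linear function of #dx_j is Σ p_jl ξ_l. Its derivatives contain terms where the connections
differentiate p, and these are exactly the coefficients of #[dx_i, dx_j], as # respects brackets. -/
theorem associated_matrix {D D' : FormalConnection P} (h : D.Associated D') (hy : y ∈ C.W) :
    Matrix.of (fun i j => C.der D' y i (C.ξ y j)) * (C.bivectorMatrix P y)ᵀ =
      C.bivectorMatrix P y * (Matrix.of (fun i j => C.der D y i (C.ξ y j)))ᵀ := by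
  ext i j
  rw [Matrix.mul_apply, Matrix.mul_apply]
  have hhat : ∀ γ : OneForm n M, toStalk n y (hatField (P.sharpField γ)) =
      ∑ l, stalkPull y (P.bivector γ (C.ε l)) * C.ξ y l := fun γ =>
    toStalk_hatField C.isOpen_W C.dualOn hy _
  have hD : ∀ (D : FormalConnection P) (i j : Fin n),
      toStalk n y (D.op (C.ε i) (hatField (P.sharpField (C.ε j)))) =
      ∑ l, (C.bivectorMatrix P y j l * C.der D y i (C.ξ y l) +
        C.ξ y l * stalkPull y (fieldDeriv (P.sharpField (C.ε i)) (P.bivector (C.ε j) (C.ε l)))) := by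
    intro D i j
    rw [← separationDerivation_apply]
    refine (congrArg (stalkDer y (D.op (C.ε i))) (hhat (C.ε j))).trans ?_
    rw [map_sum]
    refine Finset.sum_congr rfl fun l _ => ?_
    rw [Derivation.leibniz, derivation_stalkPull]
    rfl
  have h1 := congrArg (toStalk n y) (D.op_hat_sharp_of_associated h (C.ε i) (C.ε j))
  rw [toSeparation_add, hD, hD, hhat] at h1
  have h2 : ∀ l, P.bivector (P.formBracket (C.ε i) (C.ε j)) (C.ε l) =
      fieldDeriv (P.sharpField (C.ε i)) (P.bivector (C.ε j) (C.ε l)) -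
        fieldDeriv (P.sharpField (C.ε j)) (P.bivector (C.ε i) (C.ε l)) := fun l =>
    P.fieldDeriv_formBracket (C.ε i) (C.ε j) (C.x l)
  simp only [h2, map_sub] at h1
  exact sum_mul_eq_of_cancel h1

/-- The expansion of a formal function in the fibre coordinates. -/
theorem exists_uniform_expand (F : FormalFn n M) :
    ∃ c : Fin n → FormalFn n M, ∀ y ∈ C.W₁,
      toStalk n y F = toStalk n y (pullback (restrict F) + ∑ i, c i * hatField (C.e i)) := by
  obtain ⟨G, rfl⟩ := toFormal_surjective F
  -- `param` is defined on the whole model space, so the Hadamard coefficients are global and serve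
  -- all y in W₁ at once.
  obtain ⟨H, hHs, hH⟩ := exists_contDiff_hadamard (C.contDiff_pull G)
  refine ⟨fun i => toFormal (C.push (hHs i)), fun y hy => ?_⟩
  have h1 : toStalk n y (toFormal G) = toStalk n y (toFormal
      (pullbackFn (restrictZero G) + ∑ i, C.push (hHs i) * linearFn (C.e i))) := by
    refine toStalk_congr C.isOpen_W₁ hy fun p hp => ?_
    have h2 : (∑ i, C.push (hHs i) * linearFn (C.e i)) p =
        ∑ i, H i (C.chart p) * (p.2 (C.e i p.1) : ℝ) :=
      map_sum (ContMDiffMap.evalRingHom p) (fun i => C.push (hHs i) * linearFn (C.e i)) Finset.univ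
    change G p = G ⟨p.1, 0⟩ + (∑ i, C.push (hHs i) * linearFn (C.e i)) p
    have h3 := hH (C.chart p).1 (C.chart p).2
    have h4 : C.m (C.φ p.1) = p.1 := C.left_inv p.1 hp
    have h5 : C.param ((C.chart p).1, 0) = ⟨p.1, 0⟩ := by
      rw [C.param_zero]
      change (⟨C.m (C.φ p.1), 0⟩ : CotangentBundle n M) = _
      rw [h4]
    rw [h2, ← h5]
    refine Eq.trans ?_ h3
    exact congrArg G (C.param_chart hp).symm
  rw [h1]
  refine congrArg (toStalk n y) ((RingHom.map_add (Ideal.Quotient.mk (flatIdeal n M)) _ _).trans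
    (congrArg (pullback (restrictZero G) + ·) ?_))
  exact map_sum (Ideal.Quotient.mk (flatIdeal n M))
    (fun i => C.push (hHs i) * linearFn (C.e i)) Finset.univ

theorem exists_expand (hy : y ∈ C.W₁) (F : FormalFn n M) :
    ∃ c : Fin n → Stalk (n := n) y,
      toStalk n y F = stalkPull y (restrict F) + ∑ i, c i * C.ξ y i := by
  obtain ⟨c, hc⟩ := C.exists_uniform_expand F
  refine ⟨fun i => toStalk n y (c i), (hc y hy).trans ?_⟩
  refine (toSeparation_add _ _).trans (congrArg (stalkPull y (restrict F) + ·) ?_)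
  rw [map_sum]
  exact Finset.sum_congr rfl fun i _ => map_mul _ _ _

theorem formalFrame (hy : y ∈ C.W₁) :
    FormalFrame ((pointIdeal y).map (toStalk n y).toRingHom) (Set.range (stalkPull y)) (C.ξ y) where
  separated := separation_separated
  mem i := Ideal.mem_map_of_mem (toStalk n y).toRingHom
    (show hatField (C.e i) ∈ pointIdeal y from rfl)
  expand a := by
    obtain ⟨F, rfl⟩ := toSeparation_surjective (pointIdeal (n := n) y) a
    obtain ⟨c, hc⟩ := C.exists_expand hy F
    exact ⟨_, ⟨_, rfl⟩, c, hc⟩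

end LocalCoords

end Frame

/-! ### Curvature, solvability and involutivity -/

section Solutions

open Matrix

variable {n : ℕ} {M : Type*} [TopologicalSpace M] [T2Space M]
  [ChartedSpace (EuclideanSpace ℝ (Fin n)) M]
  [IsManifold (𝓡 n) ∞ M] {P : PoissonStructure n M} {D D' : FormalConnection P}

theorem LocalCoords.vecMul_bivectorMatrix {x₀ y : M} (C : LocalCoords (n := n) x₀) (hy : y ∈ C.W)
    {U : FormalVectorField n M} (hU : IsVertical U) (j : Fin n) :
    ((fun i => stalkDer y U (C.ξ y i)) ᵥ* C.bivectorMatrix P y) j =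
      -toStalk n y (U (hatField (P.sharpField (C.ε j)))) := by
  rw [← separationDerivation_apply]
  change ∑ i, stalkDer y U (C.ξ y i) * stalkPull y (P.bivector (C.ε i) (C.ε j)) = _
  rw [stalkDer_hat_sharp C.isOpen_W C.dualOn hy hU (C.ε j), ← Finset.sum_neg_distrib]
  refine Finset.sum_congr rfl fun i _ => ?_
  rw [P.bivector_skew, map_neg, mul_neg, mul_comm]
  rfl

/-- If the system `D^α F = 0` is solvable for all initial values, the curvature is in the kernel
of the fibrewise form. -/
theorem inKernel_of_solutions [SigmaCompactSpace M] (hassoc : D.Associated D')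
    (hD : D.IsInvertible)
    (h : ∀ f : SmoothFn n M, ∃ F : FormalFn n M, (∀ α, D.op α F = 0) ∧ restrict F = f)
    (α β : OneForm n M) : InKernel P (D.curvature α β) := by
  have hU := D.isVertical_curvature α β
  refine (inKernel_iff hU).2 fun γ => eq_zero_of_toStalk fun y => ?_
  obtain ⟨C⟩ := exists_localCoords (n := n) y
  have hy := C.subset C.mem
  refine toStalk_hat_sharp_eq_zero C.isOpen_W C.dualOn hy hU (fun j => ?_) γ
  rw [← neg_eq_zero, ← C.vecMul_bivectorMatrix hy hU]
  refine congrFun ((C.formalFrame C.mem).kernel_of_solutions C.transpose_bivectorMatrix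
    (C.associated_matrix hassoc hy) (C.isUnit_matrix hD hy) (x := fun j => stalkPull y (C.x j))
    (fun i => ⟨_, rfl⟩) (fun i j => C.der_coord D i j) ?_ ?_) j
  · rintro _ ⟨f, rfl⟩
    exact stalkDer_stalkPull hU f
  · rintro _ ⟨f, rfl⟩
    obtain ⟨F, hF, rfl⟩ := h f
    obtain ⟨c, hc⟩ := C.exists_expand C.mem F
    refine ⟨c, ?_⟩
    rw [← hc]
    refine ⟨fun i => ?_, ?_⟩
    · refine (separationDerivation_apply _ _).trans ?_
      rw [hF, map_zero]
    · refine (separationDerivation_apply _ _).trans ?_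
      have : D.curvature α β F = 0 := by
        change ⁅D.op α, D.op β⁆ F - D.op (P.formBracket α β) F = 0
        rw [Derivation.commutator_apply, hF, hF, hF, Derivation.map_zero, Derivation.map_zero,
          sub_self, sub_self]
      rw [this, map_zero]

/-- If the curvature is in the kernel of the fibrewise form, the `D^α` span an involutive system
of derivations. -/
theorem LocalCoords.lie_der_mem [SigmaCompactSpace M] (hassoc : D.Associated D')
    (hD : D.IsInvertible) (hD' : D'.IsInvertible) (h : ∀ α β, InKernel P (D.curvature α β))
    {x₀ y : M} (C : LocalCoords (n := n) x₀) (hy : y ∈ C.W₁) (i j : Fin n) :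
    ⁅C.der D y i, C.der D y j⁆ ∈
      Submodule.span (Stalk (n := n) y) (Set.range (C.der D y)) := by
  have hyW := C.subset hy
  have hU := D.isVertical_curvature (C.ε i) (C.ε j)
  have h1 : stalkDer y (D.curvature (C.ε i) (C.ε j)) ∈
      Submodule.span (Stalk (n := n) y) (Set.range (C.der D y)) := by
    refine (C.formalFrame hy).mem_span_of_kernel C.transpose_bivectorMatrix
      (C.associated_matrix hassoc hyW) (C.isUnit_matrix hD hyW) (C.isUnit_matrix hD' hyW) ?_ ?_ ?_
    · rintro _ ⟨f, rfl⟩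
      exact C.exists_der_stalkPull hyW D f
    · rintro _ ⟨f, rfl⟩
      exact stalkDer_stalkPull hU f
    · funext k
      rw [C.vecMul_bivectorMatrix hyW hU, (inKernel_iff hU).1 (h _ _), map_zero, neg_zero]
      rfl
  have h2 : stalkDer y (D.op (P.formBracket (C.ε i) (C.ε j))) ∈
      Submodule.span (Stalk (n := n) y) (Set.range (C.der D y)) := by
    rw [C.stalkDer_op hyW]
    exact Submodule.sum_mem _ fun k _ => Submodule.smul_mem _ _ (Submodule.subset_span ⟨k, rfl⟩)
  -- The bracket is the curvature plus D^{[dx_i, dx_j]}; the latter is in the span by linearity of D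
  -- over functions.
  have h3 : ⁅C.der D y i, C.der D y j⁆ = stalkDer y (D.curvature (C.ε i) (C.ε j)) +
      stalkDer y (D.op (P.formBracket (C.ε i) (C.ε j))) := by
    refine Eq.trans ?_ (separationDerivation_add _ _)
    refine (separationDerivation_lie _ _).symm.trans (congrArg _ ?_)
    exact (sub_add_cancel ⁅D.op (C.ε i), D.op (C.ε j)⁆ (D.op (P.formBracket (C.ε i) (C.ε j)))).symm
  rw [h3]
  exact add_mem h1 h2

/-- The adjugate exists over global formal functions, so inverting the determinant near a point
inverts the matrix in all nearby stalks simultaneously. -/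
theorem map_adjugate_mul {R S ι : Type*} [CommRing R] [CommRing S] [Fintype ι] [DecidableEq ι]
    (φ : R →+* S) {V : Matrix ι ι R} {k : R} (h : φ (V.det * k) = 1) :
    φ.mapMatrix (k • V.adjugate) * φ.mapMatrix V = 1 := by
  rw [← map_mul, Matrix.smul_mul, Matrix.adjugate_mul, smul_smul]
  ext i j
  rw [mul_comm] at h
  change φ (k * V.det * (1 : Matrix ι ι R) i j) = _
  rw [map_mul, h, one_mul, Matrix.one_apply, Matrix.one_apply, apply_ite φ, map_one, map_zero]

/-- Near every point there are combinations of the `D^α` that are dual to the fibre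
coordinates. -/
theorem LocalCoords.exists_dual_derivations (hD : D.IsInvertible) {x₀ : M}
    (C : LocalCoords (n := n) x₀) : ∃ T : Fin n → FormalVectorField n M,
      ∀ᶠ y in 𝓝 x₀, ∃ K : Matrix (Fin n) (Fin n) (Stalk (n := n) y),
        K * Matrix.of (fun i j => C.der D y i (C.ξ y j)) = 1 ∧
          ∀ i, stalkDer y (T i) = ∑ j, K i j • C.der D y j := by
  obtain ⟨k, hk⟩ := exists_local_inverse (C.restrict_det_ne_zero hD (C.subset C.mem))
  set A := k • (C.frameMatrix D).adjugate with hA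
  refine ⟨fun i => ∑ j, A i j • D.op (C.ε j), ?_⟩
  filter_upwards [hk] with y hy
  refine ⟨(toStalk n y).toRingHom.mapMatrix A, ?_, fun i => separationDerivation_sum_smul _ _⟩
  rw [← C.map_frameMatrix]
  exact map_adjugate_mul (toStalk n y).toRingHom hy

end Solutions

/-! ### The degree-by-degree construction of a formal solution -/

section Recursion

variable {B ι : Type*} [CommRing B] [Algebra ℝ B] {ξ : ι → B}
  {H : ℕ → Submodule ℝ B}

/-- Elements of the powers of the ideal of the `ξ_i` have homogeneous leading parts. -/
theorem exists_homogeneous_part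
    (hmul : ∀ j k, ∀ a ∈ H j, ∀ b ∈ H k, a * b ∈ H (j + k))
    (hH0 : ∀ a, ∃ b ∈ H 0, a - b ∈ Ideal.span (Set.range ξ)) (hξ : ∀ i, ξ i ∈ H 1) (k : ℕ) :
    ∀ a ∈ Ideal.span (Set.range ξ) ^ k, ∃ b ∈ H k, a - b ∈ Ideal.span (Set.range ξ) ^ (k + 1) := by
  set I := Ideal.span (Set.range ξ)
  -- In degree one a coefficient may be replaced by its degree-zero part, the error being a product
  -- of two elements of I.
  have h1 : ∀ a ∈ I, ∃ b ∈ H 1, a - b ∈ I ^ 2 := by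
    intro a ha
    induction ha using Submodule.span_induction with
    | mem x hx =>
      obtain ⟨i, rfl⟩ := hx
      exact ⟨_, hξ i, by simp⟩
    | zero => exact ⟨0, zero_mem _, by simp⟩
    | add a b _ _ ha hb =>
      obtain ⟨a', ha', ha⟩ := ha
      obtain ⟨b', hb', hb⟩ := hb
      exact ⟨a' + b', add_mem ha' hb', by rw [add_sub_add_comm]; exact add_mem ha hb⟩
    | smul c a ha' ha =>
      obtain ⟨b, hb, hab⟩ := ha
      obtain ⟨c', hc', hcc⟩ := hH0 c
      have hbI : b ∈ I := by
        have := sub_mem ha' (Ideal.pow_le_self two_ne_zero hab)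
        rwa [sub_sub_cancel] at this
      refine ⟨c' * b, by simpa using hmul 0 1 c' hc' b hb, ?_⟩
      have : c • a - c' * b = c * (a - b) + (c - c') * b := by rw [smul_eq_mul]; ring
      rw [this]
      refine add_mem (Ideal.mul_mem_left _ _ hab) ?_
      rw [pow_two]
      exact Ideal.mul_mem_mul hcc hbI
  induction k with
  | zero => simpa using hH0
  | succ k ih =>
    intro a ha
    rw [pow_succ] at ha
    refine Submodule.mul_induction_on ha (fun x hx y hy => ?_) fun x y hx hy => ?_
    · obtain ⟨x', hx', hxx⟩ := ih x hx
      obtain ⟨y', hy', hyy⟩ := h1 y hy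
      have hxI : x' ∈ I ^ k := by
        have := sub_mem hx (Ideal.pow_le_pow_right (Nat.le_succ k) hxx)
        rwa [sub_sub_cancel] at this
      refine ⟨x' * y', hmul _ _ _ hx' _ hy', ?_⟩
      have : x * y - x' * y' = (x - x') * y + x' * (y - y') := by ring
      rw [this]
      refine add_mem ?_ ?_
      · rw [pow_succ]
        exact Ideal.mul_mem_mul hxx hy
      · rw [show k + 1 + 1 = k + 2 from rfl, pow_add]
        exact Ideal.mul_mem_mul hxI hyy
    · obtain ⟨x', hx', hxx⟩ := hx
      obtain ⟨y', hy', hyy⟩ := hy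
      exact ⟨x' + y', add_mem hx' hy', by rw [add_sub_add_comm]; exact add_mem hxx hyy⟩

variable [Fintype ι] [DecidableEq ι] {T : ι → Derivation ℝ B B}

/-- The terms of a formal solution of `T_i F = 0` for commuting `T_i`. -/
theorem exists_homogeneous_solution (hT : ∀ i j, T i (ξ j) = if i = j then 1 else 0)
    (hcomm : ∀ i j, ⁅T i, T j⁆ = 0)
    (hH : ∀ k, ∀ a ∈ Ideal.span (Set.range ξ) ^ k,
      ∃ b ∈ H k, a - b ∈ Ideal.span (Set.range ξ) ^ (k + 1)) {g : B} (hg : g ∈ H 0) :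
    ∃ p : ℕ → B, p 0 = g ∧ (∀ k, p k ∈ H k) ∧
      ∀ k i, T i (∑ j ∈ Finset.range (k + 1), p j) ∈ Ideal.span (Set.range ξ) ^ k := by
  set I := Ideal.span (Set.range ξ)
  have step : ∀ k g, (∀ i, T i g ∈ I ^ k) → ∃ p ∈ H (k + 1), ∀ i, T i (g + p) ∈ I ^ (k + 1) := by
    intro k g hg
    have h1 : ∑ i, ξ i * T i g ∈ I ^ (k + 1) := by
      rw [pow_succ']
      exact Ideal.sum_mem _ fun i _ => Ideal.mul_mem_mul (frame_mem_span ξ i) (hg i)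
    obtain ⟨b, hb, hsb⟩ := hH _ _ h1
    -- Only the homogeneous part of the correction is kept. The discarded remainder has order k + 2,
    -- and T_i lowers this to k + 1 at worst.
    refine ⟨-(((k : ℝ) + 1)⁻¹ • b), neg_mem (Submodule.smul_mem _ _ hb), fun i => ?_⟩
    have h2 : g + -(((k : ℝ) + 1)⁻¹ • b) = (g - ((k : ℝ) + 1)⁻¹ • ∑ i, ξ i * T i g) +
        ((k : ℝ) + 1)⁻¹ • (∑ i, ξ i * T i g - b) := by
      rw [smul_sub]
      abel
    rw [h2, map_add, Derivation.map_smul]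
    refine add_mem (derivation_correction_mem hT hcomm hg i) ?_
    rw [Algebra.smul_def]
    exact Ideal.mul_mem_left _ _ (derivation_pow (T i) I (k + 1) _ hsb)
  choose! q hq hqT using step
  let G : ℕ → B := fun k => Nat.rec g (fun k G => G + q k G) k
  have hG : ∀ k i, T i (G k) ∈ I ^ k := by
    intro k
    induction k with
    | zero => simp
    | succ k ih => exact hqT k (G k) ih
  let p : ℕ → B := fun k => Nat.casesOn k g fun k => q k (G k)
  refine ⟨p, rfl, fun k => ?_, fun k i => ?_⟩
  · cases k with
    | zero => exact hg
    | succ k => exact hq k (G k) (hG k)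
  · have : ∀ k, ∑ j ∈ Finset.range (k + 1), p j = G k := by
      intro k
      induction k with
      | zero => simp [p, G]
      | succ k ih => rw [Finset.sum_range_succ, ih]
    rw [this]
    exact hG k i

end Recursion

/-! ### Formal functions over a set of points -/

section Family

variable {A κ : Type*} [CommRing A] [Algebra ℝ A] (I : κ → Ideal A)

/-- The quotient of a ring by the intersection of the powers of the ideals of a family. -/
def FamilySeparation : Type _ := A ⧸ (⨅ i, ⨅ k : ℕ, I i ^ k)

instance : CommRing (FamilySeparation I) := inferInstanceAs (CommRing (A ⧸ (⨅ i, ⨅ k : ℕ, I i ^ k)))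

instance : Algebra ℝ (FamilySeparation I) :=
  inferInstanceAs (Algebra ℝ (A ⧸ (⨅ i, ⨅ k : ℕ, I i ^ k)))

/-- The projection to the separation. -/
def toFamily : A →ₐ[ℝ] FamilySeparation I := Ideal.Quotient.mkₐ ℝ (⨅ i, ⨅ k : ℕ, I i ^ k)

theorem toFamily_surjective : Function.Surjective (toFamily I) :=
  Ideal.Quotient.mkₐ_surjective ℝ _

variable {I}

theorem toFamily_eq_zero {a : A} : toFamily I a = 0 ↔ ∀ i, toSeparation (I i) a = 0 := by
  simp only [toSeparation_eq_zero]
  exact Ideal.Quotient.eq_zero_iff_mem.trans (by simp only [Submodule.mem_iInf])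

theorem toFamily_eq {a b : A} :
    toFamily I a = toFamily I b ↔ ∀ i, toSeparation (I i) a = toSeparation (I i) b := by
  rw [← sub_eq_zero, ← map_sub, toFamily_eq_zero]
  exact forall_congr' fun i => by rw [map_sub, sub_eq_zero]

/-- Order in the ξ_j, measured over the whole family, bounds from below the order at each single
point. -/
theorem mem_pow_of_toFamily {ι : Type*} {ξ : ι → A} {i : κ} (hξ : ∀ j, ξ j ∈ I i) {a : A} {k : ℕ}
    (h : toFamily I a ∈ Ideal.span (Set.range fun j => toFamily I (ξ j)) ^ k) : a ∈ I i ^ k := by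
  have hle : Ideal.span (Set.range fun j => toFamily I (ξ j)) ≤
      (I i).map (toFamily I).toRingHom := by
    rw [Ideal.span_le]
    rintro _ ⟨j, rfl⟩
    exact Ideal.mem_map_of_mem (toFamily I).toRingHom (hξ j)
  have h1 := Ideal.pow_right_mono hle k h
  rw [← Ideal.map_pow] at h1
  obtain ⟨b, hb, hab⟩ := (Ideal.mem_map_iff_of_surjective (toFamily I).toRingHom
    (toFamily_surjective I)).1 h1
  have h2 : toFamily I (b - a) = 0 := by
    rw [map_sub, sub_eq_zero]
    exact hab
  have := sub_mem hb (toSeparation_eq_zero.1 (toFamily_eq_zero.1 h2 i) k)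
  rwa [sub_sub_cancel] at this

theorem derivation_family (d : Derivation ℝ A A) {a : A} (ha : toFamily I a = 0) :
    toFamily I (d a) = 0 :=
  toFamily_eq_zero.2 fun i => derivation_separation d (toFamily_eq_zero.1 ha i)

variable (I) in
/-- The derivation of the separation defined by a derivation. -/
def familyDerivation (d : Derivation ℝ A A) :
    Derivation ℝ (FamilySeparation I) (FamilySeparation I) :=
  Derivation.liftOfSurjective (f := toFamily I) (toFamily_surjective I)
    fun _ => derivation_family d

theorem familyDerivation_apply (d : Derivation ℝ A A) (a : A) :
    familyDerivation I d (toFamily I a) = toFamily I (d a) :=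
  Derivation.liftOfSurjective_apply (f := toFamily I) (toFamily_surjective I)
    (fun _ => derivation_family d) a

theorem familyDerivation_lie_eq_zero {d d' : Derivation ℝ A A}
    (h : ∀ i, ⁅separationDerivation (I i) d, separationDerivation (I i) d'⁆ = 0) :
    ⁅familyDerivation I d, familyDerivation I d'⁆ = 0 := by
  ext a
  obtain ⟨a, rfl⟩ := toFamily_surjective I a
  rw [Derivation.commutator_apply]
  simp only [familyDerivation_apply]
  rw [← map_sub, Derivation.zero_apply, toFamily_eq_zero]
  intro i
  have h1 := congrArg (fun U : Derivation ℝ _ _ => U (toSeparation (I i) a)) (h i)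
  simpa only [Derivation.commutator_apply, separationDerivation_apply, Derivation.zero_apply,
    ← map_sub] using h1

/-- A formal solution of `T_i F = 0` for derivations that are dual to `ξ` and commute. -/
theorem exists_family_solution {ι : Type*} [Fintype ι] [DecidableEq ι] {ξ : ι → A}
    {H : ℕ → Submodule ℝ A} {T : ι → Derivation ℝ A A}
    (hT : ∀ l i j, separationDerivation (I l) (T i) (toSeparation (I l) (ξ j)) =
      if i = j then 1 else 0)
    (hcomm : ∀ l i j, ⁅separationDerivation (I l) (T i), separationDerivation (I l) (T j)⁆ = 0)
    (hH : ∀ k, ∀ a, toFamily I a ∈ Ideal.span (Set.range fun j => toFamily I (ξ j)) ^ k →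
      ∃ b ∈ H k, toFamily I (a - b) ∈ Ideal.span (Set.range fun j => toFamily I (ξ j)) ^ (k + 1))
    {g : A} (hg : g ∈ H 0) :
    ∃ p : ℕ → A, toFamily I (p 0) = toFamily I g ∧ (∀ k, p k ∈ H k) ∧
      ∀ k i, toFamily I (T i (∑ j ∈ Finset.range (k + 1), p j)) ∈
        Ideal.span (Set.range fun j => toFamily I (ξ j)) ^ k := by
  have h1 : ∀ i j, familyDerivation I (T i) (toFamily I (ξ j)) = if i = j then 1 else 0 := by
    intro i j
    rw [familyDerivation_apply]
    have h1 : (if i = j then (1 : FamilySeparation I) else 0) =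
        toFamily I (if i = j then 1 else 0) := by split_ifs <;> simp
    rw [h1, toFamily_eq]
    intro l
    rw [← separationDerivation_apply, hT]
    split_ifs <;> simp
  have h2 : ∀ k, ∀ a ∈ Ideal.span (Set.range fun j => toFamily I (ξ j)) ^ k,
      ∃ b ∈ (H k).map (toFamily I).toLinearMap,
        a - b ∈ Ideal.span (Set.range fun j => toFamily I (ξ j)) ^ (k + 1) := by
    intro k a ha
    obtain ⟨a, rfl⟩ := toFamily_surjective I a
    obtain ⟨b, hb, hab⟩ := hH k a ha
    exact ⟨_, Submodule.mem_map_of_mem (f := (toFamily I).toLinearMap) hb, by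
      rw [map_sub] at hab; exact hab⟩
  obtain ⟨p, hp0, hpH, hp⟩ := exists_homogeneous_solution
    (ξ := fun j => toFamily I (ξ j)) (T := fun i => familyDerivation I (T i))
    (H := fun k => (H k).map (toFamily I).toLinearMap) h1
    (fun i j => familyDerivation_lie_eq_zero fun l => hcomm l i j) h2
    (Submodule.mem_map_of_mem (f := (toFamily I).toLinearMap) hg)
  choose q hq hqp using hpH
  have hqp' : ∀ k, toFamily I (q k) = p k := hqp
  refine ⟨q, (hqp' 0).trans hp0, hq, fun k i => ?_⟩
  rw [← familyDerivation_apply, map_sum]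
  simp only [hqp']
  exact hp k i

end Family

/-! ### Fibrewise homogeneous functions -/

section Homogeneous

variable {n : ℕ} {M : Type*} [TopologicalSpace M] [ChartedSpace (EuclideanSpace ℝ (Fin n)) M]
  [IsManifold (𝓡 n) ∞ M]

variable (n M) in
/-- The functions on `T*M` that are homogeneous of degree `k` on the fibres. -/
def homogeneous (k : ℕ) : Submodule ℝ (SmoothFnCot n M) where
  carrier := {F | ∀ (x : M) (t : ℝ) (ξ : CotangentFibre n x), F ⟨x, t • ξ⟩ = t ^ k * F ⟨x, ξ⟩}
  add_mem' {F G} hF hG x t ξ := by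
    change F ⟨x, t • ξ⟩ + G ⟨x, t • ξ⟩ = t ^ k * (F ⟨x, ξ⟩ + G ⟨x, ξ⟩)
    rw [hF, hG, mul_add]
  zero_mem' x t ξ := (mul_zero (t ^ k)).symm
  smul_mem' c F hF x t ξ := by
    change c * F ⟨x, t • ξ⟩ = t ^ k * (c * F ⟨x, ξ⟩)
    rw [hF, mul_left_comm]

variable (n M) in
/-- The formal functions that are homogeneous of degree `k` on the fibres. -/
def formalHomogeneous (k : ℕ) : Submodule ℝ (FormalFn n M) :=
  (homogeneous n M k).map (Ideal.Quotient.mkₐ ℝ (flatIdeal n M)).toLinearMap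

theorem toFormal_mem_formalHomogeneous {k : ℕ} {F : SmoothFnCot n M} (hF : F ∈ homogeneous n M k) :
    toFormal F ∈ formalHomogeneous n M k := ⟨F, hF, rfl⟩

theorem formalHomogeneous_mul (j k : ℕ) : ∀ a ∈ formalHomogeneous n M j,
    ∀ b ∈ formalHomogeneous n M k, a * b ∈ formalHomogeneous n M (j + k) := by
  rintro _ ⟨F, hF, rfl⟩ _ ⟨G, hG, rfl⟩
  refine ⟨F * G, fun x t ξ => ?_, rfl⟩
  change F ⟨x, t • ξ⟩ * G ⟨x, t • ξ⟩ = t ^ (j + k) * (F ⟨x, ξ⟩ * G ⟨x, ξ⟩)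
  rw [hF, hG, pow_add]
  ring

theorem pullback_mem (f : SmoothFn n M) : pullback f ∈ formalHomogeneous n M 0 :=
  toFormal_mem_formalHomogeneous fun x t ξ => by
    rw [pow_zero, one_mul]
    rfl

theorem hatField_mem (X : VectorFieldOn n M) : hatField X ∈ formalHomogeneous n M 1 :=
  toFormal_mem_formalHomogeneous fun x t ξ => by
    rw [pow_one]
    rfl

/-- The ideals of the points of a subset of `M`. -/
abbrev pointIdeals (O : Set M) (y : O) : Ideal (FormalFn n M) := pointIdeal (y : M)

/-- The ideal of the fibre coordinates over a subset of `M`. -/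
abbrev LocalCoords.fibreIdeal {x₀ : M} (C : LocalCoords (n := n) x₀) (O : Set M) :
    Ideal (FamilySeparation (pointIdeals (n := n) O)) :=
  Ideal.span (Set.range fun j => toFamily (pointIdeals O) (hatField (C.e j)))

variable [T2Space M]

/-- The uniform Hadamard expansion shows that the restriction to Z is a degree-zero part modulo the
ξ_j. -/
theorem LocalCoords.exists_homogeneous_part {x₀ : M} (C : LocalCoords (n := n) x₀) {O : Set M}
    (hO : O ⊆ C.W₁) (k : ℕ) (a : FormalFn n M)
    (ha : toFamily (pointIdeals O) a ∈ C.fibreIdeal O ^ k) :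
    ∃ b ∈ formalHomogeneous n M k,
      toFamily (pointIdeals O) (a - b) ∈ C.fibreIdeal O ^ (k + 1) := by
  have h0 : ∀ a : FormalFn n M,
      toFamily (pointIdeals O) a - toFamily (pointIdeals O) (pullback (restrict a)) ∈
        C.fibreIdeal O := by
    intro a
    obtain ⟨c, hc⟩ := C.exists_uniform_expand a
    have h1 : toFamily (pointIdeals O) a = toFamily (pointIdeals O)
        (pullback (restrict a) + ∑ i, c i * hatField (C.e i)) :=
      toFamily_eq.2 fun y => hc y (hO y.2)
    rw [h1, ← map_sub, add_sub_cancel_left, map_sum]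
    refine Ideal.sum_mem _ fun i _ => ?_
    rw [map_mul]
    exact Ideal.mul_mem_left _ _
      (frame_mem_span (fun j => toFamily (pointIdeals O) (hatField (C.e j))) i)
  obtain ⟨_, ⟨b, hb, rfl⟩, hab⟩ := FormalPoisson.exists_homogeneous_part
    (H := fun k => (formalHomogeneous n M k).map (toFamily (pointIdeals O)).toLinearMap)
    (ξ := fun j => toFamily (pointIdeals O) (hatField (C.e j))) (by
      rintro j k _ ⟨a, ha, rfl⟩ _ ⟨b, hb, rfl⟩
      exact ⟨a * b, formalHomogeneous_mul j k a ha b hb, map_mul (toFamily (pointIdeals O)) a b⟩)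
    (by
      intro a
      obtain ⟨a, rfl⟩ := toFamily_surjective (pointIdeals O) a
      exact ⟨_, ⟨_, pullback_mem (restrict a), rfl⟩, h0 a⟩)
    (fun i => ⟨_, hatField_mem (C.e i), rfl⟩) k _ ha
  refine ⟨b, hb, ?_⟩
  rw [map_sub]
  exact hab

end Homogeneous

/-! ### Order of vanishing along rays in the fibres -/

section Rays

open Asymptotics

variable {n : ℕ} {M : Type*} [TopologicalSpace M] [T2Space M]
  [ChartedSpace (EuclideanSpace ℝ (Fin n)) M] [IsManifold (𝓡 n) ∞ M]

theorem differentiable_ray (G : SmoothFnCot n M) {y : M} (ξ : CotangentFibre n y) :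
    Differentiable ℝ fun t : ℝ => G ⟨y, t • ξ⟩ := by
  obtain ⟨C⟩ := exists_localCoords (n := n) y
  have h1 : ∀ t : ℝ, G ⟨y, t • ξ⟩ = G (C.param (C.φ y, t • (C.chart ⟨y, ξ⟩).2)) := by
    intro t
    rw [← C.chart_smul, C.param_chart C.mem]
  simp only [h1]
  have h2 : Differentiable ℝ fun t : ℝ => ((C.φ y, t • (C.chart ⟨y, ξ⟩).2) : CoordModel n) := by
    fun_prop
  exact ((C.contDiff_pull G).differentiable (by simp)).comp h2

/-- Each factor from the ideal is differentiable along the ray and zero at its origin, hence O(t).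
-/
theorem isBigO_ray {y : M} {k : ℕ} (ξ : CotangentFibre n y) : ∀ G ∈ cotPointIdeal (n := n) y ^ k,
    (fun t : ℝ => G ⟨y, t • ξ⟩) =O[𝓝 0] fun t => t ^ k := by
  induction k with
  | zero =>
    intro G _
    simp only [pow_zero]
    exact (differentiable_ray G ξ).continuous.continuousAt.isBigO_one ℝ
  | succ k ih =>
    intro G hG
    rw [pow_succ] at hG
    refine Submodule.mul_induction_on hG (fun a ha b hb => ?_) fun a b ha hb => ha.add hb
    have h1 : (fun t : ℝ => b ⟨y, t • ξ⟩) =O[𝓝 0] fun t => t := by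
      have h2 := (differentiable_ray b ξ 0).isBigO_sub
      have h3 : b ⟨y, 0⟩ = 0 := hb
      simpa [h3] using h2
    exact ((ih a ha).mul h1).congr_right fun t => (pow_succ t k).symm

theorem eq_zero_of_isBigO_ray {y : M} {k : ℕ} {ξ : CotangentFibre n y} {G : SmoothFnCot n M}
    (hG : G ∈ homogeneous n M k) (h : (fun t : ℝ => G ⟨y, t • ξ⟩) =O[𝓝 0] fun t => t ^ (k + 1)) :
    G ⟨y, ξ⟩ = 0 := by
  by_contra hne
  have h1 : ∀ t : ℝ, G ⟨y, t • ξ⟩ = t ^ k * G ⟨y, ξ⟩ := fun t => hG y t ξ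
  simp only [h1] at h
  have h2 : (fun t : ℝ => t ^ k) =o[𝓝 0] fun t : ℝ => t ^ k := by
    refine IsBigO.trans_isLittleO ?_ (isLittleO_pow_pow (Nat.lt_succ_self k))
    have h3 := h.mul (isBigO_refl (fun _ : ℝ => (G ⟨y, ξ⟩)⁻¹) (𝓝 0))
    simp only [mul_assoc, mul_inv_cancel₀ hne, mul_one] at h3
    refine h3.trans ?_
    simpa only [mul_comm] using
      (isBigO_refl (fun t : ℝ => t ^ (k + 1)) (𝓝 0)).const_mul_left (G ⟨y, ξ⟩)⁻¹
  refine isLittleO_irrefl ?_ h2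
  have h4 : ∃ᶠ t : ℝ in 𝓝 0, t ≠ 0 := by
    have : ∀ᶠ t : ℝ in 𝓝[≠] 0, t ≠ 0 := eventually_mem_nhdsWithin
    exact this.frequently.filter_mono nhdsWithin_le_nhds
  exact h4.mono fun t ht => pow_ne_zero k ht

/-- A function that vanishes to order `k` along all rays in the fibres lies in the `k`-th power of
the ideal of the fibre coordinates. -/
theorem LocalCoords.mem_fibreIdeal_of_isBigO {x₀ : M} (C : LocalCoords (n := n) x₀) {O : Set M}
    (ho : IsOpen O) (hO : O ⊆ C.W₁) {k : ℕ} {G : SmoothFnCot n M}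
    (hG : ∀ y ∈ O, ∀ ξ : CotangentFibre n y, (fun t : ℝ => G ⟨y, t • ξ⟩) =O[𝓝 0] fun t => t ^ k) :
    toFamily (pointIdeals O) (toFormal G) ∈ C.fibreIdeal O ^ k := by
  suffices h : ∀ j ≤ k, toFamily (pointIdeals O) (toFormal G) ∈ C.fibreIdeal O ^ j from h k le_rfl
  intro j
  induction j with
  | zero => simp
  | succ j ih =>
    intro hj
    -- The leading part Q in degree j < k must vanish over O: G and G - Q are both O(t^(j+1)) on
    -- rays, while Q is homogeneous of degree j.
    obtain ⟨_, ⟨Q, hQ, rfl⟩, hGQ⟩ := C.exists_homogeneous_part hO j _ (ih (Nat.le_of_succ_le hj))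
    have h1 : ∀ y ∈ O, ∀ ξ : CotangentFibre n y, Q ⟨y, ξ⟩ = 0 := by
      intro y hy ξ
      have h2 : toFormal (G - Q) ∈ pointIdeal (n := n) y ^ (j + 1) :=
        mem_pow_of_toFamily (I := pointIdeals O) (i := ⟨y, hy⟩)
          (fun j => (show hatField (C.e j) ∈ pointIdeal y from rfl)) hGQ
      have h3 := isBigO_ray ξ _ (toFormal_mem_pow.1 h2)
      refine eq_zero_of_isBigO_ray hQ ?_
      have h4 : (fun t : ℝ => G ⟨y, t • ξ⟩) =O[𝓝 0] fun t => t ^ (j + 1) :=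
        (hG y hy ξ).trans (IsBigO.of_bound 1 (by
          filter_upwards [Metric.ball_mem_nhds (0 : ℝ) one_pos] with t ht
          rw [one_mul, norm_pow, norm_pow]
          exact pow_le_pow_of_le_one (norm_nonneg t) (mem_ball_zero_iff.1 ht).le hj))
      refine (h4.sub h3).congr_left fun t => ?_
      change G ⟨y, t • ξ⟩ - (G ⟨y, t • ξ⟩ - Q ⟨y, t • ξ⟩) = _
      rw [sub_sub_cancel]
    have h5 : toFamily (pointIdeals O) (toFormal Q) = 0 := by
      rw [toFamily_eq_zero]
      intro y
      exact (toStalk_congr (F := Q) (G := 0) ho y.2 fun p hp => h1 p.1 hp p.2).trans (map_zero _)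
    have h6 : toFamily (pointIdeals O) (toFormal G) -
        toFamily (pointIdeals O) (toFormal Q) ∈ C.fibreIdeal O ^ (j + 1) := by
      rw [← map_sub]
      exact hGQ
    rwa [h5, sub_zero] at h6

end Rays

/-! ### Existence and uniqueness of solutions -/

section Solutions

open Asymptotics Matrix

variable {n : ℕ} {M : Type*} [TopologicalSpace M] [T2Space M]
  [ChartedSpace (EuclideanSpace ℝ (Fin n)) M] [IsManifold (𝓡 n) ∞ M]

/-- Borel's theorem along the fibres of `T*M`. -/
theorem LocalCoords.exists_borel {x₀ : M} (C : LocalCoords (n := n) x₀)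
    {Q : ℕ → SmoothFnCot n M} (hQ : ∀ k, Q k ∈ homogeneous n M k) :
    ∃ F : SmoothFnCot n M, ∀ y ∈ C.W₁, C.φ y ∈ Metric.ball (C.φ x₀) 1 →
      ∀ (ξ : CotangentFibre n y) (k : ℕ),
        (fun t : ℝ => (F - ∑ j ∈ Finset.range k, Q j) ⟨y, t • ξ⟩) =O[𝓝 0] fun t => t ^ k := by
  -- The bump in the base gives the terms the compact base support required by Borel's lemma; it is
  -- 1 where F is used.
  let b : ContDiffBump (C.φ x₀) := ⟨1, 2, one_pos, one_lt_two⟩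
  let p : ℕ → CoordModel n → ℝ := fun k z => b z.1 * Q k (C.param z)
  obtain ⟨F, hF, h⟩ := exists_contDiff_borel (P := p)
    (fun k => (b.contDiff.comp contDiff_fst).mul (C.contDiff_pull (Q k)))
    (fun k y t η => by
      change b y * Q k (C.param (y, t • η)) = t ^ k * (b y * Q k (C.param (y, η)))
      rw [C.param_smul]
      exact (congrArg (b y * ·) (hQ k _ t (C.param (y, η)).2)).trans (mul_left_comm _ _ _))
    (isCompact_closedBall (C.φ x₀) 2)
    (fun k y η hy => by
      have : b y = 0 := b.zero_of_le_dist (not_le.1 hy).le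
      change b y * _ = 0
      rw [this, zero_mul])
  refine ⟨C.push hF, fun y hy hyb ξ k => ?_⟩
  have h1 : ∀ t : ℝ, C.chart ⟨y, t • ξ⟩ = (C.φ y, t • (C.chart ⟨y, ξ⟩).2) := fun t =>
    C.chart_smul y t ξ
  refine (h k (C.φ y) (C.chart ⟨y, ξ⟩).2).congr_left fun t => ?_
  have h2 : (C.push hF - ∑ j ∈ Finset.range k, Q j) ⟨y, t • ξ⟩ =
      F (C.chart ⟨y, t • ξ⟩) - ∑ j ∈ Finset.range k, Q j ⟨y, t • ξ⟩ :=
    congrArg (F (C.chart ⟨y, t • ξ⟩) - ·)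
      (map_sum (ContMDiffMap.evalRingHom (⟨y, t • ξ⟩ : CotangentBundle n M)) Q (Finset.range k))
  rw [h2, h1]
  congr 1
  refine Finset.sum_congr rfl fun j _ => ?_
  have h3 : b (C.φ y) = 1 := b.one_of_mem_closedBall (Metric.ball_subset_closedBall hyb)
  change b (C.φ y) * _ = _
  rw [h3, one_mul, ← h1, C.param_chart hy]

variable {P : PoissonStructure n M} {D D' : FormalConnection P}

theorem derivation_dual {A ι : Type*} [CommRing A] [Algebra ℝ A] [Fintype ι] [DecidableEq ι]
    {d : ι → Derivation ℝ A A} {ξ : ι → A} {K : Matrix ι ι A}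
    (hK : K * Matrix.of (fun i j => d i (ξ j)) = 1) (i j : ι) :
    (∑ l, K i l • d l) (ξ j) = if i = j then 1 else 0 := by
  rw [derivation_sum_smul_apply, ← Matrix.one_apply, ← hK]
  rfl

theorem derivation_eq_zero_of_dual {A ι : Type*} [CommRing A] [Algebra ℝ A] [Fintype ι]
    [DecidableEq ι] {d : ι → Derivation ℝ A A} {ξ : ι → A} {K : Matrix ι ι A}
    (hK : K * Matrix.of (fun i j => d i (ξ j)) = 1) {a : A}
    (ha : ∀ i, (∑ l, K i l • d l) a = 0) (i : ι) : d i a = 0 := by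
  have h1 : K *ᵥ (fun l => d l a) = 0 := by
    funext i
    refine Eq.trans ?_ (ha i)
    rw [derivation_sum_smul_apply]
    rfl
  have h2 : (fun l => d l a) = 0 := by
    rw [← Matrix.one_mulVec (fun l => d l a), ← mul_eq_one_comm.1 hK, ← Matrix.mulVec_mulVec, h1,
      Matrix.mulVec_zero]
  exact congrFun h2 i

/-- Solutions of `D^α F = 0` with the same initial values agree. -/
theorem toStalk_eq_of_solutions (hD : D.IsInvertible) {y : M} {F G : FormalFn n M}
    (hF : ∀ α, toStalk n y (D.op α F) = 0) (hG : ∀ α, toStalk n y (D.op α G) = 0)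
    (h : ∀ᶠ z in 𝓝 y, restrict F z = restrict G z) : toStalk n y F = toStalk n y G := by
  obtain ⟨C⟩ := exists_localCoords (n := n) y
  obtain ⟨K, hVK⟩ := (C.isUnit_matrix hD (C.subset C.mem)).exists_right_inv
  have hK := mul_eq_one_comm.1 hVK
  rw [← sub_eq_zero, ← map_sub]
  -- Agreement of the restrictions near y, not only at y, puts the difference into the ideal of the
  -- ξ_i: the stalk remembers the whole jet along Z.
  refine (C.formalFrame C.mem).eq_zero_of_forall_eq_zero (derivation_dual hK) ?_ fun i => ?_
  · obtain ⟨c, hc⟩ := C.exists_expand C.mem (F - G)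
    have h1 : stalkPull y (restrict (F - G)) = 0 := by
      rw [← map_zero (stalkPull y)]
      refine stalkPull_congr ?_
      filter_upwards [h] with z hz
      rw [map_sub]
      exact sub_eq_zero.2 hz
    rw [hc, h1, zero_add]
    exact Ideal.sum_mem _ fun i _ => Ideal.mul_mem_left _ _ (frame_mem_span _ i)
  · rw [derivation_sum_smul_apply]
    refine Finset.sum_eq_zero fun j _ => ?_
    have h2 : C.der D y j (toStalk n y (F - G)) = 0 := by
      refine (separationDerivation_apply _ _).trans ?_
      rw [Derivation.map_sub, map_sub, hF, hG, sub_zero]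
    rw [h2, mul_zero]

/-- Local solutions of `D^α F = 0` exist. -/
theorem exists_local_solution [SigmaCompactSpace M] (hassoc : D.Associated D')
    (hD : D.IsInvertible) (hD' : D'.IsInvertible) (hR : ∀ α β, InKernel P (D.curvature α β))
    (f : SmoothFn n M) (x₀ : M) : ∃ (F : SmoothFnCot n M) (O : Set M), IsOpen O ∧ x₀ ∈ O ∧
      ∀ y ∈ O, F ⟨y, 0⟩ = f y ∧ ∀ α, toStalk n y (D.op α (toFormal F)) = 0 := by
  obtain ⟨C⟩ := exists_localCoords (n := n) x₀
  obtain ⟨T, hT⟩ := C.exists_dual_derivations hD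
  obtain ⟨O₁, hO₁, hO₁o, hxO₁⟩ := eventually_nhds_iff.1 hT
  let O : Set M := (O₁ ∩ C.W₁) ∩ C.φ ⁻¹' Metric.ball (C.φ x₀) 1
  have hOo : IsOpen O := (hO₁o.inter C.isOpen_W₁).inter
    (Metric.isOpen_ball.preimage C.φ.contMDiff.continuous)
  have hxO : x₀ ∈ O := ⟨⟨hxO₁, C.mem⟩, Metric.mem_ball_self one_pos⟩
  have hOW : O ⊆ C.W₁ := fun y hy => hy.1.2
  choose K hK hKT using fun y : O => hO₁ y y.2.1.1
  -- The recursion runs over all of O at once, so that its terms are represented by smooth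
  -- functions; solutions in separate stalks need not fit together.
  obtain ⟨p, hp0, hpH, hp⟩ := exists_family_solution (I := pointIdeals O)
    (ξ := fun j => hatField (C.e j)) (H := formalHomogeneous n M) (T := T)
    (fun y i j => by
      refine Eq.trans ?_ (derivation_dual (hK y) i j)
      exact congrArg (fun U : Derivation ℝ _ _ => U (C.ξ y j)) (hKT y i))
    (fun y i j => by
      refine Eq.trans ?_ (lie_eq_zero_of_dual (hK y)
        (C.lie_der_mem hassoc hD hD' hR (hOW y.2)) i j)
      exact congrArg₂ (fun U V : Derivation ℝ _ _ => ⁅U, V⁆) (hKT y i) (hKT y j))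
    (C.exists_homogeneous_part hOW) (pullback_mem f)
  choose Q hQ hQp using hpH
  have hQp' : ∀ k, toFormal (Q k) = p k := hQp
  obtain ⟨F, hF⟩ := C.exists_borel hQ
  have hsum : ∀ k, toFormal (F - ∑ j ∈ Finset.range k, Q j) =
      toFormal F - ∑ j ∈ Finset.range k, p j := by
    intro k
    refine (map_sub (Ideal.Quotient.mk (flatIdeal n M)) _ _).trans
      (congrArg (toFormal F - ·) ?_)
    refine (map_sum (Ideal.Quotient.mk (flatIdeal n M)) Q (Finset.range k)).trans ?_
    exact Finset.sum_congr rfl fun j _ => hQp' j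
  have hξ : ∀ y : M, ∀ j, hatField (C.e j) ∈ pointIdeal (n := n) y := fun y j => rfl
  -- The ray estimates of Borel's lemma become membership in ideal powers through
  -- `mem_fibreIdeal_of_isBigO`.
  have hmem : ∀ (y : O) k, toFormal F - ∑ j ∈ Finset.range k, p j ∈
      pointIdeal (n := n) (y : M) ^ k := by
    intro y k
    rw [← hsum]
    exact mem_pow_of_toFamily (I := pointIdeals O) (i := y) (hξ y)
      (C.mem_fibreIdeal_of_isBigO hOo hOW fun z hz ξ => hF z (hOW hz) hz.2 ξ k)
  refine ⟨F, O, hOo, hxO, fun y hy => ⟨?_, ?_⟩⟩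
  · have h1 := mem_pointIdeal.1 (Ideal.pow_le_self one_ne_zero (hmem ⟨y, hy⟩ 1))
    rw [Finset.sum_range_one, map_sub] at h1
    have h2 := toSeparation_eq_zero.1 (toFamily_eq_zero.1
      (show toFamily (pointIdeals O) (p 0 - pullback f) = 0 by
        rw [map_sub, hp0, sub_self]) ⟨y, hy⟩) 1
    rw [pow_one, mem_pointIdeal, map_sub] at h2
    exact (sub_eq_zero.1 h1).trans (sub_eq_zero.1 h2)
  · have hT0 : ∀ i, toStalk n y (T i (toFormal F)) = 0 := by
      intro i
      rw [toSeparation_eq_zero]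
      intro k
      -- The remainder after k + 1 terms loses one order under T_i, and T_i of the partial sum has
      -- order k by construction.
      have h1 := derivation_pow (T i) _ k _ (hmem ⟨y, hy⟩ (k + 1))
      have h2 := mem_pow_of_toFamily (I := pointIdeals O) (i := ⟨y, hy⟩) (hξ y) (hp k i)
      have h3 := add_mem h1 h2
      rwa [Derivation.map_sub, sub_add_cancel] at h3
    intro α
    rw [← separationDerivation_apply]
    -- The T_i are an invertible transform of the D_i, and these span every D^α in the stalk.
    have h1 : ∀ i, C.der D y i (toStalk n y (toFormal F)) = 0 :=
      derivation_eq_zero_of_dual (hK ⟨y, hy⟩) fun i => by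
        rw [← hKT ⟨y, hy⟩ i]
        exact (separationDerivation_apply _ _).trans (hT0 i)
    have h2 := congrArg (fun U : Derivation ℝ (Stalk (n := n) y) (Stalk (n := n) y) =>
      U (toStalk n y (toFormal F))) (C.stalkDer_op (C.subset (hOW hy)) D α)
    refine h2.trans ((derivation_sum_smul_apply _ _ _).trans ?_)
    exact Finset.sum_eq_zero fun i _ => by rw [h1, mul_zero]

/-- Gluing of functions with equal germs. -/
theorem toStalk_glue [SigmaCompactSpace M] {ι : Type*} (ρ : SmoothPartitionOfUnity ι (𝓡 n) M Set.univ)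
    (H : ι → SmoothFnCot n M) {y : M} {G : FormalFn n M}
    (h : ∀ i, y ∈ tsupport (ρ i) → toStalk n y (toFormal (H i)) = toStalk n y G) :
    toStalk n y (toFormal (glue ρ H)) = toStalk n y G := by
  obtain ⟨G, rfl⟩ := toFormal_surjective G
  obtain ⟨s, hs⟩ := ρ.toPartitionOfUnity.exists_finset_nhds y
  obtain ⟨U, hU, hUo, hyU⟩ := eventually_nhds_iff.1 hs
  let r : ι → SmoothFn n M := ρ
  -- As Σ ρ_i = 1, the glued function is G + Σ ρ_i (H_i - G) near y. Each summand has zero germ: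
  -- either H_i and G agree in the stalk or ρ_i vanishes near y.
  have h1 : toStalk n y (toFormal (glue ρ H)) = toStalk n y (toFormal
      (G + ∑ i ∈ s, pullbackFn (r i) * (H i - G))) := by
    refine toStalk_congr hUo hyU fun q hq => ?_
    have h2 : (G + ∑ i ∈ s, pullbackFn (r i) * (H i - G)) q =
        G q + ∑ i ∈ s, ρ i q.1 * (H i q - G q) :=
      congrArg (G q + ·) (map_sum (ContMDiffMap.evalRingHom q)
        (fun i => pullbackFn (r i) * (H i - G)) s)
    have h3 : ∑ i ∈ s, ρ i q.1 = 1 := (hU _ hq).1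
    have h4 : ∑ᶠ i, ρ i q.1 * H i q = ∑ i ∈ s, ρ i q.1 * H i q := by
      refine finsum_eq_sum_of_support_subset _ fun i hi => (hU _ hq).2 ?_
      have h5 : ρ i q.1 * H i q ≠ 0 := hi
      exact left_ne_zero_of_mul h5
    rw [h2, glue_apply, h4]
    simp only [mul_sub, Finset.sum_sub_distrib, ← Finset.sum_mul, h3, one_mul]
    ring
  have h2 : toStalk n y (toFormal (∑ i ∈ s, pullbackFn (r i) * (H i - G))) = 0 := by
    refine (map_sum ((toStalk n y).toRingHom.comp (Ideal.Quotient.mk (flatIdeal n M)))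
      (fun i => pullbackFn (r i) * (H i - G)) s).trans (Finset.sum_eq_zero fun i _ => ?_)
    refine (map_mul (toStalk n y) (pullback (r i)) (toFormal (H i) - toFormal G)).trans ?_
    by_cases hy : y ∈ tsupport (ρ i)
    · rw [map_sub, h i hy, sub_self, mul_zero]
    · have h3 : stalkPull y (r i) = 0 := by
        rw [← map_zero (stalkPull y)]
        refine stalkPull_congr ?_
        filter_upwards [(isClosed_tsupport (ρ i)).isOpen_compl.mem_nhds hy] with z hz
        exact image_eq_zero_of_notMem_tsupport hz
      rw [← stalkPull_apply, h3, zero_mul]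
  rw [h1]
  refine (toSeparation_add (toFormal G) (toFormal (∑ i ∈ s, pullbackFn (r i) * (H i - G)))).trans ?_
  rw [h2, add_zero]

/-- If the curvature is in the kernel of the fibrewise form, the system `D^α F = 0` is solvable
for all initial values. -/
theorem exists_solution [SigmaCompactSpace M] (hassoc : D.Associated D')
    (hD : D.IsInvertible) (hD' : D'.IsInvertible) (hR : ∀ α β, InKernel P (D.curvature α β))
    (f : SmoothFn n M) : ∃ F : FormalFn n M, (∀ α, D.op α F = 0) ∧ restrict F = f := by
  choose H O hOo hxO hH using exists_local_solution hassoc hD hD' hR f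
  obtain ⟨ρ, hρ⟩ := exists_partition (n := n) hOo hxO
  -- Uniqueness makes the local solutions around y agree in the stalk, so the glued function has the
  -- jet of a solution there.
  have key : ∀ y, ∃ i, y ∈ O i ∧
      toStalk n y (toFormal (glue ρ H)) = toStalk n y (toFormal (H i)) := by
    intro y
    refine ⟨y, hxO y, toStalk_glue ρ H fun i hi => ?_⟩
    refine toStalk_eq_of_solutions hD (hH i y (hρ i hi)).2 (hH y y (hxO y)).2 ?_
    filter_upwards [(hOo i).mem_nhds (hρ i hi), (hOo y).mem_nhds (hxO y)] with z hz hz'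
    exact (hH i z hz).1.trans (hH y z hz').1.symm
  refine ⟨toFormal (glue ρ H), fun α => eq_zero_of_toStalk fun y => ?_, ?_⟩
  · obtain ⟨i, hi, h⟩ := key y
    rw [← separationDerivation_apply, h, separationDerivation_apply, (hH i y hi).2]
  · ext y
    obtain ⟨i, hi, h⟩ := key y
    have h1 := toSeparation_eq_zero.1 (show toStalk n y
      (toFormal (glue ρ H) - toFormal (H i)) = 0 by rw [map_sub, h, sub_self]) 1
    rw [pow_one, mem_pointIdeal, map_sub] at h1
    exact (sub_eq_zero.1 h1).trans (hH i y hi).1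

theorem solution_unique [SigmaCompactSpace M] (hD : D.IsInvertible) {F G : FormalFn n M}
    (hF : ∀ α, D.op α F = 0) (hG : ∀ α, D.op α G = 0) (h : restrict F = restrict G) : F = G := by
  rw [← sub_eq_zero]
  refine eq_zero_of_toStalk fun y => ?_
  rw [map_sub, sub_eq_zero]
  refine toStalk_eq_of_solutions hD (fun α => ?_) (fun α => ?_) ?_
  · rw [hF, map_zero]
  · rw [hG, map_zero]
  · exact Eventually.of_forall fun z => by rw [h]

end Solutions

end FormalPoisson

end

theorem theoremT (n : ℕ) (M : Type*) [TopologicalSpace M] [T2Space M] [SigmaCompactSpace M]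
    [ChartedSpace (EuclideanSpace ℝ (Fin n)) M] [IsManifold (𝓡 n) ∞ M]
    (P : FormalPoisson.PoissonStructure n M) (D D' : FormalPoisson.FormalConnection P)
    (hassoc : D.Associated D') (hD : D.IsInvertible) (hD' : D'.IsInvertible) :
    (∀ f : FormalPoisson.SmoothFn n M, ∃! F : FormalPoisson.FormalFn n M,
        (∀ α : FormalPoisson.OneForm n M, D.op α F = 0) ∧
          FormalPoisson.restrict F = FormalPoisson.restrict (FormalPoisson.pullback f)) ↔
      ∀ α β : FormalPoisson.OneForm n M, FormalPoisson.InKernel P (D.curvature α β) := by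
  constructor
  · intro h
    refine FormalPoisson.inKernel_of_solutions hassoc hD fun f => ?_
    obtain ⟨F, hF, -⟩ := h f
    exact ⟨F, hF⟩
  · intro h f
    obtain ⟨F, hF, hFf⟩ := FormalPoisson.exists_solution hassoc hD hD' h f
    exact ⟨F, ⟨hF, hFf⟩, fun G hG =>
      FormalPoisson.solution_unique hD hG.1 hF (hG.2.trans hFf.symm)⟩
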